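/- Let $\mathbb K=\mathbb R$ or $\mathbb C$; all vector spaces are finite dimensional over $\mathbb K$. **Conventions.** A bivector $\Lambda$ on $W$ is identified with an alternating bilinear form on $W^*$; $\mathrm{Im}\,\Lambda=\Lambda(W^*,\cdot)\subset W$, its dimension is the rank of $\Lambda$ and its codimension the corank. The 2-form associated to $\Lambda$ is the symplectic form $\omega_\Lambda$ on $\mathrm{Im}\,\Lambda$ with $\omega_\Lambda(\Lambda(\alpha,\cdot),\Lambda(\beta,\cdot))=\Lambda(\alpha,\beta)$. The bivector dual to a symplectic form $\omega$ is the transport of $\omega$ by $v\mapsto\omega(v,\cdot)$. For a pair of symplectic forms $(\omega,\omega_1)$ let $J$ be given by $\omega_1(v,w)=\omega(Jv,w)$; the characteristic polynomial and the elementary divisors (powers of monic irreducible polynomials over $\mathbb K$) of $(\omega,\omega_1)$ are those of $J$. The rank of a pair $(\Lambda,\Lambda_1)$ is $\max_{t\in\mathbb K}\mathrm{rank}((1-t)\Lambda+t\Lambda_1)$, its corank is $\dim W$ minus its rank, and the pair is *maximal* if $\mathrm{rank}\,\Lambda=\mathrm{rank}\,\Lambda_1=\mathrm{rank}(\Lambda,\Lambda_1)$.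 A family $w=\{w(t)\}_{t\in\mathbb K}$ of subspaces of $V$ is a *Veronese web of codimension $r$ with characteristic numbers* $n_1,\dots,n_r\ge 1$ if there is a basis $\{e_{ij}\}$, $1\le i\le n_j$, $1\le j\le r$, of $V^*$ with $w(t)=\mathrm{Ker}(\gamma_1(t)\wedge\dots\wedge\gamma_r(t))$ for all $t$, where $\gamma_j(t)=\sum_{i=1}^{n_j}t^{i-1}e_{ij}$ (if $r=0$ this means $V=0$). *Kronecker elementary pair of dimension $2n-1$* $(n\ge1)$: choose distinct non-zero scalars $b_1,\dots,b_n$; on $\mathbb K^{2n}$ with basis $e_1,\dots,e_{2n}$ let $\Omega=\sum_{j=1}^n e^*_{2j-1}\wedge e^*_{2j}$ and $\Omega_1=\sum_{j=1}^n b_j\,e^*_{2j-1}\wedge e^*_{2j}$; the pair consists of the images of the dual bivectors of $\Omega,\Omega_1$ on $\mathbb K^{2n}/\mathbb K\big(\sum_{j=1}^n e_{2j}\big)$. **Proposition.** Let $(\Lambda,\Lambda_1)$ be a maximal pair of bivectors on $W$ and $r=\mathrm{corank}(\Lambda,\Lambda_1)$. Let $L_0$ be the intersection of all subspaces $\mathrm{Im}(\Lambda+t\Lambda_1)$,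 $t\in\mathbb K$, of codimension $r$, and $L_0'\subset W^*$ its annihilator. (a) $L_0\subset\mathrm{Im}\,\Lambda_1$ and $\Lambda(L_0',\cdot)=\Lambda_1(L_0',\cdot)$. Set $L_1=\Lambda(L_0',\cdot)$. (b) $L_0\subset \mathrm{Im}\,\Lambda\cap\mathrm{Im}\,\Lambda_1$, and the restrictions to $L_0$ of the 2-forms associated to $\Lambda$ and $\Lambda_1$ both have kernel $L_1$. Hence they project onto symplectic forms $\bar\omega,\bar\omega_1$ on $L_0/L_1$. (c) Letting $w(t)$ be the image of $\mathrm{Im}(\Lambda+t\Lambda_1)$ in $W/L_0$, for $t\in\mathbb K$, defines a Veronese web $w$ of codimension $r$ on $W/L_0$. (d) If $n_1,\dots,n_r$ are characteristic numbers of $w$, then $(\Lambda,\Lambda_1,W)$ is isomorphic to the product of the dual pair of $(\bar\omega,\bar\omega_1)$ on $L_0/L_1$ and of the Kronecker elementary pairs of dimensions $2n_1-1,\dots,2n_r-1$, whatever the scalars $b_j$ used to construct each of the latter. Moreover two maximal pairs are isomorphic if and only if their pairs $(\bar\omega,\bar\omega_1)$ have the same elementary divisors and their webs have the same characteristic numbers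 (up to order). (e) For every $a\in\mathbb K$, $\mathrm{corank}(\Lambda+a\Lambda_1)>r$ if and only if $-a$ is a root of the characteristic polynomial of $(\bar\omega,\bar\omega_1)$. -/

import Mathlib

/-! # Pairs of bivectors and algebraic Veronese webs

A bivector on a finite-dimensional space `W` is an alternating bilinear form on the dual space
`Module.Dual 𝕜 W` (the canonical identification of `Λ²W` with the 2-forms on `W*`).
-/

open Module Polynomial

open scoped DirectSum

namespace BivectorPair

noncomputable section

section Bivectors

variable {𝕜 W E F : Type*} [Field 𝕜] [AddCommGroup W] [Module 𝕜 W] [AddCommGroup E] [Module 𝕜 E]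
  [AddCommGroup F] [Module 𝕜 F]

/-- The image of a bivector under a linear map `π`: `(π_*Λ)(α, β) = Λ(α ∘ π, β ∘ π)`. -/
def pushforward (π : E →ₗ[𝕜] F) (Λ : LinearMap.BilinForm 𝕜 (Dual 𝕜 E)) :
    LinearMap.BilinForm 𝕜 (Dual 𝕜 F) :=
  Λ.compl₁₂ π.dualMap π.dualMap

/-- Two pairs of bivectors are isomorphic if a linear isomorphism carries one onto the other. -/
def Isomorphic (Λ Λ₁ : LinearMap.BilinForm 𝕜 (Dual 𝕜 E))
    (Θ Θ₁ : LinearMap.BilinForm 𝕜 (Dual 𝕜 F)) : Prop :=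
  ∃ φ : E ≃ₗ[𝕜] F, pushforward φ.toLinearMap Λ = Θ ∧ pushforward φ.toLinearMap Λ₁ = Θ₁

/-- The product of a bivector on `E` and a bivector on `F`, a bivector on `E × F`. -/
def prodBivector (Λ : LinearMap.BilinForm 𝕜 (Dual 𝕜 E)) (Θ : LinearMap.BilinForm 𝕜 (Dual 𝕜 F)) :
    LinearMap.BilinForm 𝕜 (Dual 𝕜 (E × F)) :=
  pushforward (LinearMap.inl 𝕜 E F) Λ + pushforward (LinearMap.inr 𝕜 E F) Θ

/-- The product of a finite family of bivectors. -/
def piBivector {ι : Type*} [Fintype ι] [DecidableEq ι] {G : ι → Type*}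
    [∀ i, AddCommGroup (G i)] [∀ i, Module 𝕜 (G i)]
    (Λ : ∀ i, LinearMap.BilinForm 𝕜 (Dual 𝕜 (G i))) :
    LinearMap.BilinForm 𝕜 (Dual 𝕜 (∀ i, G i)) :=
  ∑ i, pushforward (LinearMap.single 𝕜 G i) (Λ i)

variable [FiniteDimensional 𝕜 W] [FiniteDimensional 𝕜 E]

/-- The map `α ↦ Λ(α, ·)` from `W*` to `W** = W`. -/
def sharp (Λ : LinearMap.BilinForm 𝕜 (Dual 𝕜 W)) : Dual 𝕜 W →ₗ[𝕜] W :=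
  (evalEquiv 𝕜 W).symm.toLinearMap ∘ₗ Λ

theorem apply_sharp (Λ : LinearMap.BilinForm 𝕜 (Dual 𝕜 W)) (α β : Dual 𝕜 W) :
    β (sharp Λ α) = Λ α β := by
  simp [sharp]

/-- The image `Im Λ = Λ(W*, ·)`. -/
def image (Λ : LinearMap.BilinForm 𝕜 (Dual 𝕜 W)) : Submodule 𝕜 W :=
  LinearMap.range (sharp Λ)

/-- The rank of a bivector. -/
def bivectorRank (Λ : LinearMap.BilinForm 𝕜 (Dual 𝕜 W)) : ℕ := finrank 𝕜 (image Λ)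

/-- The corank of a bivector. -/
def corank (Λ : LinearMap.BilinForm 𝕜 (Dual 𝕜 W)) : ℕ := finrank 𝕜 W - bivectorRank Λ

/-- The rank of a pair: the maximum of the ranks of `(1 - t)Λ + tΛ₁`. -/
def pairRank (Λ Λ₁ : LinearMap.BilinForm 𝕜 (Dual 𝕜 W)) : ℕ :=
  ⨆ t : 𝕜, bivectorRank ((1 - t) • Λ + t • Λ₁)

/-- The corank of a pair. -/
def pairCorank (Λ Λ₁ : LinearMap.BilinForm 𝕜 (Dual 𝕜 W)) : ℕ := finrank 𝕜 W - pairRank Λ Λ₁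

/-- A maximal pair of bivectors. -/
structure IsMaximal (Λ Λ₁ : LinearMap.BilinForm 𝕜 (Dual 𝕜 W)) : Prop where
  alt : Λ.IsAlt
  alt₁ : Λ₁.IsAlt
  rank_eq : bivectorRank Λ = pairRank Λ Λ₁
  rank₁_eq : bivectorRank Λ₁ = pairRank Λ Λ₁

/-- A linear section of `W* → Im Λ`, used to define `imageForm`. -/
def imageSection (Λ : LinearMap.BilinForm 𝕜 (Dual 𝕜 W)) : image Λ →ₗ[𝕜] Dual 𝕜 W :=
  ((sharp Λ).rangeRestrict.exists_rightInverse_of_surjective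
    (LinearMap.range_rangeRestrict _)).choose

theorem sharp_imageSection (Λ : LinearMap.BilinForm 𝕜 (Dual 𝕜 W)) (v : image Λ) :
    sharp Λ (imageSection Λ v) = v := by
  have h := ((sharp Λ).rangeRestrict.exists_rightInverse_of_surjective
    (LinearMap.range_rangeRestrict _)).choose_spec
  exact congrArg Subtype.val (LinearMap.congr_fun h v)

/-- The 2-form on `Im Λ` associated to `Λ`; by `imageForm_sharp` it is the form `ω` with
`ω(Λ(α, ·), Λ(β, ·)) = Λ(α, β)`. -/
def imageForm (Λ : LinearMap.BilinForm 𝕜 (Dual 𝕜 W)) : LinearMap.BilinForm 𝕜 (image Λ) :=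
  Λ.compl₁₂ (imageSection Λ) (imageSection Λ)

theorem imageForm_sharp {Λ : LinearMap.BilinForm 𝕜 (Dual 𝕜 W)} (hΛ : Λ.IsAlt) (α β : Dual 𝕜 W) :
    imageForm Λ ((sharp Λ).rangeRestrict α) ((sharp Λ).rangeRestrict β) = Λ α β := by
  have key : ∀ a b c : Dual 𝕜 W, sharp Λ a = sharp Λ b → Λ a c = Λ b c := by
    intro a b c h
    rw [← apply_sharp, ← apply_sharp, h]
  calc imageForm Λ ((sharp Λ).rangeRestrict α) ((sharp Λ).rangeRestrict β)
      = Λ (imageSection Λ ((sharp Λ).rangeRestrict α))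
          (imageSection Λ ((sharp Λ).rangeRestrict β)) := rfl
    _ = Λ α (imageSection Λ ((sharp Λ).rangeRestrict β)) :=
        key _ _ _ (sharp_imageSection Λ _)
    _ = - Λ (imageSection Λ ((sharp Λ).rangeRestrict β)) α := (hΛ.neg_eq _ _).symm
    _ = - Λ β α := congrArg Neg.neg (key _ _ _ (sharp_imageSection Λ _))
    _ = Λ α β := hΛ.neg_eq _ _

/-- The restriction to `L ⊆ Im Λ` of the 2-form associated to `Λ`. -/
def restrictedForm (Λ : LinearMap.BilinForm 𝕜 (Dual 𝕜 W)) {L : Submodule 𝕜 W} (h : L ≤ image Λ) :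
    LinearMap.BilinForm 𝕜 L :=
  (imageForm Λ).compl₁₂ (Submodule.inclusion h) (Submodule.inclusion h)

/-- The subspace `L₀`: the intersection of all `Im(Λ + tΛ₁)` whose codimension is the corank of
the pair. -/
def core (Λ Λ₁ : LinearMap.BilinForm 𝕜 (Dual 𝕜 W)) : Submodule 𝕜 W :=
  ⨅ t ∈ {t : 𝕜 | corank (Λ + t • Λ₁) = pairCorank Λ Λ₁}, image (Λ + t • Λ₁)

/-- The subspace `L₁ = Λ(L₀', ·)`, where `L₀'` is the annihilator of `L₀` in `W*`. -/
def coreKernel (Λ Λ₁ : LinearMap.BilinForm 𝕜 (Dual 𝕜 W)) : Submodule 𝕜 W :=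
  (core Λ Λ₁).dualAnnihilator.map (sharp Λ)

/-- The quotient `L₀ / L₁`. -/
abbrev ReducedSpace (Λ Λ₁ : LinearMap.BilinForm 𝕜 (Dual 𝕜 W)) : Type _ :=
  core Λ Λ₁ ⧸ (coreKernel Λ Λ₁).submoduleOf (core Λ Λ₁)

/-- The family `t ↦ Im(Λ + tΛ₁) / L₀` of subspaces of `W / L₀`: the images of the subspaces
`Im(Λ + tΛ₁)` under the projection `W → W / L₀`. -/
def web (Λ Λ₁ : LinearMap.BilinForm 𝕜 (Dual 𝕜 W)) (t : 𝕜) : Submodule 𝕜 (W ⧸ core Λ Λ₁) :=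
  (image (Λ + t • Λ₁)).map (core Λ Λ₁).mkQ

/-- The bivector dual to a nondegenerate 2-form `ω`, obtained by transporting `ω` along
`v ↦ ω(v, ·)`. -/
def dualBivector (ω : LinearMap.BilinForm 𝕜 E) (h : ω.Nondegenerate) :
    LinearMap.BilinForm 𝕜 (Dual 𝕜 E) :=
  ω.compl₁₂ (ω.toDual h).symm.toLinearMap (ω.toDual h).symm.toLinearMap

end Bivectors

/-- A pair of symplectic forms on a vector space. -/
structure SymplecticPair (𝕜 E : Type*) [Field 𝕜] [AddCommGroup E] [Module 𝕜 E] where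
  ω : LinearMap.BilinForm 𝕜 E
  ω₁ : LinearMap.BilinForm 𝕜 E
  alt : ω.IsAlt
  alt₁ : ω₁.IsAlt
  nondeg : ω.Nondegenerate
  nondeg₁ : ω₁.Nondegenerate

namespace SymplecticPair

variable {𝕜 E : Type*} [Field 𝕜] [AddCommGroup E] [Module 𝕜 E] [FiniteDimensional 𝕜 E]

/-- The endomorphism `J` with `ω₁(v, w) = ω(J v, w)`. -/
def endo (σ : SymplecticPair 𝕜 E) : Module.End 𝕜 E :=
  σ.ω₁.symmCompOfNondegenerate σ.ω σ.nondeg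

theorem ω_endo (σ : SymplecticPair 𝕜 E) (v w : E) : σ.ω (σ.endo v) w = σ.ω₁ v w :=
  σ.ω₁.symmCompOfNondegenerate_left_apply σ.nondeg w v

/-- The characteristic polynomial of the pair. -/
def charpoly (σ : SymplecticPair 𝕜 E) : 𝕜[X] := LinearMap.charpoly σ.endo

/-- The multiset `s` is the family of elementary divisors of the pair, i.e. of `J`: with `X` acting
as `J`, the `𝕜[X]`-module `E` is the direct sum of the `𝕜[X] / (q)`, `q ∈ s`, where each `q` is a
power of a monic irreducible polynomial with positive exponent. -/
def HasElementaryDivisors (σ : SymplecticPair 𝕜 E) (s : Multiset 𝕜[X]) : Prop :=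
  ∃ (k : ℕ) (p : Fin k → 𝕜[X]) (e : Fin k → ℕ),
    (∀ i, (p i).Monic ∧ Irreducible (p i) ∧ 0 < e i) ∧
    s = Finset.univ.val.map (fun i => p i ^ e i) ∧
    Nonempty (Module.AEval' σ.endo ≃ₗ[𝕜[X]] ⨁ i : Fin k, 𝕜[X] ⧸ Ideal.span {p i ^ e i})

/-- The bivector dual to `ω`. -/
def dual (σ : SymplecticPair 𝕜 E) : LinearMap.BilinForm 𝕜 (Dual 𝕜 E) :=
  dualBivector σ.ω σ.nondeg

/-- The bivector dual to `ω₁`. -/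
def dual₁ (σ : SymplecticPair 𝕜 E) : LinearMap.BilinForm 𝕜 (Dual 𝕜 E) :=
  dualBivector σ.ω₁ σ.nondeg₁

end SymplecticPair

/-- `σ` is the pair of forms on `L₀ / L₁` onto which the restrictions to `L₀` of the 2-forms
associated to `Λ` and `Λ₁` project. -/
def IsReducedPair {𝕜 W : Type*} [Field 𝕜] [AddCommGroup W] [Module 𝕜 W] [FiniteDimensional 𝕜 W]
    (Λ Λ₁ : LinearMap.BilinForm 𝕜 (Dual 𝕜 W)) (σ : SymplecticPair 𝕜 (ReducedSpace Λ Λ₁)) : Prop :=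
  ∃ (h : core Λ Λ₁ ≤ image Λ) (h₁ : core Λ Λ₁ ≤ image Λ₁), ∀ x y : core Λ Λ₁,
    σ.ω (Submodule.Quotient.mk x) (Submodule.Quotient.mk y) = restrictedForm Λ h x y ∧
    σ.ω₁ (Submodule.Quotient.mk x) (Submodule.Quotient.mk y) = restrictedForm Λ₁ h₁ x y

section VeroneseWebs

variable {𝕜 V : Type*} [Field 𝕜] [AddCommGroup V] [Module 𝕜 V]

/-- The Veronese curve `γ(t) = γ₁(t) ∧ … ∧ γᵣ(t)`, `γⱼ(t) = ∑ᵢ t^(i-1) eᵢⱼ`, of a basis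
`(eᵢⱼ)`, `1 ≤ i ≤ nⱼ`, `1 ≤ j ≤ r` (the indices `i` and `j` start from `0` in the code). -/
def veroneseCurve {r : ℕ} {n : Fin r → ℕ} (e : Basis (Σ j : Fin r, Fin (n j)) 𝕜 V) (t : 𝕜) :
    ⋀[𝕜]^r V :=
  exteriorPower.ιMulti 𝕜 r (fun j => ∑ i : Fin (n j), t ^ (i : ℕ) • e ⟨j, i⟩)

/-- The kernel of an `r`-form `θ`: the vectors `v` such that `θ` vanishes on every `r`-tuple
of vectors in which `v` occurs. -/
def formKer {r : ℕ} (θ : ⋀[𝕜]^r (Dual 𝕜 V)) : Set V :=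
  {v | ∀ m : Fin r → V, v ∈ Set.range m →
    exteriorPower.pairingDual 𝕜 V r θ (exteriorPower.ιMulti 𝕜 r m) = 0}

/-- The family `w` is a Veronese web of codimension `r` with characteristic numbers
`n₁, …, nᵣ`. (The degenerate case `r = 0`, `V = 0` is allowed.) -/
def HasCharacteristicNumbers (w : 𝕜 → Submodule 𝕜 V) {r : ℕ} (n : Fin r → ℕ) : Prop :=
  (∀ j, 0 < n j) ∧ ∃ e : Basis (Σ j : Fin r, Fin (n j)) 𝕜 (Dual 𝕜 V),
    ∀ t, (w t : Set V) = formKer (veroneseCurve e t)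

/-- Algebraic Veronese webs of codimension `r`. -/
def IsVeroneseWeb (r : ℕ) (w : 𝕜 → Submodule 𝕜 V) : Prop :=
  ∃ n : Fin r → ℕ, HasCharacteristicNumbers w n

end VeroneseWebs

section Kronecker

variable {𝕜 : Type*} [Field 𝕜] {n : ℕ}

/-- The 2-form `∑ⱼ bⱼ e*₂ⱼ₋₁ ∧ e*₂ⱼ` on the `2n`-dimensional space `(𝕜 × 𝕜)ⁿ`, where
`e*₂ⱼ₋₁` and `e*₂ⱼ` are the first and second coordinate in the `j`-th factor. -/
def weightedForm (b : Fin n → 𝕜) : LinearMap.BilinForm 𝕜 (Fin n → 𝕜 × 𝕜) :=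
  LinearMap.mk₂ 𝕜 (fun x y => ∑ j, b j * ((x j).1 * (y j).2 - (x j).2 * (y j).1))
    (fun x x' y => by
      rw [← Finset.sum_add_distrib]
      exact Finset.sum_congr rfl fun j _ => by simp only [Pi.add_apply, Prod.fst_add, Prod.snd_add]; ring)
    (fun c x y => by
      rw [Finset.smul_sum]
      exact Finset.sum_congr rfl fun j _ => by
        simp only [Pi.smul_apply, Prod.smul_fst, Prod.smul_snd, smul_eq_mul]; ring)
    (fun x y y' => by
      rw [← Finset.sum_add_distrib]
      exact Finset.sum_congr rfl fun j _ => by simp only [Pi.add_apply, Prod.fst_add, Prod.snd_add]; ring)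
    (fun c x y => by
      rw [Finset.smul_sum]
      exact Finset.sum_congr rfl fun j _ => by
        simp only [Pi.smul_apply, Prod.smul_fst, Prod.smul_snd, smul_eq_mul]; ring)

theorem weightedForm_apply (b : Fin n → 𝕜) (x y : Fin n → 𝕜 × 𝕜) :
    weightedForm b x y = ∑ j, b j * ((x j).1 * (y j).2 - (x j).2 * (y j).1) := rfl

theorem weightedForm_isAlt (b : Fin n → 𝕜) : (weightedForm b).IsAlt := fun x => by
  rw [weightedForm_apply]
  exact Finset.sum_eq_zero fun j _ => by ring

theorem weightedForm_nondegenerate {b : Fin n → 𝕜} (hb : ∀ j, b j ≠ 0) :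
    (weightedForm b).Nondegenerate := by
  have hs : ∀ x, (∀ y, weightedForm b x y = 0) → x = 0 := by
    intro x hx
    funext j
    have h1 := hx (Pi.single j (0, 1))
    have h2 := hx (Pi.single j (1, 0))
    rw [weightedForm_apply, Finset.sum_eq_single j (fun i _ hi => by simp [hi]) (by simp)] at h1 h2
    simp [hb j] at h1 h2
    exact Prod.ext h1 h2
  refine ⟨hs, fun y hy => hs y fun x => ?_⟩
  rw [← (weightedForm_isAlt b).neg_eq, hy x, neg_zero]

/-- The pair `Ω = ∑ⱼ e*₂ⱼ₋₁ ∧ e*₂ⱼ`, `Ω₁ = ∑ⱼ bⱼ e*₂ⱼ₋₁ ∧ e*₂ⱼ`. -/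
def weightedPair (b : Fin n → 𝕜) (hb : ∀ j, b j ≠ 0) : SymplecticPair 𝕜 (Fin n → 𝕜 × 𝕜) where
  ω := weightedForm 1
  ω₁ := weightedForm b
  alt := weightedForm_isAlt 1
  alt₁ := weightedForm_isAlt b
  nondeg := weightedForm_nondegenerate fun _ => one_ne_zero
  nondeg₁ := weightedForm_nondegenerate hb

variable (𝕜 n) in
/-- The line `E₀` spanned by `-∑ⱼ e₂ⱼ`. -/
def kroneckerLine : Submodule 𝕜 (Fin n → 𝕜 × 𝕜) := 𝕜 ∙ (fun _ => (0, -1))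

variable (𝕜 n) in
/-- The space of dimension `2n - 1` (for `n ≥ 1`) of the Kronecker elementary pair. -/
abbrev KroneckerSpace : Type _ := (Fin n → 𝕜 × 𝕜) ⧸ kroneckerLine 𝕜 n

/-- First bivector of the Kronecker elementary pair with weights `b`: the image on
`KroneckerSpace 𝕜 n` of the bivector dual to `Ω`. -/
def kronecker (b : Fin n → 𝕜) (hb : ∀ j, b j ≠ 0) :
    LinearMap.BilinForm 𝕜 (Dual 𝕜 (KroneckerSpace 𝕜 n)) :=
  pushforward (kroneckerLine 𝕜 n).mkQ (weightedPair b hb).dual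

/-- Second bivector of the Kronecker elementary pair with weights `b`: the image on
`KroneckerSpace 𝕜 n` of the bivector dual to `Ω₁`. -/
def kronecker₁ (b : Fin n → 𝕜) (hb : ∀ j, b j ≠ 0) :
    LinearMap.BilinForm 𝕜 (Dual 𝕜 (KroneckerSpace 𝕜 n)) :=
  pushforward (kroneckerLine 𝕜 n).mkQ (weightedPair b hb).dual₁

end Kronecker

end

end BivectorPair

open BivectorPair

/-! Dualise: the pair becomes a pencil Λ + tΛ₁ of alternating forms on W*, and Im(Λ + tΛ₁) is the
annihilator of its kernel. So L₀ is the annihilator of S = `kernelSpan`, the sum of the kernels of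
least dimension. By semicontinuity of kernel dimensions (`finite_finrank_ker_lt`,
`ker_le_of_infinite`), finitely many parameters can be discarded without shrinking S, and ker Λ₁,
the kernel at infinity, also lies in S. Since Λ = -tΛ₁ on the kernel at t, Λ(S) = Λ₁(S); since
kernels at distinct parameters are orthogonal for both forms, S is isotropic and L₁ ⊆ L₀. This gives
(a) and (b).

A pencil spanned by its generic kernels has only Kronecker blocks of column type.
`exists_isChainBasis` proves this by induction, replacing the pencil S ⇉ L by L ⇉ (L × L)/S, which
shortens every chain by one. In a chain basis the kernel at t is spanned by the vectors ∑ tⁱ eⱼᵢ,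
which is (c). Inside S the kernel has dimension r for every t, so a jump in corank comes from a
kernel vector outside S, and such vectors give the eigenvectors of J on L₀/L₁: this is (e).

For the decomposition (`exists_isKroneckerSplitting`), W* is enlarged by r dimensions so that the r
kernel curves leave the kernel except at prescribed parameters -bⱼᵢ. At each such parameter the
extended pencil acquires an explicit plane in its kernel. These planes are mutually orthogonal; the
vectors of their sum that lie in W* form the Kronecker models, and the orthogonal complement Z is
the dual of L₀/L₁. Splitting a model itself with other weights shows that the weights do not matter.

It remains to classify symplectic pairs by elementary divisors. A vector v whose annihilator is the
minimal polynomial of J and a dual vector w span a J-invariant symplectic subspace whose structure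
depends only on that polynomial. The complement inherits the remaining dimensions of ker f(J), and
`IsSkewHamiltonian.exists_equiv` concludes by induction. -/

namespace BivectorPair

/-! ### Semicontinuity and generic kernels in pencils of linear maps. -/

section Pencils

variable {𝕜 U Y : Type*} [Field 𝕜] [AddCommGroup U] [Module 𝕜 U] [FiniteDimensional 𝕜 U]
  [AddCommGroup Y] [Module 𝕜 Y]

/-- Semicontinuity of the dimension of the kernel in a pencil of linear maps. -/
theorem finite_finrank_ker_lt (A B : U →ₗ[𝕜] Y) :
    {t : 𝕜 | finrank 𝕜 (LinearMap.ker A) < finrank 𝕜 (LinearMap.ker (A + t • B))}.Finite := by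
  -- On a complement C of ker A the map A has a left inverse P. A kernel at t larger than ker A
  -- meets C, and a common vector is an eigenvector of PB on C for -1/t; an endomorphism has
  -- finitely many eigenvalues.
  obtain ⟨C, hC⟩ := (LinearMap.ker A).exists_isCompl
  obtain ⟨P, hP⟩ := (A ∘ₗ C.subtype).exists_leftInverse_of_injective (by
    rw [LinearMap.ker_eq_bot']
    intro m hm
    have : (m : U) ∈ LinearMap.ker A ⊓ C := ⟨hm, m.2⟩
    rw [hC.inf_eq_bot] at this
    exact Subtype.ext this)
  set Q : End 𝕜 C := P ∘ₗ B ∘ₗ C.subtype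
  refine ((Module.End.finite_hasEigenvalue Q).image (fun l => -l⁻¹)).subset ?_
  intro t ht
  have hne : (LinearMap.ker (A + t • B)) ⊓ C ≠ ⊥ := by
    intro h
    have h1 := Submodule.finrank_add_finrank_le_of_disjoint (disjoint_iff.2 h)
    have h2 := Submodule.finrank_add_eq_of_isCompl hC
    have ht' : finrank 𝕜 (LinearMap.ker A) < finrank 𝕜 (LinearMap.ker (A + t • B)) := ht
    omega
  obtain ⟨x, ⟨hx, hxC⟩, hx0⟩ := Submodule.exists_mem_ne_zero_of_ne_bot hne
  have h1 : (⟨x, hxC⟩ : C) + t • Q ⟨x, hxC⟩ = 0 := by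
    have e1 : P (A x) = ⟨x, hxC⟩ := LinearMap.congr_fun hP ⟨x, hxC⟩
    have : P (A x + t • B x) = 0 := by
      have : A x + t • B x = 0 := hx
      rw [this, map_zero]
    rw [map_add, map_smul, e1] at this
    exact this
  have ht0 : t ≠ 0 := by
    rintro rfl
    apply hx0
    simpa using h1
  refine ⟨-t⁻¹, ?_, by simp⟩
  refine Module.End.hasEigenvalue_of_hasEigenvector (x := ⟨x, hxC⟩) ⟨?_, ?_⟩
  · rw [Module.End.mem_eigenspace_iff]
    have : t • Q ⟨x, hxC⟩ = -⟨x, hxC⟩ := by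
      rw [eq_neg_iff_add_eq_zero, add_comm]; exact h1
    calc Q ⟨x, hxC⟩ = t⁻¹ • t • Q ⟨x, hxC⟩ := by rw [smul_smul, inv_mul_cancel₀ ht0, one_smul]
      _ = _ := by rw [this]; simp
  · intro h
    exact hx0 (congrArg Subtype.val h)

/-- If infinitely many kernels of a pencil lie in `T` and have at least the dimension of the kernel
of `A`, then the kernel of `A` lies in `T` as well. -/
theorem ker_le_of_infinite (A B : U →ₗ[𝕜] Y) (T : Submodule 𝕜 U)
    (h : {s : 𝕜 | finrank 𝕜 (LinearMap.ker A) ≤ finrank 𝕜 (LinearMap.ker (A + s • B)) ∧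
      LinearMap.ker (A + s • B) ≤ T}.Infinite) : LinearMap.ker A ≤ T := by
  by_contra hT
  -- Semicontinuity is applied to the pencil x ↦ ((A + sB)x, x mod T), whose kernel is ker(A + sB) ∩
  -- T. If ker A were not in T, this kernel would be too small at s = 0, and every s in the
  -- hypothesis would be a jump.
  obtain ⟨s, ⟨hs1, hs2⟩, hs3⟩ :=
    (h.sdiff (finite_finrank_ker_lt (A.prod T.mkQ) (B.prod 0))).nonempty
  apply hs3
  have e1 : LinearMap.ker (A.prod T.mkQ) < LinearMap.ker A := by
    rw [LinearMap.ker_prod, Submodule.ker_mkQ]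
    exact lt_of_le_of_ne inf_le_left fun h => hT (inf_eq_left.1 h)
  have e2 : LinearMap.ker (A.prod T.mkQ + s • B.prod 0) = LinearMap.ker (A + s • B) := by
    have : A.prod T.mkQ + s • B.prod 0 = (A + s • B).prod T.mkQ := by
      ext x <;> simp
    rw [this, LinearMap.ker_prod, Submodule.ker_mkQ]
    exact inf_eq_left.2 hs2
  change finrank 𝕜 _ < finrank 𝕜 _
  rw [e2]
  exact (Submodule.finrank_lt_finrank_of_lt e1).trans_le hs1

/-- The scalars `t` for which the kernel of `A + tB` has the dimension of the kernel of `A`. -/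
def regularSet (A B : U →ₗ[𝕜] Y) : Set 𝕜 :=
  {t | finrank 𝕜 (LinearMap.ker (A + t • B)) = finrank 𝕜 (LinearMap.ker A)}

/-- The sum of the kernels of minimal dimension of the pencil `A + tB`. -/
def kernelSpan (A B : U →ₗ[𝕜] Y) : Submodule 𝕜 U :=
  ⨆ t ∈ regularSet A B, LinearMap.ker (A + t • B)

/-- The pencil `A + tB` has kernels of minimal dimension at `0` and at infinity. -/
structure IsRegularPencil (A B : U →ₗ[𝕜] Y) : Prop where
  finrank_eq : finrank 𝕜 (LinearMap.ker B) = finrank 𝕜 (LinearMap.ker A)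
  le_finrank : ∀ t : 𝕜, finrank 𝕜 (LinearMap.ker A) ≤ finrank 𝕜 (LinearMap.ker (A + t • B))

namespace IsRegularPencil

variable {A B : U →ₗ[𝕜] Y} (h : IsRegularPencil A B)
include h

theorem finite_compl_regularSet : (regularSet A B)ᶜ.Finite := by
  refine (finite_finrank_ker_lt A B).subset fun t ht => ?_
  exact lt_of_le_of_ne (h.le_finrank t) (Ne.symm ht)

/-- Recentre the pencil at t₀: all but finitely many nearby parameters are regular and outside F, so
containment in T passes to the limit kernel. -/
theorem ker_le_of_mem [Infinite 𝕜] (T : Submodule 𝕜 U) {F : Set 𝕜} (hF : F.Finite)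
    (hT : ∀ t ∈ regularSet A B, t ∉ F → LinearMap.ker (A + t • B) ≤ T) {t₀ : 𝕜}
    (ht₀ : t₀ ∈ regularSet A B) : LinearMap.ker (A + t₀ • B) ≤ T := by
  refine ker_le_of_infinite (A + t₀ • B) B T ?_
  have hfin : (((regularSet A B)ᶜ ∪ F).preimage (fun s => t₀ + s)).Finite :=
    (h.finite_compl_regularSet.union hF).preimage (add_right_injective t₀).injOn
  refine (hfin.infinite_compl).mono fun s hs => ?_
  simp only [Set.preimage_union, Set.compl_union, Set.mem_inter_iff, Set.mem_compl_iff,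
    Set.mem_preimage, not_not] at hs
  have e : A + t₀ • B + s • B = A + (t₀ + s) • B := by rw [add_smul, add_assoc]
  change _ ≤ _ ∧ _
  rw [e]
  exact ⟨(ht₀.trans hs.1.symm).le, hT _ hs.1 hs.2⟩

/-- This is how the span of kernels is used throughout: inclusions need checking only off a finite
set, which is then chosen to avoid division by zero or coinciding parameters. -/
theorem kernelSpan_le [Infinite 𝕜] (T : Submodule 𝕜 U) {F : Set 𝕜} (hF : F.Finite)
    (hT : ∀ t ∈ regularSet A B, t ∉ F → LinearMap.ker (A + t • B) ≤ T) : kernelSpan A B ≤ T :=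
  iSup₂_le fun _ ht => h.ker_le_of_mem T hF hT ht

omit h [FiniteDimensional 𝕜 U] in
theorem ker_le_kernelSpan_of_mem {t : 𝕜} (ht : t ∈ regularSet A B) :
    LinearMap.ker (A + t • B) ≤ kernelSpan A B :=
  le_iSup₂_of_le t ht le_rfl

omit h [FiniteDimensional 𝕜 U] in
theorem zero_mem_regularSet : (0 : 𝕜) ∈ regularSet A B := by
  unfold regularSet
  change _ = _
  rw [zero_smul, add_zero]

omit h [FiniteDimensional 𝕜 U] in
theorem ker_le_kernelSpan : LinearMap.ker A ≤ kernelSpan A B := by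
  have := ker_le_kernelSpan_of_mem (A := A) (B := B) zero_mem_regularSet
  simpa using this

/-- The member B sits at parameter infinity. For s ≠ 0 the kernel of B + sA is that of A + s⁻¹B, so
semicontinuity at s = 0 applies. -/
theorem ker_le_kernelSpan' [Infinite 𝕜] : LinearMap.ker B ≤ kernelSpan A B := by
  refine ker_le_of_infinite B A _ ?_
  have hfin : (((regularSet A B)ᶜ).preimage (fun s : 𝕜 => s⁻¹) ∪ {0}).Finite :=
    (h.finite_compl_regularSet.preimage inv_injective.injOn).union (Set.finite_singleton _)
  refine (hfin.infinite_compl).mono fun s hs => ?_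
  simp only [Set.compl_union, Set.mem_inter_iff, Set.mem_compl_iff, Set.mem_preimage, not_not,
    Set.mem_singleton_iff] at hs
  have e : LinearMap.ker (B + s • A) = LinearMap.ker (A + s⁻¹ • B) := by
    rw [← LinearMap.ker_smul (A + s⁻¹ • B) s hs.2, smul_add, smul_smul, mul_inv_cancel₀ hs.2,
      one_smul, add_comm]
  change _ ≤ _ ∧ _
  rw [e]
  exact ⟨(h.finrank_eq.trans hs.1.symm).le, ker_le_kernelSpan_of_mem hs.1⟩

/-- On the kernel at t one has A = -tB, and t = 0 can be left out, so A and B are proportional by a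
non-zero scalar on each generating kernel. -/
theorem map_kernelSpan_eq [Infinite 𝕜] :
    (kernelSpan A B).map A = (kernelSpan A B).map B := by
  have key : ∀ t ∈ regularSet A B, t ∉ ({0} : Set 𝕜) → ∀ x ∈ LinearMap.ker (A + t • B),
      A x = -t • B x := by
    intro t _ _ x hx
    rw [neg_smul, eq_neg_iff_add_eq_zero]
    exact hx
  apply le_antisymm
  · rw [Submodule.map_le_iff_le_comap]
    refine h.kernelSpan_le _ (Set.finite_singleton 0) fun t ht ht0 x hx => ?_
    rw [Submodule.mem_comap, key t ht ht0 x hx]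
    exact Submodule.smul_mem _ _ (Submodule.mem_map_of_mem (ker_le_kernelSpan_of_mem ht hx))
  · rw [Submodule.map_le_iff_le_comap]
    refine h.kernelSpan_le _ (Set.finite_singleton 0) fun t ht ht0 x hx => ?_
    have h1 : B x = -t⁻¹ • A x := by
      rw [key t ht ht0 x hx, smul_smul]
      simp [inv_mul_cancel₀ (show t ≠ 0 from ht0)]
    rw [Submodule.mem_comap, h1]
    exact Submodule.smul_mem _ _ (Submodule.mem_map_of_mem (ker_le_kernelSpan_of_mem ht hx))

end IsRegularPencil

end Pencils

/-! ### Isotropy of the generic kernels of an alternating pencil. -/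

section AlternatingPencils

variable {𝕜 U : Type*} [Field 𝕜] [Infinite 𝕜] [AddCommGroup U] [Module 𝕜 U]
  [FiniteDimensional 𝕜 U] {A B : LinearMap.BilinForm 𝕜 U}

omit [Infinite 𝕜] [FiniteDimensional 𝕜 U] in
/-- Kernel vectors at distinct parameters are orthogonal for both forms of a pencil. -/
theorem apply_eq_zero_of_mem_ker (hA : A.IsAlt) (hB : B.IsAlt) {s t : 𝕜} (hst : s ≠ t)
    {x y : U} (hx : x ∈ LinearMap.ker (A + s • B)) (hy : y ∈ LinearMap.ker (A + t • B)) :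
    A x y = 0 ∧ B x y = 0 := by
  have h1 : A x y + s * B x y = 0 := by simpa using LinearMap.congr_fun hx y
  have h2 : A y x + t * B y x = 0 := by simpa using LinearMap.congr_fun hy x
  rw [← hA.neg_eq, ← hB.neg_eq] at h2
  -- Both relations concern the same two numbers A(x, y) and B(x, y) once antisymmetry is used, and
  -- their difference isolates B(x, y).
  have h3 : (s - t) * B x y = 0 := by linear_combination h1 + h2
  have h4 : B x y = 0 := (mul_eq_zero.1 h3).resolve_left (sub_ne_zero.2 hst)
  exact ⟨by simpa [h4] using h1, h4⟩

/-- The generators at parameter t itself are superfluous. Here t need not be regular, which is what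
the eigenvalue criterion requires. -/
theorem apply_eq_zero_of_mem_ker_of_mem_kernelSpan (hA : A.IsAlt) (hB : B.IsAlt)
    (h : IsRegularPencil A B) {t : 𝕜} {x y : U} (hx : x ∈ LinearMap.ker (A + t • B))
    (hy : y ∈ kernelSpan A B) : A x y = 0 ∧ B x y = 0 := by
  have : kernelSpan A B ≤ LinearMap.ker (A x) ⊓ LinearMap.ker (B x) :=
    h.kernelSpan_le _ (Set.finite_singleton t) fun s _ hs z hz =>
      apply_eq_zero_of_mem_ker hA hB (fun h => hs h.symm) hx hz
  exact this hy

theorem apply_eq_zero_of_mem_kernelSpan (hA : A.IsAlt) (hB : B.IsAlt)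
    (h : IsRegularPencil A B) {x y : U} (hx : x ∈ kernelSpan A B)
    (hy : y ∈ kernelSpan A B) : A x y = 0 ∧ B x y = 0 := by
  have : kernelSpan A B ≤ LinearMap.ker (A.flip y) ⊓ LinearMap.ker (B.flip y) :=
    iSup₂_le fun t _ z hz => apply_eq_zero_of_mem_ker_of_mem_kernelSpan hA hB h hz hy
  exact this hx

end AlternatingPencils

/-! ### Kronecker normal form of a pencil spanned by its kernels. -/

section Chains

variable {𝕜 : Type*} [Field 𝕜]

/-- A basis `e j i`, `i < n j`, of `S` made of chains `A (e j 0) = 0`, `A (e j (i+1)) = -B (e j i)`,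
which puts the pencil `A + tB` into Kronecker normal form with only column minimal indices. -/
structure IsChainBasis {S Y ι : Type*} [AddCommGroup S] [Module 𝕜 S] [AddCommGroup Y] [Module 𝕜 Y]
    [Fintype ι] (A B : S →ₗ[𝕜] Y) (n : ι → ℕ) (e : ι → ℕ → S) : Prop where
  pos : ∀ j, 0 < n j
  -- With zero as the value past the end, `map_succ` at the last index also says that B kills the
  -- last vector of the chain.
  eq_zero : ∀ j i, n j ≤ i → e j i = 0
  map_zero : ∀ j, A (e j 0) = 0
  map_succ : ∀ j i, A (e j (i + 1)) = -B (e j i)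
  indep : ∀ c : ι → ℕ → 𝕜, ∑ j, ∑ i ∈ Finset.range (n j), c j i • e j i = 0 →
    ∀ j, ∀ i < n j, c j i = 0
  span : ∀ x : S, ∃ c : ι → ℕ → 𝕜, x = ∑ j, ∑ i ∈ Finset.range (n j), c j i • e j i
  indep_map : ∀ c : ι → ℕ → 𝕜, ∑ j, ∑ i ∈ Finset.range (n j - 1), c j i • B (e j i) = 0 →
    ∀ j, ∀ i < n j - 1, c j i = 0

/-- A pencil whose kernels at all but finitely many parameters span the space cannot have an
injective member at infinity. -/
theorem not_injective_of_iSup_ker_eq_top {S Y : Type*} [AddCommGroup S] [Module 𝕜 S]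
    [FiniteDimensional 𝕜 S] [Nontrivial S] [AddCommGroup Y] [Module 𝕜 Y] (A B : S →ₗ[𝕜] Y)
    (h : ∀ F : Set 𝕜, F.Finite → ⨆ t ∈ Fᶜ, LinearMap.ker (A + t • B) = ⊤) :
    LinearMap.ker B ≠ ⊥ := by
  intro hB
  obtain ⟨P, hP⟩ := B.exists_leftInverse_of_injective hB
  have hP' : ∀ x, P (B x) = x := fun x => LinearMap.congr_fun hP x
  -- With P a left inverse of B, a kernel vector at t is an eigenvector of PA for -t. Deleting these
  -- finitely many t leaves only zero kernels, which cannot span.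
  have hF := (Module.End.finite_hasEigenvalue (P ∘ₗ A : End 𝕜 S)).preimage
    (neg_injective (G := 𝕜)).injOn
  have hbot : ⨆ t ∈ ((fun t : 𝕜 => -t) ⁻¹' {μ | Module.End.HasEigenvalue (P ∘ₗ A) μ})ᶜ,
      LinearMap.ker (A + t • B) = ⊥ := by
    rw [iSup₂_eq_bot]
    intro t ht
    rw [LinearMap.ker_eq_bot']
    intro x hx
    by_contra hx0
    apply ht
    refine Module.End.hasEigenvalue_of_hasEigenvector (x := x) ⟨?_, hx0⟩
    rw [Module.End.mem_eigenspace_iff]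
    have : P (A x + t • B x) = 0 := by
      have : A x + t • B x = 0 := hx
      rw [this, LinearMap.map_zero]
    rw [map_add, map_smul, hP'] at this
    rw [neg_smul]
    exact eq_neg_of_add_eq_zero_left this
  rw [h _ hF] at hbot
  exact top_ne_bot hbot

/-- The reflection of a pencil `S ⇉ L` at its source: the cokernel of `S → L × L`. -/
theorem iSup_ker_reflection_eq_top {S L : Type*} [AddCommGroup S] [Module 𝕜 S]
    [AddCommGroup L] [Module 𝕜 L] (A B : S →ₗ[𝕜] L)
    (hB : LinearMap.range B = ⊤)
    (h : ∀ F : Set 𝕜, F.Finite → ⨆ t ∈ Fᶜ, LinearMap.ker (A + t • B) = ⊤) (F : Set 𝕜)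
    (hF : F.Finite) :
    ⨆ t ∈ Fᶜ, LinearMap.ker (-((LinearMap.range (A.prod B)).mkQ ∘ₗ LinearMap.inr 𝕜 L L) +
      t • ((LinearMap.range (A.prod B)).mkQ ∘ₗ LinearMap.inl 𝕜 L L)) = ⊤ := by
  rw [eq_top_iff, ← hB, ← Submodule.map_top, ← h F hF, Submodule.map_iSup]
  refine iSup_mono fun t => ?_
  rw [Submodule.map_iSup]
  refine iSup_mono fun _ => ?_
  rw [Submodule.map_le_iff_le_comap]
  intro x hx
  have hx : A x + t • B x = 0 := hx
  -- If Ax = -tBx, this element of L × L is the image of -x, so Bx lies in the reflected kernel at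
  -- the same t. As B is onto, these vectors span L.
  have : -((0, B x) : L × L) + t • ((B x, 0) : L × L) = A.prod B (-x) := by
    ext
    · change -0 + t • B x = A (-x)
      rw [map_neg, neg_zero, zero_add, eq_neg_iff_add_eq_zero, add_comm]; exact hx
    · simp
  change -(LinearMap.range (A.prod B)).mkQ (0, B x) +
    t • (LinearMap.range (A.prod B)).mkQ (B x, 0) = 0
  rw [← map_smul, ← map_neg, ← map_add, this, Submodule.mkQ_apply,
    Submodule.Quotient.mk_eq_zero]
  exact ⟨_, rfl⟩

/-- In the cokernel of (A, B) the chain relations say exactly that (0, f 0) and (-f i, f (i + 1))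
come from S. Their preimages form a chain with one more vector, which B maps back onto f. -/
theorem exists_chain_lift {S L : Type*} [AddCommGroup S] [Module 𝕜 S]
    [AddCommGroup L] [Module 𝕜 L] (A B : S →ₗ[𝕜] L) {m : ℕ} {f : ℕ → L}
    (hf : ∀ i, m ≤ i → f i = 0)
    (h0 : (-((LinearMap.range (A.prod B)).mkQ ∘ₗ LinearMap.inr 𝕜 L L)) (f 0) = 0)
    (h1 : ∀ i, (-((LinearMap.range (A.prod B)).mkQ ∘ₗ LinearMap.inr 𝕜 L L)) (f (i + 1)) =
      -((LinearMap.range (A.prod B)).mkQ ∘ₗ LinearMap.inl 𝕜 L L) (f i)) :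
    ∃ e : ℕ → S, (∀ i, m + 1 ≤ i → e i = 0) ∧ A (e 0) = 0 ∧ (∀ i, A (e (i + 1)) = -f i) ∧
      ∀ i, B (e i) = f i := by
  have h0' : ∃ x, A x = 0 ∧ B x = f 0 := by
    have : (LinearMap.range (A.prod B)).mkQ (0, f 0) = 0 := by
      rw [← neg_eq_zero]; exact h0
    rw [Submodule.mkQ_apply, Submodule.Quotient.mk_eq_zero] at this
    obtain ⟨x, hx⟩ := this
    exact ⟨x, congrArg Prod.fst hx, congrArg Prod.snd hx⟩
  have h1' : ∀ i, ∃ x, (m ≤ i → x = 0) ∧ A x = -f i ∧ B x = f (i + 1) := by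
    intro i
    -- Past the end both components vanish and the preimage must be chosen to be zero, so that the
    -- lifted chain stops at m + 1.
    by_cases hi : m ≤ i
    · exact ⟨0, fun _ => rfl, by simp [hf i hi], by simp [hf (i + 1) (by omega)]⟩
    · have e := h1 i
      have : (LinearMap.range (A.prod B)).mkQ (-f i, f (i + 1)) = 0 := by
        have e2 : ((-f i, f (i + 1)) : L × L) = (0, f (i + 1)) - (f i, 0) := by ext <;> simp
        rw [e2, map_sub, sub_eq_zero]
        exact neg_injective e
      rw [Submodule.mkQ_apply, Submodule.Quotient.mk_eq_zero] at this
      obtain ⟨x, hx⟩ := this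
      exact ⟨x, fun h => absurd h hi, congrArg Prod.fst hx, congrArg Prod.snd hx⟩
  obtain ⟨x0, hx0⟩ := h0'
  choose x hx using h1'
  refine ⟨fun i => Nat.casesOn i x0 x, ?_, hx0.1, fun i => (hx i).2.1, ?_⟩
  · rintro (_ | i) hi
    · omega
    · exact (hx i).1 (by omega)
  · rintro (_ | i)
    · exact hx0.2
    · exact (hx i).2.2

/-- Chain bases lift along the reflection of a pencil. -/
theorem IsChainBasis.of_reflection {S L ι : Type*} [AddCommGroup S] [Module 𝕜 S]
    [FiniteDimensional 𝕜 S] [AddCommGroup L] [Module 𝕜 L] [Fintype ι] (A B : S →ₗ[𝕜] L)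
    {m : ι → ℕ} {f : ι → ℕ → L}
    (hf : IsChainBasis (-((LinearMap.range (A.prod B)).mkQ ∘ₗ LinearMap.inr 𝕜 L L))
      ((LinearMap.range (A.prod B)).mkQ ∘ₗ LinearMap.inl 𝕜 L L) m f) :
    ∃ (q : ℕ) (n : ι ⊕ Fin q → ℕ) (e : ι ⊕ Fin q → ℕ → S), IsChainBasis A B n e := by
  choose e he0 heA0 heA heB using fun j =>
    exists_chain_lift A B (hf.eq_zero j) (hf.map_zero j) (hf.map_succ j)
  -- The common kernel is invisible after reflection; its basis vectors supply the chains of length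
  -- one.
  set N : Submodule 𝕜 S := LinearMap.ker A ⊓ LinearMap.ker B
  have bN := Module.finBasis 𝕜 N
  have hNA : ∀ k, A (bN k) = 0 := fun k => (bN k).2.1
  have hNB : ∀ k, B (bN k) = 0 := fun k => (bN k).2.2
  have heAs : ∀ (c : ι → ℕ → 𝕜) j, A (∑ i ∈ Finset.range (m j + 1), c j i • e j i) =
      -∑ i ∈ Finset.range (m j), c j (i + 1) • f j i := by
    intro c j
    rw [map_sum, Finset.sum_range_succ', map_smul, heA0, smul_zero, add_zero,
      ← Finset.sum_neg_distrib]
    exact Finset.sum_congr rfl fun i _ => by rw [map_smul, heA, smul_neg]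
  have heBs : ∀ (c : ι → ℕ → 𝕜) j, B (∑ i ∈ Finset.range (m j + 1), c j i • e j i) =
      ∑ i ∈ Finset.range (m j), c j i • f j i := by
    intro c j
    rw [map_sum, Finset.sum_range_succ, map_smul, heB, hf.eq_zero j _ le_rfl, smul_zero, add_zero]
    exact Finset.sum_congr rfl fun i _ => by rw [map_smul, heB]
  refine ⟨finrank 𝕜 N, Sum.elim (fun j => m j + 1) (fun _ => 1),
    Sum.elim e (fun k i => if i = 0 then (bN k : S) else 0), ?_, ?_, ?_, ?_, ?_, ?_, ?_⟩
  · rintro (j | k) <;> simp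
  · rintro (j | k) i hi
    · exact he0 j i hi
    · have : i ≠ 0 := by simp only [Sum.elim_inr] at hi; omega
      simp [this]
  · rintro (j | k)
    · exact heA0 j
    · simp [hNA]
  · rintro (j | k) i
    · simp only [Sum.elim_inl]
      rw [heA, heB]
    · by_cases hi : i = 0 <;> simp [hi, hNB]
  · intro c hc
    simp only [Fintype.sum_sum_type, Sum.elim_inl, Sum.elim_inr, Finset.sum_range_one,
      if_true] at hc
    -- Applying A detects the coefficients of index at least 1 and applying B those before the last;
    -- together they cover every chain of length m j + 1.
    have hA := congrArg A hc
    have hB := congrArg B hc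
    rw [map_add, map_sum, LinearMap.map_zero] at hA hB
    have hzA : A (∑ k, c (Sum.inr k) 0 • (bN k : S)) = 0 := by
      rw [map_sum]; exact Finset.sum_eq_zero fun k _ => by rw [map_smul, hNA, smul_zero]
    have hzB : B (∑ k, c (Sum.inr k) 0 • (bN k : S)) = 0 := by
      rw [map_sum]; exact Finset.sum_eq_zero fun k _ => by rw [map_smul, hNB, smul_zero]
    rw [hzA, add_zero, Finset.sum_congr rfl fun j _ => heAs (fun j => c (Sum.inl j)) j,
      Finset.sum_neg_distrib, neg_eq_zero] at hA
    rw [hzB, add_zero, Finset.sum_congr rfl fun j _ => heBs (fun j => c (Sum.inl j)) j] at hB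
    have hA' := hf.indep (fun j i => c (Sum.inl j) (i + 1)) hA
    have hB' := hf.indep (fun j => c (Sum.inl j)) hB
    have hl : ∀ j, ∀ i < m j + 1, c (Sum.inl j) i = 0 := by
      intro j i hi
      rcases i with _ | i
      · exact hB' j 0 (hf.pos j)
      · exact hA' j i (by omega)
    rintro (j | k) i hi
    · exact hl j i hi
    · have hi0 : i = 0 := by simp only [Sum.elim_inr] at hi; omega
      subst hi0
      rw [Finset.sum_eq_zero fun j _ => Finset.sum_eq_zero fun i hi => by
        rw [hl j i (Finset.mem_range.1 hi), zero_smul], zero_add] at hc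
      have : ∑ k, c (Sum.inr k) 0 • bN k = 0 := by
        apply Subtype.ext
        simpa using hc
      exact Fintype.linearIndependent_iff.1 bN.linearIndependent _ this k
  · intro x
    -- Subtract a combination of the lifted vectors with the same image under B. The remainder x₁
    -- satisfies B x₁ = 0, so (A x₁, 0) dies in the cokernel, and A x₁ involves only the last
    -- vectors of the chains f. Those are, up to sign, the images under A of the last lifted
    -- vectors, which B kills; after this correction only N is left.
    obtain ⟨c, hc⟩ := hf.span (B x)
    set x₁ := x - ∑ j, ∑ i ∈ Finset.range (m j), c j i • e j i with hx₁
    have hBx₁ : B x₁ = 0 := by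
      rw [hx₁, map_sub, hc, sub_eq_zero, map_sum]
      refine Finset.sum_congr rfl fun j _ => ?_
      rw [map_sum]
      exact Finset.sum_congr rfl fun i _ => by rw [map_smul, heB]
    obtain ⟨d, hd⟩ := hf.span (A x₁)
    have hd0 : ∀ j, ∀ i < m j - 1, d j i = 0 := by
      apply hf.indep_map
      have h1 : ((LinearMap.range (A.prod B)).mkQ ∘ₗ LinearMap.inl 𝕜 L L) (A x₁) = 0 := by
        change (LinearMap.range (A.prod B)).mkQ (A x₁, 0) = 0
        rw [Submodule.mkQ_apply, Submodule.Quotient.mk_eq_zero]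
        exact ⟨x₁, Prod.ext rfl hBx₁⟩
      rw [hd, map_sum] at h1
      rw [← h1]
      refine Finset.sum_congr rfl fun j _ => ?_
      rw [map_sum]
      obtain ⟨p, hp⟩ := Nat.exists_eq_succ_of_ne_zero (hf.pos j).ne'
      have h2 := hf.map_succ j p
      rw [hf.eq_zero j (p + 1) (by omega), LinearMap.map_zero, eq_comm, neg_eq_zero] at h2
      rw [hp, Nat.succ_eq_add_one, Nat.add_sub_cancel, Finset.sum_range_succ, map_smul, h2,
        smul_zero, add_zero]
      exact Finset.sum_congr rfl fun i _ => by rw [map_smul]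
    have hd' : A x₁ = ∑ j, d j (m j - 1) • f j (m j - 1) := by
      rw [hd]
      refine Finset.sum_congr rfl fun j _ => ?_
      refine Finset.sum_eq_single _ (fun i hi hne => ?_) (fun h => ?_)
      · have := Finset.mem_range.1 hi
        rw [hd0 j i (by omega), zero_smul]
      · have := hf.pos j
        exact absurd (Finset.mem_range.2 (by omega)) h
    have hx₂ : x₁ + ∑ j, d j (m j - 1) • e j (m j) ∈ N := by
      constructor
      · change A _ = 0
        rw [map_add, hd', map_sum, ← Finset.sum_add_distrib]
        refine Finset.sum_eq_zero fun j _ => ?_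
        obtain ⟨p, hp⟩ := Nat.exists_eq_succ_of_ne_zero (hf.pos j).ne'
        rw [hp, Nat.succ_eq_add_one, Nat.add_sub_cancel, map_smul, heA, smul_neg, add_neg_cancel]
      · change B _ = 0
        rw [map_add, hBx₁, zero_add, map_sum]
        refine Finset.sum_eq_zero fun j _ => ?_
        rw [map_smul, heB, hf.eq_zero j _ le_rfl, smul_zero]
    refine ⟨Sum.elim (fun j i => if i < m j then c j i else -d j (m j - 1))
      (fun k _ => bN.repr ⟨_, hx₂⟩ k), ?_⟩
    simp only [Fintype.sum_sum_type, Sum.elim_inl, Sum.elim_inr, Finset.sum_range_one, if_true]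
    have h3 := congrArg Subtype.val (bN.sum_repr ⟨_, hx₂⟩)
    simp only [Submodule.coe_sum, Submodule.coe_smul] at h3
    rw [h3, hx₁]
    have h4 : ∑ j, ∑ i ∈ Finset.range (m j + 1),
        (if i < m j then c j i else -d j (m j - 1)) • e j i =
        ∑ j, ∑ i ∈ Finset.range (m j), c j i • e j i - ∑ j, d j (m j - 1) • e j (m j) := by
      rw [← Finset.sum_sub_distrib]
      refine Finset.sum_congr rfl fun j _ => ?_
      rw [Finset.sum_range_succ, if_neg (lt_irrefl _), neg_smul, ← sub_eq_add_neg]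
      congr 1
      exact Finset.sum_congr rfl fun i hi => by rw [if_pos (Finset.mem_range.1 hi)]
    rw [h4]
    abel
  · intro c hc
    simp only [Fintype.sum_sum_type, Sum.elim_inl, Sum.elim_inr, Nat.add_sub_cancel,
      Nat.sub_self, Finset.range_zero, Finset.sum_empty, Finset.sum_const_zero, add_zero, heB] at hc
    have := hf.indep (fun j => c (Sum.inl j)) hc
    rintro (j | k) i hi
    · exact this j i (by simpa using hi)
    · simp at hi

/-- A pencil spanned by its kernels at all but finitely many parameters has a chain basis. -/
theorem exists_isChainBasis.{u} {S Y : Type u} [AddCommGroup S] [Module 𝕜 S]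
    [FiniteDimensional 𝕜 S] [AddCommGroup Y] [Module 𝕜 Y] (A B : S →ₗ[𝕜] Y)
    (h : ∀ F : Set 𝕜, F.Finite → ⨆ t ∈ Fᶜ, LinearMap.ker (A + t • B) = ⊤) :
    ∃ (ι : Type) (_ : Fintype ι) (n : ι → ℕ) (e : ι → ℕ → S), IsChainBasis A B n e := by
  induction hd : finrank 𝕜 S using Nat.strong_induction_on generalizing S Y with
  | _ d ih =>
  rcases subsingleton_or_nontrivial S with hS | hS
  · exact ⟨Empty, inferInstance, fun j => j.elim, fun j => j.elim, fun j => j.elim,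
      fun j => j.elim, fun j => j.elim, fun j => j.elim, fun _ _ j => j.elim,
      fun x => ⟨fun j => j.elim, Subsingleton.elim _ _⟩, fun _ _ j => j.elim⟩
  -- For x in the kernel at t, Ax = B(-tx), and such x span. The target may thus be cut down to the
  -- range of B, whose dimension is less than that of S because B is not injective; the reflected
  -- pencil has this range as source, and the induction proceeds.
  have hAB : LinearMap.range A ≤ LinearMap.range B := by
    rw [LinearMap.range_eq_map, ← h ∅ Set.finite_empty, Submodule.map_le_iff_le_comap]
    refine iSup₂_le fun t _ x hx => ⟨-t • x, ?_⟩
    have hx : A x + t • B x = 0 := hx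
    rw [map_smul, neg_smul, eq_comm]
    exact eq_neg_of_add_eq_zero_left hx
  set L := LinearMap.range B
  set A' : S →ₗ[𝕜] L := A.codRestrict L fun x => hAB ⟨x, rfl⟩
  set B' : S →ₗ[𝕜] L := B.rangeRestrict
  have hker : ∀ t : 𝕜, LinearMap.ker (A' + t • B') = LinearMap.ker (A + t • B) := by
    intro t
    ext x
    rw [LinearMap.mem_ker, LinearMap.mem_ker, Subtype.ext_iff]
    rfl
  have h' : ∀ F : Set 𝕜, F.Finite → ⨆ t ∈ Fᶜ, LinearMap.ker (A' + t • B') = ⊤ := by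
    simpa only [hker] using h
  have hlt : finrank 𝕜 L < d := by
    have h1 := B.finrank_range_add_finrank_ker
    have h2 := Submodule.one_le_finrank_iff.2 (not_injective_of_iSup_ker_eq_top A B h)
    change finrank 𝕜 (LinearMap.range B) < d
    omega
  obtain ⟨ι, _, m, f, hf⟩ := ih _ hlt _ _
    (iSup_ker_reflection_eq_top A' B' B.range_rangeRestrict h') rfl
  obtain ⟨q, n, e, he⟩ := IsChainBasis.of_reflection A' B' hf
  refine ⟨_, inferInstance, n, e, he.pos, he.eq_zero, fun j => ?_, fun j i => ?_, he.indep, he.span,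
    fun c hc => he.indep_map c ?_⟩
  · exact congrArg Subtype.val (he.map_zero j)
  · exact congrArg Subtype.val (he.map_succ j i)
  · apply Subtype.ext
    simpa [B'] using hc

end Chains

/-! ### Kernels computed in a chain basis. -/

section ChainKernel

variable {𝕜 S Y ι : Type*} [Field 𝕜] [AddCommGroup S] [Module 𝕜 S] [AddCommGroup Y] [Module 𝕜 Y]
  [Fintype ι] {A B : S →ₗ[𝕜] Y} {n : ι → ℕ} {e : ι → ℕ → S}

namespace IsChainBasis

variable (h : IsChainBasis A B n e)
include h

theorem reindex {κ : Type*} [Fintype κ] (σ : κ ≃ ι) :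
    IsChainBasis A B (n ∘ σ) (e ∘ σ) where
  pos j := h.pos (σ j)
  eq_zero j i hi := h.eq_zero (σ j) i hi
  map_zero j := h.map_zero (σ j)
  map_succ j := h.map_succ (σ j)
  indep c hc j i hi := by
    have := h.indep (fun j => c (σ.symm j)) (by
      rw [← hc, ← σ.sum_comp]
      simp) (σ j) i hi
    simpa using this
  span x := by
    obtain ⟨c, hc⟩ := h.span x
    exact ⟨fun j => c (σ j), by rw [hc, ← σ.sum_comp]; rfl⟩
  indep_map c hc j i hi := by
    have := h.indep_map (fun j => c (σ.symm j)) (by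
      rw [← hc, ← σ.sum_comp]
      simp) (σ j) i hi
    simpa using this

theorem linearIndependent :
    LinearIndependent 𝕜 (fun x : Σ j, Fin (n j) => e x.1 x.2) := by
  classical
  rw [Fintype.linearIndependent_iff]
  intro g hg
  have := h.indep (fun j i => if hi : i < n j then g ⟨j, i, hi⟩ else 0) (by
    rw [← hg, Fintype.sum_sigma]
    refine Finset.sum_congr rfl fun j _ => ?_
    rw [← Fin.sum_univ_eq_sum_range (fun i => (if hi : i < n j then g ⟨j, i, hi⟩ else 0) • e j i)]
    exact Finset.sum_congr rfl fun i _ => by simp)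
  rintro ⟨j, i⟩
  simpa using this j i i.2

theorem top_le_span :
    ⊤ ≤ Submodule.span 𝕜 (Set.range (fun x : Σ j, Fin (n j) => e x.1 x.2)) := by
  rintro x -
  obtain ⟨c, rfl⟩ := h.span x
  refine Submodule.sum_mem _ fun j _ => Submodule.sum_mem _ fun i hi => Submodule.smul_mem _ _ ?_
  exact Submodule.subset_span ⟨⟨j, i, Finset.mem_range.1 hi⟩, rfl⟩

/-- The relation A e(i+1) = -B e(i) turns the kernel condition at t into the recurrence c(i+1) = t
c(i), because the vectors B e(i) that remain are independent. -/
theorem map_add_smul_sum (t : 𝕜) (c : ι → ℕ → 𝕜) :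
    (A + t • B) (∑ j, ∑ i ∈ Finset.range (n j), c j i • e j i) =
      ∑ j, ∑ i ∈ Finset.range (n j - 1), (t * c j i - c j (i + 1)) • B (e j i) := by
  rw [map_sum]
  refine Finset.sum_congr rfl fun j _ => ?_
  obtain ⟨p, hp⟩ := Nat.exists_eq_succ_of_ne_zero (h.pos j).ne'
  have hB : B (e j p) = 0 := by
    rw [← neg_eq_zero, ← h.map_succ, h.eq_zero j (p + 1) (by omega), LinearMap.map_zero]
  rw [hp, Nat.succ_eq_add_one, Nat.add_sub_cancel, LinearMap.add_apply, LinearMap.smul_apply,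
    map_sum, map_sum, Finset.sum_range_succ', Finset.sum_range_succ _ p, map_smul, map_smul,
    h.map_zero, hB, smul_zero, smul_zero, add_zero, add_zero, Finset.smul_sum,
    ← Finset.sum_add_distrib]
  refine Finset.sum_congr rfl fun i _ => ?_
  rw [map_smul, map_smul, h.map_succ, sub_smul, mul_smul, smul_neg]
  abel

/-- The coefficients of a kernel vector along each chain form a geometric progression of ratio t,
hence one polynomial curve per chain. -/
theorem ker_eq_span (t : 𝕜) : LinearMap.ker (A + t • B) =
    Submodule.span 𝕜 (Set.range fun j => ∑ i ∈ Finset.range (n j), t ^ i • e j i) := by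
  classical
  apply le_antisymm
  · intro x hx
    obtain ⟨c, rfl⟩ := h.span x
    rw [LinearMap.mem_ker, h.map_add_smul_sum] at hx
    have hx := h.indep_map (fun j i => t * c j i - c j (i + 1)) hx
    refine Submodule.sum_mem _ fun j _ => ?_
    have : ∀ i < n j, c j i = c j 0 * t ^ i := by
      intro i
      induction i with
      | zero => simp
      | succ i ih =>
        intro hi
        have h1 := hx j i (by omega)
        rw [← sub_eq_zero.1 h1, ih (by omega)]
        ring
    rw [Finset.sum_congr rfl fun i hi => by rw [this i (Finset.mem_range.1 hi), mul_smul],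
      ← Finset.smul_sum]
    exact Submodule.smul_mem _ _ (Submodule.subset_span ⟨j, rfl⟩)
  · rw [Submodule.span_le]
    rintro _ ⟨j, rfl⟩
    have := h.map_add_smul_sum t (fun k i => if k = j then t ^ i else 0)
    rw [Finset.sum_eq_single j (fun k _ hk => by simp [hk]) (by simp)] at this
    simp only [if_true] at this
    change (A + t • B) _ = 0
    rw [this]
    refine Finset.sum_eq_zero fun k _ => Finset.sum_eq_zero fun i _ => ?_
    by_cases hk : k = j <;> simp [hk, pow_succ']

/-- The coefficient of e j 0 in the j-th curve is 1 for every t, including t = 0, so the curves stay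
independent and no parameter is exceptional. -/
theorem finrank_ker (t : 𝕜) : finrank 𝕜 (LinearMap.ker (A + t • B)) = Fintype.card ι := by
  rw [h.ker_eq_span t]
  apply finrank_span_eq_card
  rw [Fintype.linearIndependent_iff]
  intro g hg j
  have := h.indep (fun j i => g j * t ^ i) (by
    rw [← hg]
    refine Finset.sum_congr rfl fun j _ => ?_
    rw [Finset.smul_sum]
    exact Finset.sum_congr rfl fun i _ => mul_smul _ _ _) j 0 (h.pos j)
  simpa using this

end IsChainBasis

end ChainKernel

/-! ### Dictionary between bivectors on W and alternating forms on W*. -/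

section Bivectors

variable {𝕜 W : Type*} [Field 𝕜] [AddCommGroup W] [Module 𝕜 W] [FiniteDimensional 𝕜 W]
  {Λ Λ₁ : LinearMap.BilinForm 𝕜 (Dual 𝕜 W)}

theorem ker_sharp (Λ : LinearMap.BilinForm 𝕜 (Dual 𝕜 W)) :
    LinearMap.ker (sharp Λ) = LinearMap.ker Λ :=
  LinearMap.ker_comp_of_ker_eq_bot _ (LinearEquiv.ker _)

theorem bivectorRank_add_finrank_ker (Λ : LinearMap.BilinForm 𝕜 (Dual 𝕜 W)) :
    bivectorRank Λ + finrank 𝕜 (LinearMap.ker Λ) = finrank 𝕜 W := by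
  rw [← ker_sharp, ← Subspace.dual_finrank_eq (K := 𝕜) (V := W)]
  exact (sharp Λ).finrank_range_add_finrank_ker

theorem corank_eq (Λ : LinearMap.BilinForm 𝕜 (Dual 𝕜 W)) :
    corank Λ = finrank 𝕜 (LinearMap.ker Λ) := by
  have := bivectorRank_add_finrank_ker Λ
  unfold corank
  omega

theorem image_eq_dualCoannihilator (hΛ : Λ.IsAlt) :
    image Λ = (LinearMap.ker Λ).dualCoannihilator := by
  apply Submodule.eq_of_le_of_finrank_eq
  · rintro _ ⟨α, rfl⟩
    rw [Submodule.mem_dualCoannihilator]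
    intro β hβ
    rw [apply_sharp, ← hΛ.neg_eq, LinearMap.mem_ker.1 hβ, LinearMap.zero_apply, neg_zero]
  · have h1 := bivectorRank_add_finrank_ker Λ
    have h2 := Subspace.finrank_add_finrank_dualCoannihilator_eq (LinearMap.ker Λ)
    unfold bivectorRank at h1
    omega

theorem dualAnnihilator_image (hΛ : Λ.IsAlt) :
    (image Λ).dualAnnihilator = LinearMap.ker Λ := by
  rw [image_eq_dualCoannihilator hΛ, Subspace.dualCoannihilator_dualAnnihilator_eq]

namespace IsMaximal

variable (h : IsMaximal Λ Λ₁)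
include h

theorem alt_add_smul (t : 𝕜) : (Λ + t • Λ₁).IsAlt := by
  intro x
  simp [h.alt x, h.alt₁ x]

theorem pairCorank_eq : pairCorank Λ Λ₁ = finrank 𝕜 (LinearMap.ker Λ) := by
  have := bivectorRank_add_finrank_ker Λ
  have := h.rank_eq
  unfold pairCorank
  omega

theorem bivectorRank_le (t : 𝕜) : bivectorRank ((1 - t) • Λ + t • Λ₁) ≤ bivectorRank Λ := by
  rw [h.rank_eq]
  refine le_ciSup (f := fun t : 𝕜 => bivectorRank ((1 - t) • Λ + t • Λ₁)) ⟨finrank 𝕜 W, ?_⟩ t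
  rintro _ ⟨s, rfl⟩
  have := bivectorRank_add_finrank_ker ((1 - s) • Λ + s • Λ₁)
  simp only
  omega

/-- The rank of a pair is taken over (1 - t)Λ + tΛ₁, which up to a scalar runs through all Λ + tΛ₁
except t = -1. Semicontinuity recovers that parameter from its neighbours. -/
theorem isRegularPencil [Infinite 𝕜] : IsRegularPencil Λ Λ₁ := by
  have key : ∀ t : 𝕜, 1 + t ≠ 0 →
      finrank 𝕜 (LinearMap.ker Λ) ≤ finrank 𝕜 (LinearMap.ker (Λ + t • Λ₁)) := by
    intro t ht
    have e : LinearMap.ker (Λ + t • Λ₁) =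
        LinearMap.ker ((1 - t / (1 + t)) • Λ + (t / (1 + t)) • Λ₁) := by
      rw [← LinearMap.ker_smul ((1 - t / (1 + t)) • Λ + (t / (1 + t)) • Λ₁) (1 + t) ht, smul_add,
        smul_smul, smul_smul]
      congr 2
      · rw [mul_sub, mul_div_cancel₀ _ ht]; simp
      · rw [mul_div_cancel₀ _ ht]
    rw [e]
    have h1 := bivectorRank_add_finrank_ker ((1 - t / (1 + t)) • Λ + (t / (1 + t)) • Λ₁)
    have h2 := bivectorRank_add_finrank_ker Λ
    have h3 := h.bivectorRank_le (t / (1 + t))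
    omega
  refine ⟨?_, fun t => ?_⟩
  · have h1 := bivectorRank_add_finrank_ker Λ
    have h2 := bivectorRank_add_finrank_ker Λ₁
    have h3 := h.rank_eq
    have h4 := h.rank₁_eq
    omega
  · by_cases ht : 1 + t = 0
    · obtain ⟨s, hs⟩ :=
        ((finite_finrank_ker_lt (Λ + t • Λ₁) Λ₁).union (Set.finite_singleton 0)).exists_notMem
      simp only [Set.mem_union, Set.mem_singleton_iff, not_or] at hs
      refine (key (t + s) ?_).trans ?_
      · rw [← add_assoc, ht, zero_add]; exact hs.2
      · rw [add_smul, ← add_assoc]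
        exact not_lt.1 hs.1
    · exact key t ht

/-- Each image is the annihilator of a kernel, so an intersection of images is the annihilator of a
sum of kernels. From here on everything takes place in W*. -/
theorem core_eq : core Λ Λ₁ = (kernelSpan Λ Λ₁).dualCoannihilator := by
  have e : {t : 𝕜 | corank (Λ + t • Λ₁) = pairCorank Λ Λ₁} = regularSet Λ Λ₁ := by
    ext t
    change _ = _ ↔ _ = _
    rw [corank_eq, h.pairCorank_eq]
  rw [core, e]
  ext x
  simp only [Submodule.mem_iInf, Submodule.mem_dualCoannihilator]
  constructor
  · intro hx φ hφ
    have : kernelSpan Λ Λ₁ ≤ LinearMap.ker (Dual.eval 𝕜 W x) := by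
      refine iSup₂_le fun t ht ψ hψ => ?_
      have h1 := hx t ht
      rw [image_eq_dualCoannihilator (h.alt_add_smul t), Submodule.mem_dualCoannihilator] at h1
      exact h1 ψ hψ
    exact this hφ
  · intro hx t ht
    rw [image_eq_dualCoannihilator (h.alt_add_smul t), Submodule.mem_dualCoannihilator]
    exact fun φ hφ => hx φ (IsRegularPencil.ker_le_kernelSpan_of_mem ht hφ)

theorem dualAnnihilator_core : (core Λ Λ₁).dualAnnihilator = kernelSpan Λ Λ₁ := by
  rw [h.core_eq, Subspace.dualCoannihilator_dualAnnihilator_eq]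

theorem mem_core {x : W} : x ∈ core Λ Λ₁ ↔ ∀ φ ∈ kernelSpan Λ Λ₁, φ x = 0 := by
  rw [h.core_eq, Submodule.mem_dualCoannihilator]

theorem core_le_image : core Λ Λ₁ ≤ image Λ := by
  rw [h.core_eq, image_eq_dualCoannihilator h.alt]
  exact Submodule.dualCoannihilator_anti IsRegularPencil.ker_le_kernelSpan

theorem core_le_image₁ [Infinite 𝕜] : core Λ Λ₁ ≤ image Λ₁ := by
  rw [h.core_eq, image_eq_dualCoannihilator h.alt₁]
  exact Submodule.dualCoannihilator_anti h.isRegularPencil.ker_le_kernelSpan'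

theorem coreKernel_eq : coreKernel Λ Λ₁ = (kernelSpan Λ Λ₁).map (sharp Λ) := by
  rw [coreKernel, h.dualAnnihilator_core]

theorem coreKernel_eq₁ [Infinite 𝕜] : coreKernel Λ Λ₁ = (kernelSpan Λ Λ₁).map (sharp Λ₁) := by
  rw [h.coreKernel_eq, sharp, sharp, Submodule.map_comp, Submodule.map_comp,
    h.isRegularPencil.map_kernelSpan_eq]

theorem coreKernel_le_core [Infinite 𝕜] : coreKernel Λ Λ₁ ≤ core Λ Λ₁ := by
  rw [h.coreKernel_eq]
  rintro _ ⟨α, hα, rfl⟩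
  rw [h.mem_core]
  intro β hβ
  rw [apply_sharp]
  exact (apply_eq_zero_of_mem_kernelSpan h.alt h.alt₁ h.isRegularPencil hα hβ).1

end IsMaximal

/-- The minus sign comes from Λ(α, β) = -Λ(β, α) = -α(Λ(β, ·)). The form can then be evaluated with
a preimage of only one argument. -/
theorem imageForm_apply {Λ : LinearMap.BilinForm 𝕜 (Dual 𝕜 W)} (hΛ : Λ.IsAlt) {α : Dual 𝕜 W}
    {x y : image Λ} (hx : sharp Λ α = x) : imageForm Λ x y = -α y := by
  obtain ⟨_, β, rfl⟩ := y
  have : x = (sharp Λ).rangeRestrict α := Subtype.ext hx.symm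
  rw [this]
  change imageForm Λ ((sharp Λ).rangeRestrict α) ((sharp Λ).rangeRestrict β) = -α (sharp Λ β)
  rw [imageForm_sharp hΛ, apply_sharp, hΛ.neg_eq]

theorem restrictedForm_apply {Λ : LinearMap.BilinForm 𝕜 (Dual 𝕜 W)} (hΛ : Λ.IsAlt)
    {L : Submodule 𝕜 W} (hL : L ≤ image Λ) {α : Dual 𝕜 W} {x y : L} (hx : sharp Λ α = x) :
    restrictedForm Λ hL x y = -α y :=
  imageForm_apply hΛ (x := Submodule.inclusion hL x) hx

/-- The kernel of the restriction to `L` of the 2-form associated to `Λ`. -/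
theorem map_ker_restrictedForm {Λ : LinearMap.BilinForm 𝕜 (Dual 𝕜 W)} (hΛ : Λ.IsAlt)
    {L : Submodule 𝕜 W} (hL : L ≤ image Λ) (hle : L.dualAnnihilator.map (sharp Λ) ≤ L) :
    (LinearMap.ker (restrictedForm Λ hL)).map L.subtype = L.dualAnnihilator.map (sharp Λ) := by
  apply le_antisymm
  · rintro _ ⟨x, hx, rfl⟩
    obtain ⟨α, hα⟩ := hL x.2
    refine ⟨α, ?_, hα⟩
    rw [SetLike.mem_coe, Submodule.mem_dualAnnihilator]
    intro y hy
    have := restrictedForm_apply hΛ hL (y := ⟨y, hy⟩) hα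
    rw [LinearMap.mem_ker.1 hx] at this
    simpa using this
  · rintro _ ⟨α, hα, rfl⟩
    refine ⟨⟨_, hle ⟨α, hα, rfl⟩⟩, ?_, rfl⟩
    rw [SetLike.mem_coe, LinearMap.mem_ker]
    ext y
    rw [restrictedForm_apply hΛ hL (α := α) rfl, (Submodule.mem_dualAnnihilator _).1 hα y y.2]
    simp

end Bivectors

/-! ### Kernels of decomposable forms and quotients of alternating forms. -/

section Forms

variable {𝕜 V : Type*} [Field 𝕜] [AddCommGroup V] [Module 𝕜 V]

/-- The kernel of a nonzero decomposable form `f₁ ∧ … ∧ fᵣ` is the intersection of the kernels. -/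
theorem formKer_ιMulti [FiniteDimensional 𝕜 V] {r : ℕ} {f : Fin r → Dual 𝕜 V}
    (hf : LinearIndependent 𝕜 f) :
    formKer (exteriorPower.ιMulti 𝕜 r f) = {v | ∀ j, f j v = 0} := by
  classical
  ext v
  constructor
  · intro hv
    by_contra hne
    simp only [Set.mem_ofPred_eq, not_forall] at hne
    obtain ⟨j₀, hj₀⟩ := hne
    -- Independence of the fⱼ provides vectors dual to them. Replacing the j₀-th of these by v gives
    -- a tuple on which the form equals f_{j₀}(v), the determinant of an identity matrix with one
    -- row changed.
    have hsurj : Function.Surjective (LinearMap.pi f) := by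
      rw [← LinearMap.range_eq_top, ← Subspace.dualAnnihilator_inj, Submodule.dualAnnihilator_top,
        eq_bot_iff]
      intro φ hφ
      rw [Submodule.mem_dualAnnihilator] at hφ
      have h1 : ∑ j, φ (Pi.single j 1) • f j = 0 := by
        ext x
        have := hφ (LinearMap.pi f x) ⟨x, rfl⟩
        rw [LinearMap.pi_apply_eq_sum_univ φ] at this
        have hs : ∀ i : Fin r, (Pi.single i 1 : Fin r → 𝕜) = fun j => if i = j then 1 else 0 := by
          intro i; ext j; simp [Pi.single_apply, eq_comm]
        simp only [hs]
        simpa [mul_comm] using this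
      have h2 := Fintype.linearIndependent_iff.1 hf _ h1
      rw [Submodule.mem_bot]
      ext j
      simpa using h2 j
    have hdet : Matrix.det (Matrix.of fun i j =>
        (Function.update (fun i : Fin r => (Pi.single i 1 : Fin r → 𝕜)) j₀ (fun j => f j v)) i j)
        = f j₀ v := by
      have : (Matrix.of fun i j =>
        (Function.update (fun i : Fin r => (Pi.single i 1 : Fin r → 𝕜)) j₀ (fun j => f j v)) i j)
          = Matrix.updateRow (1 : Matrix (Fin r) (Fin r) 𝕜) j₀ (fun j => f j v) := by
        ext i j
        by_cases hi : i = j₀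
        · subst hi; simp
        · simp [Matrix.updateRow_ne hi, Function.update_of_ne hi, Matrix.one_apply,
            Pi.single_apply, eq_comm]
      rw [this, ← Matrix.cramer_transpose_apply]
      simp
    choose g hg using hsurj
    set m : Fin r → V := Function.update (fun i => g (Pi.single i 1)) j₀ v
    have := hv m ⟨j₀, by simp [m]⟩
    rw [exteriorPower.pairingDual_ιMulti_ιMulti] at this
    apply hj₀
    rw [← hdet, ← this]
    congr 1
    ext i j
    by_cases hi : i = j₀
    · subst hi; simp [m]
    · have := congrFun (hg (Pi.single i 1)) j
      simp only [LinearMap.pi_apply] at this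
      simp [m, Function.update_of_ne hi, this]
  · rintro hv m ⟨i, rfl⟩
    rw [exteriorPower.pairingDual_ιMulti_ιMulti]
    exact Matrix.det_eq_zero_of_row_eq_zero i fun j => hv j

theorem linearIndependent_sum_pow_smul {r : ℕ} {n : Fin r → ℕ} (hn : ∀ j, 0 < n j)
    {e : (Σ j : Fin r, Fin (n j)) → V} (he : LinearIndependent 𝕜 e) (t : 𝕜) :
    LinearIndependent 𝕜 fun j => ∑ i : Fin (n j), t ^ (i : ℕ) • e ⟨j, i⟩ := by
  rw [Fintype.linearIndependent_iff] at he ⊢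
  intro g hg j
  have := he (fun x => g x.1 * t ^ (x.2 : ℕ)) (by
    rw [← hg, Fintype.sum_sigma]
    refine Finset.sum_congr rfl fun j _ => ?_
    rw [Finset.smul_sum]
    exact Finset.sum_congr rfl fun i _ => mul_smul _ _ _) ⟨j, 0, hn j⟩
  simpa using this

/-- The exterior algebra is eliminated here: the Veronese condition becomes an equality of subspaces
of the dual. -/
theorem coe_eq_formKer_veroneseCurve_iff [FiniteDimensional 𝕜 V] {r : ℕ} {n : Fin r → ℕ}
    (hn : ∀ j, 0 < n j) (e : Basis (Σ j : Fin r, Fin (n j)) 𝕜 (Dual 𝕜 V)) (t : 𝕜)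
    (w : Submodule 𝕜 V) : (w : Set V) = formKer (veroneseCurve e t) ↔ w.dualAnnihilator =
      Submodule.span 𝕜 (Set.range fun j => ∑ i : Fin (n j), t ^ (i : ℕ) • e ⟨j, i⟩) := by
  have h1 : formKer (veroneseCurve e t) = ((Submodule.span 𝕜 (Set.range fun j =>
      ∑ i : Fin (n j), t ^ (i : ℕ) • e ⟨j, i⟩)).dualCoannihilator : Set V) := by
    rw [veroneseCurve, formKer_ιMulti (linearIndependent_sum_pow_smul hn e.linearIndependent t)]
    ext v
    rw [SetLike.mem_coe, Submodule.mem_dualCoannihilator]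
    constructor
    · intro hv φ hφ
      have : Submodule.span 𝕜 (Set.range fun j => ∑ i : Fin (n j), t ^ (i : ℕ) • e ⟨j, i⟩) ≤
          LinearMap.ker (Dual.eval 𝕜 V v) := by
        rw [Submodule.span_le]
        rintro _ ⟨j, rfl⟩
        exact hv j
      exact this hφ
    · intro hv j
      exact hv _ (Submodule.subset_span ⟨j, rfl⟩)
  rw [h1, SetLike.coe_set_eq]
  constructor
  · rintro rfl
    rw [Subspace.dualCoannihilator_dualAnnihilator_eq]
  · intro h
    rw [← h, Subspace.dualAnnihilator_dualCoannihilator_eq]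

/-- An alternating form induces a nondegenerate form on the quotient by its kernel. -/
theorem exists_quotient_form {B : LinearMap.BilinForm 𝕜 V} (hB : B.IsAlt) {K : Submodule 𝕜 V}
    (hK : LinearMap.ker B = K) : ∃ ω : LinearMap.BilinForm 𝕜 (V ⧸ K), ω.IsAlt ∧ ω.Nondegenerate ∧
      ∀ x y, ω (Submodule.Quotient.mk x) (Submodule.Quotient.mk y) = B x y := by
  obtain ⟨s, hs⟩ := K.mkQ.exists_rightInverse_of_surjective K.range_mkQ
  have hs' : ∀ x : V, s (Submodule.Quotient.mk x) - x ∈ LinearMap.ker B := by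
    intro x
    rw [hK, ← Submodule.Quotient.mk_eq_zero, Submodule.Quotient.mk_sub, sub_eq_zero]
    exact LinearMap.congr_fun hs (Submodule.Quotient.mk x)
  have hl : ∀ x y, B (s (Submodule.Quotient.mk x)) y = B x y := by
    intro x y
    have : B (s (Submodule.Quotient.mk x)) = B x := by
      rw [← sub_eq_zero, ← map_sub]; exact hs' x
    rw [this]
  have key : ∀ x y, B.compl₁₂ s s (Submodule.Quotient.mk x) (Submodule.Quotient.mk y) = B x y := by
    intro x y
    rw [LinearMap.compl₁₂_apply, hl, ← hB.neg_eq, hl, hB.neg_eq]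
  have hsep : ∀ x, (∀ y, B.compl₁₂ s s x y = 0) → x = 0 := by
    intro x hx
    obtain ⟨x, rfl⟩ := Submodule.Quotient.mk_surjective _ x
    rw [Submodule.Quotient.mk_eq_zero, ← hK, LinearMap.mem_ker]
    ext y
    rw [← key]
    exact hx _
  have halt : LinearMap.BilinForm.IsAlt (B.compl₁₂ s s) := fun x => hB _
  refine ⟨B.compl₁₂ s s, halt, ⟨hsep, fun y hy => hsep y fun x => ?_⟩, key⟩
  rw [← LinearMap.BilinForm.IsAlt.neg_eq halt, hy x, neg_zero]

end Forms

/-! ### The web of a maximal pair, its reduced pair and the corank jumps. -/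

section Webs

variable {𝕜 W : Type*} [Field 𝕜] [AddCommGroup W] [Module 𝕜 W] [FiniteDimensional 𝕜 W]
  {Λ Λ₁ : LinearMap.BilinForm 𝕜 (Dual 𝕜 W)}

namespace IsMaximal

variable (h : IsMaximal Λ Λ₁)
include h

/-- The dual of `W / L₀` is the span of the generic kernels of the pair. -/
noncomputable def dualQuotCoreEquiv : Dual 𝕜 (W ⧸ core Λ Λ₁) ≃ₗ[𝕜] kernelSpan Λ Λ₁ :=
  (core Λ Λ₁).dualQuotEquivDualAnnihilator.trans (LinearEquiv.ofEq _ _ h.dualAnnihilator_core)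

/-- Functionals on W/L₀ are the elements of S, and one of them kills w(t) exactly when it kills Im(Λ
+ tΛ₁), that is, when it lies in the kernel at t. -/
theorem map_dualAnnihilator_web (t : 𝕜) :
    (web Λ Λ₁ t).dualAnnihilator.map ((kernelSpan Λ Λ₁).subtype ∘ₗ
      h.dualQuotCoreEquiv.toLinearMap) = LinearMap.ker (Λ + t • Λ₁) ⊓ kernelSpan Λ Λ₁ := by
  have key : ∀ φ : Dual 𝕜 (W ⧸ core Λ Λ₁), φ ∈ (web Λ Λ₁ t).dualAnnihilator ↔
      (h.dualQuotCoreEquiv φ : Dual 𝕜 W) ∈ LinearMap.ker (Λ + t • Λ₁) := by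
    intro φ
    rw [← dualAnnihilator_image (h.alt_add_smul t), Submodule.mem_dualAnnihilator,
      Submodule.mem_dualAnnihilator]
    constructor
    · intro hφ x hx
      exact hφ _ ⟨x, hx, rfl⟩
    · rintro hφ _ ⟨x, hx, rfl⟩
      exact hφ x hx
  ext α
  constructor
  · rintro ⟨φ, hφ, rfl⟩
    exact ⟨(key φ).1 hφ, (h.dualQuotCoreEquiv φ).2⟩
  · rintro ⟨h1, h2⟩
    refine ⟨h.dualQuotCoreEquiv.symm ⟨α, h2⟩, (key _).2 ?_, ?_⟩
    · rw [LinearEquiv.apply_symm_apply]; exact h1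
    · simp

/-- Characteristic numbers of the web in terms of the generic kernels of the pair. -/
theorem hasCharacteristicNumbers_web_iff {r : ℕ} {n : Fin r → ℕ} :
    HasCharacteristicNumbers (web Λ Λ₁) n ↔ (∀ j, 0 < n j) ∧
      ∃ e : Basis (Σ j : Fin r, Fin (n j)) 𝕜 (kernelSpan Λ Λ₁), ∀ t : 𝕜,
        LinearMap.ker (Λ + t • Λ₁) ⊓ kernelSpan Λ Λ₁ = Submodule.span 𝕜 (Set.range fun j =>
          ∑ i : Fin (n j), t ^ (i : ℕ) • (e ⟨j, i⟩ : Dual 𝕜 W)) := by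
  unfold HasCharacteristicNumbers
  refine and_congr_right fun hn => ?_
  have key : ∀ (e : Basis (Σ j : Fin r, Fin (n j)) 𝕜 (Dual 𝕜 (W ⧸ core Λ Λ₁))) (t : 𝕜),
      ((web Λ Λ₁ t : Set _) = formKer (veroneseCurve e t)) ↔
      LinearMap.ker (Λ + t • Λ₁) ⊓ kernelSpan Λ Λ₁ = Submodule.span 𝕜 (Set.range fun j =>
          ∑ i : Fin (n j), t ^ (i : ℕ) • ((e.map h.dualQuotCoreEquiv) ⟨j, i⟩ : Dual 𝕜 W)) := by
    intro e t
    rw [coe_eq_formKer_veroneseCurve_iff hn, ← h.map_dualAnnihilator_web,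
      ← (Submodule.map_injective_of_injective (f := (kernelSpan Λ Λ₁).subtype ∘ₗ
      h.dualQuotCoreEquiv.toLinearMap) (Subtype.val_injective.comp
        h.dualQuotCoreEquiv.injective)).eq_iff, Submodule.map_span, ← Set.range_comp]
    have : ((kernelSpan Λ Λ₁).subtype ∘ₗ h.dualQuotCoreEquiv.toLinearMap) ∘
        (fun j => ∑ i : Fin (n j), t ^ (i : ℕ) • e ⟨j, i⟩) = fun j =>
          ∑ i : Fin (n j), t ^ (i : ℕ) • ((e.map h.dualQuotCoreEquiv) ⟨j, i⟩ : Dual 𝕜 W) := by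
      funext j
      simp [map_sum]
    rw [this]
  constructor
  · rintro ⟨e, he⟩
    exact ⟨e.map h.dualQuotCoreEquiv, fun t => (key e t).1 (he t)⟩
  · rintro ⟨e, he⟩
    refine ⟨e.map h.dualQuotCoreEquiv.symm, fun t => (key _ t).2 ?_⟩
    rw [he t]
    simp

/-- S remains spanned by its kernels when finitely many parameters are dropped, as
`exists_isChainBasis` demands. The number of chains is read off at t = 0, where the whole of ker Λ
lies in S. -/
theorem exists_isChainBasis_kernelSpan [Infinite 𝕜] : ∃ (n : Fin (pairCorank Λ Λ₁) → ℕ)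
    (e : Fin (pairCorank Λ Λ₁) → ℕ → kernelSpan Λ Λ₁),
      IsChainBasis (Λ.domRestrict (kernelSpan Λ Λ₁)) (Λ₁.domRestrict (kernelSpan Λ Λ₁)) n e := by
  obtain ⟨ι, _, n, e, he⟩ := exists_isChainBasis (𝕜 := 𝕜) (S := kernelSpan Λ Λ₁)
    (Y := Dual 𝕜 (Dual 𝕜 W))
    (Λ.domRestrict (kernelSpan Λ Λ₁)) (Λ₁.domRestrict (kernelSpan Λ Λ₁)) (by
      intro F hF
      rw [eq_top_iff, ← Submodule.map_le_map_iff_of_injective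
        (kernelSpan Λ Λ₁).injective_subtype, Submodule.map_top, Submodule.range_subtype]
      refine h.isRegularPencil.kernelSpan_le _ hF fun t ht htF x hx => ?_
      refine ⟨⟨x, IsRegularPencil.ker_le_kernelSpan_of_mem ht hx⟩, ?_, rfl⟩
      exact Submodule.mem_iSup_of_mem t (Submodule.mem_iSup_of_mem htF hx))
  have hcard : Fintype.card (Fin (pairCorank Λ Λ₁)) = Fintype.card ι := by
    rw [Fintype.card_fin, h.pairCorank_eq, ← he.finrank_ker 0, zero_smul, add_zero]
    symm
    have : LinearMap.ker Λ = (LinearMap.ker (Λ.domRestrict (kernelSpan Λ Λ₁))).map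
        (kernelSpan Λ Λ₁).subtype := by
      ext x
      constructor
      · intro hx
        exact ⟨⟨x, IsRegularPencil.ker_le_kernelSpan hx⟩, hx, rfl⟩
      · rintro ⟨y, hy, rfl⟩
        exact hy
    rw [this]
    exact (LinearEquiv.finrank_eq (Submodule.equivMapOfInjective _
      (kernelSpan Λ Λ₁).injective_subtype _))
  exact ⟨_, _, he.reindex (Fintype.equivOfCardEq hcard)⟩

omit h [FiniteDimensional 𝕜 W] in
theorem map_ker_domRestrict (t : 𝕜) : (LinearMap.ker (Λ.domRestrict (kernelSpan Λ Λ₁) +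
      t • Λ₁.domRestrict (kernelSpan Λ Λ₁))).map (kernelSpan Λ Λ₁).subtype =
    LinearMap.ker (Λ + t • Λ₁) ⊓ kernelSpan Λ Λ₁ := by
  ext x
  constructor
  · rintro ⟨y, hy, rfl⟩
    exact ⟨hy, y.2⟩
  · rintro ⟨h1, h2⟩
    exact ⟨⟨x, h2⟩, h1, rfl⟩

theorem isVeroneseWeb [Infinite 𝕜] : IsVeroneseWeb (pairCorank Λ Λ₁) (web Λ Λ₁) := by
  obtain ⟨n, e, he⟩ := h.exists_isChainBasis_kernelSpan
  refine ⟨n, h.hasCharacteristicNumbers_web_iff.2 ⟨he.pos,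
    Basis.mk he.linearIndependent he.top_le_span, fun t => ?_⟩⟩
  rw [← map_ker_domRestrict, he.ker_eq_span, Submodule.map_span, ← Set.range_comp]
  congr 2
  funext j
  simp only [Function.comp_apply, map_sum, Basis.mk_apply]
  rw [← Fin.sum_univ_eq_sum_range (fun i => (kernelSpan Λ Λ₁).subtype (t ^ i • e j i))]
  rfl

theorem finrank_ker_inf_kernelSpan [Infinite 𝕜] (t : 𝕜) :
    finrank 𝕜 (LinearMap.ker (Λ + t • Λ₁) ⊓ kernelSpan Λ Λ₁ : Submodule 𝕜 (Dual 𝕜 W)) =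
      pairCorank Λ Λ₁ := by
  obtain ⟨n, e, he⟩ := h.exists_isChainBasis_kernelSpan
  rw [← map_ker_domRestrict, ← (Submodule.equivMapOfInjective _
      (kernelSpan Λ Λ₁).injective_subtype _).finrank_eq, he.finrank_ker, Fintype.card_fin]

/-- The part of the kernel inside S always has dimension r, so the corank jumps exactly when some
kernel vector lies outside S. -/
theorem mem_regularSet_iff [Infinite 𝕜] (t : 𝕜) :
    t ∈ regularSet Λ Λ₁ ↔ LinearMap.ker (Λ + t • Λ₁) ≤ kernelSpan Λ Λ₁ := by
  constructor
  · exact fun ht => IsRegularPencil.ker_le_kernelSpan_of_mem ht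
  · intro ht
    have := h.finrank_ker_inf_kernelSpan t
    rw [inf_eq_left.2 ht, h.pairCorank_eq] at this
    exact this

/-- The image of S lies in Λ(S) = Λ₁(S), and its dimension is dim S - r for every t, even a singular
one. -/
theorem map_kernelSpan_add_smul [Infinite 𝕜] (t : 𝕜) :
    (kernelSpan Λ Λ₁).map (Λ + t • Λ₁) = (kernelSpan Λ Λ₁).map Λ₁ := by
  rw [← h.isRegularPencil.map_kernelSpan_eq]
  have key : ∀ t : 𝕜, finrank 𝕜 ((kernelSpan Λ Λ₁).map (Λ + t • Λ₁)) + pairCorank Λ Λ₁ =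
      finrank 𝕜 (kernelSpan Λ Λ₁) := by
    intro t
    have h1 := LinearMap.finrank_range_add_finrank_ker (K := 𝕜)
      (V := kernelSpan Λ Λ₁) (V₂ := Dual 𝕜 (Dual 𝕜 W))
      ((Λ + t • Λ₁).domRestrict (kernelSpan Λ Λ₁))
    have h2 : finrank 𝕜 (LinearMap.ker ((Λ + t • Λ₁).domRestrict (kernelSpan Λ Λ₁))) =
        pairCorank Λ Λ₁ := by
      rw [← h.finrank_ker_inf_kernelSpan t, ← map_ker_domRestrict, ← (Submodule.equivMapOfInjective _
        (kernelSpan Λ Λ₁).injective_subtype _).finrank_eq]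
      rfl
    rw [LinearMap.range_domRestrict, h2] at h1
    exact h1
  have h0 := key 0
  rw [zero_smul, add_zero] at h0
  have ht := key t
  apply Submodule.eq_of_le_of_finrank_eq
  · rintro _ ⟨x, hx, rfl⟩
    have h1 : Λ₁ x ∈ (kernelSpan Λ Λ₁).map Λ := by
      rw [h.isRegularPencil.map_kernelSpan_eq]; exact Submodule.mem_map_of_mem hx
    exact Submodule.add_mem _ (Submodule.mem_map_of_mem hx) (Submodule.smul_mem _ t h1)
  · omega

end IsMaximal

namespace IsReducedPair

variable {σ : SymplecticPair 𝕜 (ReducedSpace Λ Λ₁)} (hσ : IsReducedPair Λ Λ₁ σ)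
  (h : IsMaximal Λ Λ₁)
include h hσ

theorem ω_apply {α : Dual 𝕜 W} {x y : core Λ Λ₁} (hx : sharp Λ α = x) :
    σ.ω (Submodule.Quotient.mk x) (Submodule.Quotient.mk y) = -α y := by
  obtain ⟨h0, h1, hxy⟩ := hσ
  rw [(hxy x y).1, restrictedForm_apply h.alt h0 hx]

theorem ω₁_apply {α : Dual 𝕜 W} {x y : core Λ Λ₁} (hx : sharp Λ₁ α = x) :
    σ.ω₁ (Submodule.Quotient.mk x) (Submodule.Quotient.mk y) = -α y := by
  obtain ⟨h0, h1, hxy⟩ := hσ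
  rw [(hxy x y).2, restrictedForm_apply h.alt₁ h1 hx]

/-- A kernel vector α at a is orthogonal to S, so Λ(α, ·) lies in L₀; its class is an eigenvector of
J for -a, and it is non-zero when α is outside S because ker Λ is inside S. -/
theorem isRoot_charpoly_iff [Infinite 𝕜] (a : 𝕜) :
    pairCorank Λ Λ₁ < corank (Λ + a • Λ₁) ↔ σ.charpoly.IsRoot (-a) := by
  have h1 : pairCorank Λ Λ₁ < corank (Λ + a • Λ₁) ↔
      ¬ LinearMap.ker (Λ + a • Λ₁) ≤ kernelSpan Λ Λ₁ := by
    rw [← h.mem_regularSet_iff, corank_eq, h.pairCorank_eq]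
    have := h.isRegularPencil.le_finrank a
    change _ ↔ ¬ (_ = _)
    omega
  rw [h1, SymplecticPair.charpoly, ← Module.End.hasEigenvalue_iff_isRoot_charpoly]
  constructor
  · intro hne
    obtain ⟨α, hα, hαS⟩ := SetLike.not_le_iff_exists.1 hne
    have hα' : Λ α + a • Λ₁ α = 0 := hα
    have hx : sharp Λ α ∈ core Λ Λ₁ := by
      rw [h.mem_core]
      intro β hβ
      rw [apply_sharp]
      exact (apply_eq_zero_of_mem_ker_of_mem_kernelSpan h.alt h.alt₁ h.isRegularPencil hα hβ).1
    have hx₁ : sharp Λ₁ (-a • α) = sharp Λ α := by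
      have : Λ₁ (-a • α) = Λ α := by
        ext β
        have := LinearMap.congr_fun hα' β
        simp only [LinearMap.add_apply, LinearMap.smul_apply, smul_eq_mul,
          LinearMap.zero_apply] at this
        simp only [map_smul, LinearMap.smul_apply, smul_eq_mul]
        linear_combination -this
      simp only [sharp, LinearMap.comp_apply, this]
    refine Module.End.hasEigenvalue_of_hasEigenvector
      (x := Submodule.Quotient.mk ⟨sharp Λ α, hx⟩) ⟨?_, ?_⟩
    · rw [Module.End.mem_eigenspace_iff, ← sub_eq_zero]
      refine σ.nondeg.1 _ fun y => ?_
      obtain ⟨y, rfl⟩ := Submodule.Quotient.mk_surjective _ y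
      have e1 := hσ.ω_apply h (α := α) (x := ⟨sharp Λ α, hx⟩) (y := y) rfl
      have e2 := hσ.ω₁_apply h (x := ⟨sharp Λ α, hx⟩) (y := y) hx₁
      rw [map_sub, LinearMap.sub_apply, SymplecticPair.ω_endo, e2, map_smul]
      simp only [LinearMap.smul_apply, e1]
      simp
    · rw [Ne, Submodule.Quotient.mk_eq_zero, Submodule.submoduleOf, Submodule.mem_comap, h.coreKernel_eq]
      rintro ⟨s, hs, hs'⟩
      apply hαS
      have : s - α ∈ LinearMap.ker Λ := by
        rw [← ker_sharp, LinearMap.mem_ker, map_sub, sub_eq_zero]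
        exact hs'
      have := Submodule.sub_mem _ hs (IsRegularPencil.ker_le_kernelSpan (B := Λ₁) this)
      simpa using this
  · intro hev hle
    obtain ⟨v, hv, hv0⟩ := hev.exists_hasEigenvector
    obtain ⟨x, rfl⟩ := Submodule.Quotient.mk_surjective _ v
    rw [Module.End.mem_eigenspace_iff] at hv
    obtain ⟨α, hα⟩ := h.core_le_image x.2
    obtain ⟨α₁, hα₁⟩ := h.core_le_image₁ x.2
    have hs : α₁ + a • α ∈ kernelSpan Λ Λ₁ := by
      rw [← h.dualAnnihilator_core, Submodule.mem_dualAnnihilator]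
      intro y hy
      have e1 := σ.ω_endo (Submodule.Quotient.mk x) (Submodule.Quotient.mk ⟨y, hy⟩)
      rw [hv, hσ.ω₁_apply h hα₁, map_smul, LinearMap.smul_apply, hσ.ω_apply h hα] at e1
      simp only [smul_eq_mul, neg_mul_neg] at e1
      simp only [LinearMap.add_apply, LinearMap.smul_apply, smul_eq_mul, e1]
      ring
    -- Conversely an eigenvector has a representative α that solves the kernel equation only up to
    -- Λ₁(S). Since this is also (Λ + aΛ₁)(S), α can be corrected by an element of S.
    have h2 : (Λ + a • Λ₁) α ∈ (kernelSpan Λ Λ₁).map (Λ + a • Λ₁) := by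
      rw [h.map_kernelSpan_add_smul]
      refine ⟨_, hs, ?_⟩
      have : Λ α = Λ₁ α₁ := (evalEquiv 𝕜 W).symm.injective (hα.trans hα₁.symm)
      rw [map_add, map_smul, ← this]
      rfl
    obtain ⟨s', hs', hs''⟩ := h2
    have h3 : α - s' ∈ LinearMap.ker (Λ + a • Λ₁) := by
      rw [LinearMap.mem_ker, map_sub, hs'', sub_self]
    have h4 : α ∈ kernelSpan Λ Λ₁ := by simpa using Submodule.add_mem _ (hle h3) hs'
    apply hv0
    rw [Submodule.Quotient.mk_eq_zero, Submodule.submoduleOf, Submodule.mem_comap, h.coreKernel_eq]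
    exact ⟨α, h4, hα⟩

end IsReducedPair

theorem IsMaximal.exists_isReducedPair [Infinite 𝕜] (h : IsMaximal Λ Λ₁) :
    (LinearMap.ker (restrictedForm Λ h.core_le_image)).map (core Λ Λ₁).subtype = coreKernel Λ Λ₁ ∧
    (LinearMap.ker (restrictedForm Λ₁ h.core_le_image₁)).map (core Λ Λ₁).subtype =
      coreKernel Λ Λ₁ ∧ ∃ σ : SymplecticPair 𝕜 (ReducedSpace Λ Λ₁), IsReducedPair Λ Λ₁ σ := by
  have h0 : (LinearMap.ker (restrictedForm Λ h.core_le_image)).map (core Λ Λ₁).subtype =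
      coreKernel Λ Λ₁ := map_ker_restrictedForm h.alt _ h.coreKernel_le_core
  have h1 : (LinearMap.ker (restrictedForm Λ₁ h.core_le_image₁)).map (core Λ Λ₁).subtype =
      coreKernel Λ Λ₁ := by
    have e : coreKernel Λ Λ₁ = (core Λ Λ₁).dualAnnihilator.map (sharp Λ₁) := by
      rw [h.coreKernel_eq₁, h.dualAnnihilator_core]
    rw [map_ker_restrictedForm h.alt₁ _ (e ▸ h.coreKernel_le_core), e]
  refine ⟨h0, h1, ?_⟩
  have key : ∀ {K : Submodule 𝕜 (core Λ Λ₁)}, K.map (core Λ Λ₁).subtype = coreKernel Λ Λ₁ →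
      K = (coreKernel Λ Λ₁).submoduleOf (core Λ Λ₁) := by
    intro K hK
    rw [← hK, Submodule.submoduleOf,
      Submodule.comap_map_eq_of_injective (core Λ Λ₁).injective_subtype]
  have halt : ∀ {Λ : LinearMap.BilinForm 𝕜 (Dual 𝕜 W)} {L : Submodule 𝕜 W} (hL : L ≤ image Λ),
      Λ.IsAlt → (restrictedForm Λ hL).IsAlt := fun _ h x => h _
  obtain ⟨ω, a1, a2, a3⟩ := exists_quotient_form (halt h.core_le_image h.alt) (key h0)
  obtain ⟨ω₁, b1, b2, b3⟩ := exists_quotient_form (halt h.core_le_image₁ h.alt₁) (key h1)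
  exact ⟨⟨ω, ω₁, a1, b1, a2, b2⟩, h.core_le_image, h.core_le_image₁,
    fun x y => ⟨a3 x y, b3 x y⟩⟩

end Webs

section Model

variable {𝕜 : Type*} [Field 𝕜]

variable (𝕜) in
/-- The hyperplane `∑ⱼ vⱼ = 0`, with `vⱼ` the first coordinate in the `j`-th factor; with the
restrictions of two weighted forms it is a model of the dual of the Kronecker elementary pair. -/
def zeroSum (n : ℕ) : Submodule 𝕜 (Fin n → 𝕜 × 𝕜) where
  carrier := {v | ∑ i, (v i).1 = 0}
  add_mem' {v w} hv hw := by
    simp only [Set.mem_ofPred_eq] at hv hw ⊢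
    simp [Finset.sum_add_distrib, hv, hw]
  zero_mem' := by simp
  smul_mem' c v hv := by
    simp only [Set.mem_ofPred_eq] at hv ⊢
    simp [← Finset.mul_sum, hv]

theorem mem_zeroSum {n : ℕ} {v : Fin n → 𝕜 × 𝕜} : v ∈ zeroSum 𝕜 n ↔ ∑ i, (v i).1 = 0 := Iff.rfl

end Model

/-! ### Extending the pencil so that it degenerates at prescribed parameters. -/

section Extension

variable {𝕜 U ι : Type*} [Field 𝕜] [AddCommGroup U] [Module 𝕜 U]

/-- The extension of a form on `U` to `U × C` which vanishes on `C` and pairs `C` with `U` by `φ`. -/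
def extendForm {C : Type*} [AddCommGroup C] [Module 𝕜 C] (A : LinearMap.BilinForm 𝕜 U)
    (φ : C →ₗ[𝕜] Dual 𝕜 U) : LinearMap.BilinForm 𝕜 (U × C) :=
  A.compl₁₂ (LinearMap.fst 𝕜 U C) (LinearMap.fst 𝕜 U C) +
    (φ.compl₁₂ (LinearMap.snd 𝕜 U C) (LinearMap.fst 𝕜 U C) -
      (φ.compl₁₂ (LinearMap.snd 𝕜 U C) (LinearMap.fst 𝕜 U C)).flip)

theorem extendForm_apply {C : Type*} [AddCommGroup C] [Module 𝕜 C] (A : LinearMap.BilinForm 𝕜 U)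
    (φ : C →ₗ[𝕜] Dual 𝕜 U) (x y : U × C) :
    extendForm A φ x y = A x.1 y.1 + (φ x.2 y.1 - φ y.2 x.1) := rfl

theorem extendForm_isAlt {C : Type*} [AddCommGroup C] [Module 𝕜 C] {A : LinearMap.BilinForm 𝕜 U}
    (hA : A.IsAlt) (φ : C →ₗ[𝕜] Dual 𝕜 U) : (extendForm A φ).IsAlt := by
  intro x
  rw [extendForm_apply, hA x.1, sub_self, add_zero]

theorem _root_.LinearIndependent.exists_dual_apply_eq {X : Type*} {e : X → U}
    (he : LinearIndependent 𝕜 e) (g : X → 𝕜) : ∃ φ : Dual 𝕜 U, ∀ x, φ (e x) = g x := by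
  obtain ⟨φ, hφ⟩ := ((Basis.span he).constr 𝕜 g).exists_extend
  refine ⟨φ, fun x => ?_⟩
  have h1 := LinearMap.congr_fun hφ (Basis.span he x)
  rw [Basis.constr_basis, LinearMap.comp_apply, Submodule.subtype_apply, Basis.span_apply] at h1
  exact h1

theorem _root_.LinearMap.BilinForm.IsAlt.exists_apply_eq [FiniteDimensional 𝕜 U]
    {D : LinearMap.BilinForm 𝕜 U} (hD : D.IsAlt) {θ : Dual 𝕜 U}
    (hθ : ∀ x ∈ LinearMap.ker D, θ x = 0) : ∃ u, D u = θ := by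
  have h1 : θ ∈ (LinearMap.ker D).dualAnnihilator := (Submodule.mem_dualAnnihilator _).2 hθ
  rw [LinearMap.dualAnnihilator_ker_eq_range_flip] at h1
  obtain ⟨u, hu⟩ := h1
  refine ⟨-u, ?_⟩
  rw [← hu]
  ext y
  rw [map_neg, LinearMap.neg_apply, hD.neg_eq]
  rfl

/-- Interpolation at `0` of polynomials of degree less than `n` from `n` distinct points. -/
theorem exists_interpolation_weights {n : ℕ} {τ : Fin n → 𝕜} (hτ : Function.Injective τ) :
    ∃ c : Fin n → 𝕜, ∀ k : Fin n, ∑ i, c i * τ i ^ (k : ℕ) = 0 ^ (k : ℕ) := by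
  classical
  have hdet : IsUnit (Matrix.vandermonde τ).det :=
    (Matrix.det_vandermonde_ne_zero_iff.2 hτ).isUnit
  -- With 0 ^ 0 = 1, the row (0ᵏ) is (1, 0, …, 0), the evaluation of polynomials at 0.
  refine ⟨Matrix.vecMul (fun k : Fin n => (0 : 𝕜) ^ (k : ℕ)) (Matrix.vandermonde τ)⁻¹, fun k => ?_⟩
  have : Matrix.vecMul (Matrix.vecMul (fun k : Fin n => (0 : 𝕜) ^ (k : ℕ))
      (Matrix.vandermonde τ)⁻¹) (Matrix.vandermonde τ) = fun k : Fin n => (0 : 𝕜) ^ (k : ℕ) := by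
    rw [Matrix.vecMul_vecMul, Matrix.nonsing_inv_mul _ hdet, Matrix.vecMul_one]
  exact congrFun this k

/-- The product has constant term 1 and degree at most n. Removing the 1 and one factor t leaves
exactly n coefficients, as many as a functional can take on a chain of length n. -/
theorem prod_one_add_eq_sum {n : ℕ} (b : Fin n → 𝕜) :
    ∃ q : Fin n → 𝕜, ∀ t : 𝕜, ∏ i, (1 + t * b i) = 1 + t * ∑ i : Fin n, t ^ (i : ℕ) * q i := by
  set P : 𝕜[X] := ∏ i, (1 + X * C (b i)) with hP
  refine ⟨fun i => P.coeff (i + 1), fun t => ?_⟩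
  have h1 : ∏ i, (1 + t * b i) = P.eval t := by
    rw [hP, eval_prod]
    exact Finset.prod_congr rfl fun i _ => by
      rw [eval_add, eval_one, eval_mul, eval_X, eval_C]
  have hdeg : P.natDegree < n + 1 := by
    refine Nat.lt_succ_of_le ((natDegree_prod_le _ _).trans ?_)
    refine (Finset.sum_le_card_nsmul _ _ 1 fun i _ => ?_).trans (by simp)
    compute_degree
  have h0 : P.coeff 0 = 1 := by
    rw [coeff_zero_eq_eval_zero, hP, eval_prod]
    exact Finset.prod_eq_one fun i _ => by simp
  rw [h1, eval_eq_sum_range' hdeg, Finset.sum_range_succ', h0, pow_zero, mul_one, add_comm,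
    Finset.mul_sum, ← Fin.sum_univ_eq_sum_range (fun i => P.coeff (i + 1) * t ^ (i + 1))]
  congr 1
  exact Finset.sum_congr rfl fun i _ => by ring

variable [Fintype ι] [DecidableEq ι] {n : ι → ℕ}

/-- The vectors `γⱼ(t) = ∑ᵢ tⁱ eⱼᵢ`. -/
def veroneseVector (e : (Σ j, Fin (n j)) → U) (t : 𝕜) (j : ι) : U :=
  ∑ i : Fin (n j), t ^ (i : ℕ) • e ⟨j, i⟩

omit [Fintype ι] in
/-- Functionals which pair with the curves `γⱼ` to prescribed products. -/
theorem exists_dual_veroneseVector (hn : ∀ j, 0 < n j) {e : (Σ j, Fin (n j)) → U}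
    (he : LinearIndependent 𝕜 e) (b : ∀ j, Fin (n j) → 𝕜) : ∃ φ ψ : ι → Dual 𝕜 U, ∀ k j t,
      φ k (veroneseVector e t j) + t * ψ k (veroneseVector e t j) =
        if j = k then ∏ i, (1 + t * b j i) else 0 := by
  choose q hq using fun j => prod_one_add_eq_sum (b j)
  choose φ hφ using fun k => he.exists_dual_apply_eq
    (fun x => if x.1 = k ∧ (x.2 : ℕ) = 0 then (1 : 𝕜) else 0)
  choose ψ hψ using fun k => he.exists_dual_apply_eq
    (fun x => if x.1 = k then q x.1 x.2 else 0)
  refine ⟨φ, ψ, fun k j t => ?_⟩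
  simp only [veroneseVector, map_sum, map_smul, hφ, hψ, smul_eq_mul]
  by_cases hjk : j = k
  · subst hjk
    simp only [true_and, if_true]
    rw [hq]
    congr 1
    refine (Finset.sum_eq_single (⟨0, hn j⟩ : Fin (n j)) (fun i _ hi => ?_) (by simp)).trans
      (by simp)
    have : (i : ℕ) ≠ 0 := fun h => hi (Fin.ext h)
    simp [this]
  · simp [hjk]

omit [Fintype ι] [DecidableEq ι] in
theorem one_add_neg_mul_inv_ne_zero {b b' : 𝕜} (hb' : b' ≠ 0) (hbb : b ≠ b') :
    1 + -b * b'⁻¹ ≠ 0 := by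
  intro h
  apply hbb
  field_simp at h
  linear_combination -h

/-- The vectors completing `γⱼ(-bⱼᵢ)` to a basis of the kernel of the extended pencil. -/
theorem exists_completion [FiniteDimensional 𝕜 U] {A B : LinearMap.BilinForm 𝕜 U} (hA : A.IsAlt)
    (hB : B.IsAlt) {e : (Σ j, Fin (n j)) → U}
    {b : ∀ j, Fin (n j) → 𝕜} (hb : ∀ j i, b j i ≠ 0)
    (hinj : Function.Injective fun x : Σ j, Fin (n j) => b x.1 x.2)
    (hker : ∀ (t : 𝕜) j, veroneseVector e t j ∈ LinearMap.ker (A + t • B)) {j₀ : ι} {i₀ : Fin (n j₀)}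
    (hker' : LinearMap.ker (A + (-b j₀ i₀ : 𝕜) • B) ≤
      Submodule.span 𝕜 (Set.range (veroneseVector e (-b j₀ i₀))))
    {φ ψ : ι → Dual 𝕜 U} (hφψ : ∀ k j t,
      φ k (veroneseVector e t j) + t * ψ k (veroneseVector e t j) =
        if j = k then ∏ i, (1 + t * (b j i)⁻¹) else 0) :
    ∃ u : U, (∀ v, A u v + -b j₀ i₀ * B u v = -(φ j₀ v + -b j₀ i₀ * ψ j₀ v)) ∧
      ∀ k, φ k u + -b j₀ i₀ * ψ k u = 0 := by
  set τ := -b j₀ i₀ with hτ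
  have hD : LinearMap.BilinForm.IsAlt (A + τ • B) := fun x => by simp [hA x, hB x]
  have hzero : ∀ j, (φ j₀ + τ • ψ j₀) (veroneseVector e τ j) = 0 := by
    intro j
    have := hφψ j₀ j τ
    by_cases hj : j = j₀
    · subst hj
      rw [if_pos rfl, Finset.prod_eq_zero (Finset.mem_univ i₀)] at this
      · exact this
      · rw [hτ, neg_mul, mul_inv_cancel₀ (hb j i₀), add_neg_cancel]
    · rw [if_neg hj] at this
      exact this
  have hle : Submodule.span 𝕜 (Set.range (veroneseVector e τ)) ≤
      LinearMap.ker (φ j₀ + τ • ψ j₀) := by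
    rw [Submodule.span_le]
    rintro _ ⟨j, rfl⟩
    exact hzero j
  -- At τ = -b j₀ i₀ a factor of the product vanishes, so the functional kills the kernel of the
  -- form and the equation for u₀ is solvable.
  obtain ⟨u₀, hu₀⟩ := hD.exists_apply_eq (θ := -(φ j₀ + τ • ψ j₀)) fun x hx => by
    rw [LinearMap.neg_apply, neg_eq_zero]
    exact hle (hker' hx)
  -- Kernel vectors may be added freely to u₀. For k ≠ j₀ the product is non-zero because the
  -- weights are distinct, so the k-th condition can be enforced; for k = j₀ it already holds, being
  -- the alternating form evaluated at (u₀, u₀).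
  set a : ι → 𝕜 := fun k => if k = j₀ then 0 else
    -(φ k u₀ + τ * ψ k u₀) / ∏ i, (1 + τ * (b k i)⁻¹)
  have hu : ∀ k, (φ k + τ • ψ k) (∑ j, a j • veroneseVector e τ j) =
      a k * ∏ i, (1 + τ * (b k i)⁻¹) := by
    intro k
    rw [map_sum, Finset.sum_eq_single k]
    · rw [map_smul, smul_eq_mul]
      have := hφψ k k τ
      rw [if_pos rfl] at this
      rw [← this]
      rfl
    · intro j _ hj
      have := hφψ k j τ
      rw [if_neg hj] at this
      rw [map_smul, LinearMap.add_apply, LinearMap.smul_apply, smul_eq_mul, smul_eq_mul, this,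
        mul_zero]
    · simp
  refine ⟨u₀ + ∑ j, a j • veroneseVector e τ j, fun v => ?_, fun k => ?_⟩
  · have h1 : (A + τ • B) (u₀ + ∑ j, a j • veroneseVector e τ j) = -(φ j₀ + τ • ψ j₀) := by
      rw [map_add, hu₀, map_sum, Finset.sum_eq_zero fun j _ => by
        rw [map_smul, LinearMap.mem_ker.1 (hker τ j), smul_zero], add_zero]
    exact LinearMap.congr_fun h1 v
  · have h2 := hu k
    have h3 : (φ k + τ • ψ k) (u₀ + ∑ j, a j • veroneseVector e τ j) = 0 := by
      rw [map_add, h2]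
      by_cases hk : k = j₀
      · subst hk
        have h4 : (A + τ • B) u₀ u₀ = 0 := hD u₀
        rw [hu₀, LinearMap.neg_apply, neg_eq_zero] at h4
        rw [h4]
        simp [a]
      · have hne : ∏ i, (1 + τ * (b k i)⁻¹) ≠ 0 := by
          refine Finset.prod_ne_zero_iff.2 fun i _ => one_add_neg_mul_inv_ne_zero (hb k i) ?_
          intro h
          have := hinj (a₁ := ⟨j₀, i₀⟩) (a₂ := ⟨k, i⟩) h
          exact hk (congrArg Sigma.fst this).symm
        simp only [a, if_neg hk]
        rw [div_mul_cancel₀ _ hne]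
        simp
    exact h3

end Extension

/-! ### Orthogonal splitting of an alternating pencil. -/

section Splitting

variable {𝕜 U ι : Type*} [Field 𝕜] [AddCommGroup U] [Module 𝕜 U] [Fintype ι] {n : ι → ℕ}

/-- The linear map with values `v ↦ ∑ (v_{ji}.1 q_{ji} + v_{ji}.2 p_{ji})`. -/
noncomputable def planeMap (p q : (Σ j, Fin (n j)) → U) : (∀ j, Fin (n j) → 𝕜 × 𝕜) →ₗ[𝕜] U :=
  ∑ x : Σ j, Fin (n j), ((LinearMap.fst 𝕜 𝕜 𝕜 ∘ₗ LinearMap.proj x.2 ∘ₗ LinearMap.proj x.1).smulRight (q x)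
    + (LinearMap.snd 𝕜 𝕜 𝕜 ∘ₗ LinearMap.proj x.2 ∘ₗ LinearMap.proj x.1).smulRight (p x))

theorem planeMap_apply (p q : (Σ j, Fin (n j)) → U) (v : ∀ j, Fin (n j) → 𝕜 × 𝕜) :
    planeMap p q v = ∑ x : Σ j, Fin (n j), ((v x.1 x.2).1 • q x + (v x.1 x.2).2 • p x) := by
  simp [planeMap, LinearMap.sum_apply]

/-- `p`, `q` is a symplectic family for `A` on whose members `B` is proportional to `A`. -/
structure IsPlaneFamily (A B : LinearMap.BilinForm 𝕜 U) (b : ∀ j, Fin (n j) → 𝕜)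
    (p q : (Σ j, Fin (n j)) → U) : Prop where
  alt : A.IsAlt
  ne_zero : ∀ j i, b j i ≠ 0
  qp : ∀ x, A (q x) (p x) = 1
  pp : ∀ x y, A (p x) (p y) = 0
  qq : ∀ x y, A (q x) (q y) = 0
  qp_ne : ∀ x y, x ≠ y → A (q x) (p y) = 0
  mem_p : ∀ x w, A (p x) w - b x.1 x.2 * B (p x) w = 0
  mem_q : ∀ x w, A (q x) w - b x.1 x.2 * B (q x) w = 0

namespace IsPlaneFamily

variable {A B : LinearMap.BilinForm 𝕜 U} {b : ∀ j, Fin (n j) → 𝕜} {p q : (Σ j, Fin (n j)) → U}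
  (h : IsPlaneFamily A B b p q)
include h

theorem q_planeMap (x : Σ j, Fin (n j)) (v : ∀ j, Fin (n j) → 𝕜 × 𝕜) :
    A (q x) (planeMap p q v) = (v x.1 x.2).2 := by
  classical
  rw [planeMap_apply, map_sum, Finset.sum_eq_single x]
  · simp [h.qq, h.qp]
  · intro y _ hy
    simp [h.qq, h.qp_ne x y hy.symm]
  · simp

theorem p_planeMap (x : Σ j, Fin (n j)) (v : ∀ j, Fin (n j) → 𝕜 × 𝕜) :
    A (p x) (planeMap p q v) = -(v x.1 x.2).1 := by
  classical
  rw [planeMap_apply, map_sum, Finset.sum_eq_single x]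
  · simp [h.pp, ← h.alt.neg_eq (q x), h.qp]
  · intro y _ hy
    simp [h.pp, ← h.alt.neg_eq (q y), h.qp_ne y x hy]
  · simp

theorem planeMap_planeMap (v v' : ∀ j, Fin (n j) → 𝕜 × 𝕜) :
    A (planeMap p q v) (planeMap p q v') = ∑ j, weightedForm 1 (v j) (v' j) := by
  rw [planeMap_apply, map_sum, LinearMap.sum_apply, Fintype.sum_sigma]
  refine Finset.sum_congr rfl fun j _ => ?_
  rw [weightedForm_apply]
  refine Finset.sum_congr rfl fun i _ => ?_
  simp only [map_add, map_smul, LinearMap.add_apply, LinearMap.smul_apply, h.q_planeMap,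
    h.p_planeMap, smul_eq_mul, Pi.one_apply]
  ring

/-- A = bB on each plane, which is why the inverse weights appear. -/
theorem planeMap_planeMap' (v v' : ∀ j, Fin (n j) → 𝕜 × 𝕜) :
    B (planeMap p q v) (planeMap p q v') = ∑ j, weightedForm (b j)⁻¹ (v j) (v' j) := by
  rw [planeMap_apply, map_sum, LinearMap.sum_apply, Fintype.sum_sigma]
  refine Finset.sum_congr rfl fun j _ => ?_
  rw [weightedForm_apply]
  refine Finset.sum_congr rfl fun i _ => ?_
  have e1 := h.mem_p ⟨j, i⟩ (planeMap p q v')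
  have e2 := h.mem_q ⟨j, i⟩ (planeMap p q v')
  rw [h.p_planeMap] at e1
  rw [h.q_planeMap] at e2
  have hb := h.ne_zero j i
  simp only [map_add, map_smul, LinearMap.add_apply, LinearMap.smul_apply, smul_eq_mul,
    Pi.inv_apply]
  simp only at e1 e2
  field_simp
  linear_combination (-(v j i).1) * e2 - (v j i).2 * e1

theorem apply_planeMap_eq_zero {z : U} (hp : ∀ x, A (p x) z = 0) (hq : ∀ x, A (q x) z = 0)
    (v : ∀ j, Fin (n j) → 𝕜 × 𝕜) : A (planeMap p q v) z = 0 ∧ B (planeMap p q v) z = 0 := by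
  have hB : ∀ x, B (p x) z = 0 ∧ B (q x) z = 0 := by
    intro x
    have e1 := h.mem_p x z
    have e2 := h.mem_q x z
    rw [hp, zero_sub, neg_eq_zero] at e1
    rw [hq, zero_sub, neg_eq_zero] at e2
    exact ⟨(mul_eq_zero.1 e1).resolve_left (h.ne_zero _ _),
      (mul_eq_zero.1 e2).resolve_left (h.ne_zero _ _)⟩
  rw [planeMap_apply]
  constructor
  · simp [LinearMap.sum_apply, hp, hq]
  · simp [LinearMap.sum_apply, hB]

theorem linearIndependent_p : LinearIndependent 𝕜 p := by
  classical
  rw [Fintype.linearIndependent_iff]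
  intro g hg x
  have := congrArg (A (q x)) hg
  rw [map_sum, Finset.sum_eq_single x (fun y _ hy => by
    rw [map_smul, h.qp_ne x y hy.symm, smul_zero]) (by simp), map_smul, h.qp] at this
  simpa using this

end IsPlaneFamily

/-- A pencil of alternating forms is the orthogonal sum of models of Kronecker pairs, embedded by
`f`, and of a complement `Z` which meets the span of the vectors `e` trivially. -/
structure IsKroneckerSplitting (A B : LinearMap.BilinForm 𝕜 U) (S : Submodule 𝕜 U)
    (b : ∀ j, Fin (n j) → 𝕜) (Z : Submodule 𝕜 U) (f : (∀ j, zeroSum 𝕜 (n j)) →ₗ[𝕜] U) :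
    Prop where
  map_map : ∀ v v', A (f v) (f v') = ∑ j, weightedForm 1 (v j : Fin (n j) → 𝕜 × 𝕜) (v' j)
  map_map' : ∀ v v', B (f v) (f v') = ∑ j, weightedForm (b j)⁻¹ (v j : Fin (n j) → 𝕜 × 𝕜) (v' j)
  orthogonal : ∀ z ∈ Z, ∀ v, A (f v) z = 0 ∧ B (f v) z = 0
  exists_add : ∀ u, ∃ z ∈ Z, ∃ v, u = z + f v
  eq_zero : ∀ z ∈ Z, ∀ v, z + f v = 0 → z = 0 ∧ v = 0
  disjoint : Disjoint Z S
  apply_eq_zero : ∀ z ∈ Z, ∀ s ∈ S, A s z = 0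
  exists_add_of_orthogonal : ∀ u, (∀ s ∈ S, A s u = 0) → ∃ z ∈ Z, ∃ s ∈ S, u = z + s

/-- Adjoin one dimension per curve γⱼ, paired with U by φ and ψ so that γⱼ(t) pairs with the new
directions to ∏(1 + t/bⱼᵢ). It then lies in the extended kernel at t = -bⱼᵢ, together with the
completion of `exists_completion`. These planes are orthogonal to one another because their
parameters differ. The full kernels need to be known only at the chosen -bⱼᵢ. -/
theorem exists_isKroneckerSplitting [DecidableEq ι] [FiniteDimensional 𝕜 U]
    {A B : LinearMap.BilinForm 𝕜 U}
    (hA : A.IsAlt) (hB : B.IsAlt) (hn : ∀ j, 0 < n j) {e : (Σ j, Fin (n j)) → U}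
    (he : LinearIndependent 𝕜 e)
    {b : ∀ j, Fin (n j) → 𝕜} (hb : ∀ j i, b j i ≠ 0)
    (hinj : Function.Injective fun x : Σ j, Fin (n j) => b x.1 x.2)
    (hker : ∀ (t : 𝕜) j, veroneseVector e t j ∈ LinearMap.ker (A + t • B))
    (hker' : ∀ j i, LinearMap.ker (A + (-b j i : 𝕜) • B) ≤
      Submodule.span 𝕜 (Set.range (veroneseVector e (-b j i)))) :
    ∃ (Z : Submodule 𝕜 U) (f : (∀ j, zeroSum 𝕜 (n j)) →ₗ[𝕜] U),
      IsKroneckerSplitting A B (Submodule.span 𝕜 (Set.range e)) b Z f := by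
  obtain ⟨φ, ψ, hφψ⟩ := exists_dual_veroneseVector hn he fun j i => (b j i)⁻¹
  choose u hu hu' using fun x : Σ j, Fin (n j) =>
    exists_completion hA hB hb hinj hker (hker' x.1 x.2) hφψ
  choose c hc using fun j => exists_interpolation_weights (τ := fun i => -b j i)
    (fun i i' hii => by
      have := hinj (a₁ := ⟨j, i⟩) (a₂ := ⟨j, i'⟩) (neg_injective hii)
      simpa using this)
  set Φ : (ι → 𝕜) →ₗ[𝕜] Dual 𝕜 U := Fintype.linearCombination 𝕜 φ with hΦ
  set Ψ : (ι → 𝕜) →ₗ[𝕜] Dual 𝕜 U := Fintype.linearCombination 𝕜 ψ with hΨ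
  have hΦs : ∀ j, Φ (Pi.single j 1) = φ j := fun j => by
    rw [hΦ, Fintype.linearCombination_apply_single, one_smul]
  have hΨs : ∀ j, Ψ (Pi.single j 1) = ψ j := fun j => by
    rw [hΨ, Fintype.linearCombination_apply_single, one_smul]
  have hΦΨ : ∀ (t : 𝕜) (v : U) (w : ι → 𝕜), Φ w v + t * Ψ w v =
      ∑ k, w k * (φ k v + t * ψ k v) := by
    intro t v w
    simp only [hΦ, hΨ, Fintype.linearCombination_apply, LinearMap.sum_apply, LinearMap.smul_apply,
      smul_eq_mul, Finset.mul_sum, ← Finset.sum_add_distrib]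
    exact Finset.sum_congr rfl fun k _ => by ring
  set A' := extendForm A Φ with hA'
  set B' := extendForm B Ψ with hB'
  have hA'alt : A'.IsAlt := extendForm_isAlt hA Φ
  have hB'alt : B'.IsAlt := extendForm_isAlt hB Ψ
  set q : (Σ j, Fin (n j)) → U × (ι → 𝕜) := fun x => (u x, Pi.single x.1 1) with hq
  -- The interpolation weights make the sum of these multiples equal to γⱼ(0), which A kills; this
  -- fixes both the pairing of p with q and the zero-sum condition.
  set g : (Σ j, Fin (n j)) → U := fun x => c x.1 x.2 • veroneseVector e (-b x.1 x.2) x.1 with hg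
  set p : (Σ j, Fin (n j)) → U × (ι → 𝕜) := fun x => (g x, 0) with hp
  have hgS : ∀ t j, veroneseVector e t j ∈ Submodule.span 𝕜 (Set.range e) := fun t j =>
    Submodule.sum_mem _ fun i _ => Submodule.smul_mem _ _ (Submodule.subset_span ⟨_, rfl⟩)
  have hsum : ∀ j, ∑ i, g ⟨j, i⟩ = veroneseVector e (0 : 𝕜) j := by
    intro j
    have h1 : ∀ i, g ⟨j, i⟩ = ∑ k : Fin (n j), (c j i * (-b j i) ^ (k : ℕ)) • e ⟨j, k⟩ := by
      intro i
      change c j i • ∑ k : Fin (n j), (-b j i) ^ (k : ℕ) • e ⟨j, k⟩ = _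
      rw [Finset.smul_sum]
      exact Finset.sum_congr rfl fun k _ => smul_smul _ _ _
    rw [Finset.sum_congr rfl fun i _ => h1 i, Finset.sum_comm]
    refine Finset.sum_congr rfl fun k _ => ?_
    rw [← hc j k, Finset.sum_smul]
  have hγ0 : ∀ j v, A (veroneseVector e (0 : 𝕜) j) v = 0 := by
    intro j v
    have h1 := hker 0 j
    rw [zero_smul, add_zero] at h1
    rw [LinearMap.mem_ker.1 h1, LinearMap.zero_apply]
  have hqker : ∀ x w, A' (q x) w + -b x.1 x.2 * B' (q x) w = 0 := by
    rintro x ⟨v, w⟩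
    simp only [hA', hB', extendForm_apply, hq, hΦs, hΨs]
    have h1 := hu x v
    have h2 := hΦΨ (-b x.1 x.2) (u x) w
    rw [Finset.sum_eq_zero fun k _ => by rw [hu' x k, mul_zero]] at h2
    linear_combination h1 - h2
  have hpker : ∀ x w, A' (p x) w + -b x.1 x.2 * B' (p x) w = 0 := by
    rintro ⟨j, i⟩ ⟨v, w⟩
    simp only [hA', hB', extendForm_apply, hp, hg, map_zero, LinearMap.zero_apply, zero_sub]
    have h1 : A (veroneseVector e (-b j i) j) v + -b j i * B (veroneseVector e (-b j i) j) v = 0 :=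
      LinearMap.congr_fun (LinearMap.mem_ker.1 (hker (-b j i) j)) v
    have h2 := hΦΨ (-b j i) (veroneseVector e (-b j i) j) w
    rw [Finset.sum_eq_zero fun k _ => ?_] at h2
    · simp only [map_smul, LinearMap.smul_apply, smul_eq_mul]
      linear_combination c j i * h1 - c j i * h2
    · rw [hφψ k j]
      split_ifs with hjk
      · rw [Finset.prod_eq_zero (Finset.mem_univ i) (by
          rw [neg_mul, mul_inv_cancel₀ (hb j i), add_neg_cancel]), mul_zero]
      · rw [mul_zero]
  have hneg : ∀ x y : Σ j, Fin (n j), x ≠ y → -b x.1 x.2 ≠ -b y.1 y.2 := fun x y hxy h =>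
    hxy (hinj (neg_injective h))
  have mem : ∀ {t : 𝕜} {x : U × (ι → 𝕜)}, (∀ w, A' x w + t * B' x w = 0) →
      x ∈ LinearMap.ker (A' + t • B') := fun hx => LinearMap.ext hx
  have hpp : ∀ x y, A' (p x) (p y) = 0 := by
    intro x y
    by_cases hxy : x = y
    · rw [hxy]; exact hA'alt _
    · exact (apply_eq_zero_of_mem_ker hA'alt hB'alt (hneg x y hxy) (mem (hpker x))
        (mem (hpker y))).1
  have hqq : ∀ x y, A' (q x) (q y) = 0 := by
    intro x y
    by_cases hxy : x = y
    · rw [hxy]; exact hA'alt _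
    · exact (apply_eq_zero_of_mem_ker hA'alt hB'alt (hneg x y hxy) (mem (hqker x))
        (mem (hqker y))).1
  have hqpne : ∀ x y, x ≠ y → A' (q x) (p y) = 0 := fun x y hxy =>
    (apply_eq_zero_of_mem_ker hA'alt hB'alt (hneg x y hxy) (mem (hqker x)) (mem (hpker y))).1
  have hpsum : ∀ j, ∑ i, p ⟨j, i⟩ = (veroneseVector e (0 : 𝕜) j, 0) := by
    intro j
    rw [← hsum]
    ext <;> simp [hp, Prod.fst_sum, Prod.snd_sum]
  have hqp : ∀ x, A' (q x) (p x) = 1 := by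
    rintro ⟨j, i⟩
    -- Orthogonality lets the single partner p be replaced by the whole sum γⱼ(0), on which φ j
    -- takes the value of the product at t = 0, namely 1.
    have h1 : A' (q ⟨j, i⟩) (∑ i', p ⟨j, i'⟩) = A' (q ⟨j, i⟩) (p ⟨j, i⟩) := by
      rw [map_sum]
      refine Finset.sum_eq_single _ (fun i' _ hi' => hqpne _ _ fun h => hi' ?_) (by simp)
      simpa using h.symm
    rw [← h1, hpsum]
    simp only [hA', extendForm_apply, hq, hΦs, map_zero, LinearMap.zero_apply, sub_zero]
    rw [← hA.neg_eq, hγ0, neg_zero, zero_add]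
    have := hφψ j j 0
    rw [if_pos rfl] at this
    simpa using this
  have hfam : IsPlaneFamily A' B' b p q :=
    ⟨hA'alt, hb, hqp, hpp, hqq, hqpne, fun x w => by linear_combination hpker x w,
      fun x w => by linear_combination hqker x w⟩
  set incl : (∀ j, zeroSum 𝕜 (n j)) →ₗ[𝕜] ∀ j, Fin (n j) → 𝕜 × 𝕜 :=
    LinearMap.pi fun j => (zeroSum 𝕜 (n j)).subtype ∘ₗ LinearMap.proj j with hincl
  have hincl_apply : ∀ v j, incl v j = v j := fun v j => rfl
  set f : (∀ j, zeroSum 𝕜 (n j)) →ₗ[𝕜] U := LinearMap.fst 𝕜 U (ι → 𝕜) ∘ₗ planeMap p q ∘ₗ incl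
    with hf
  -- Only the q have a component in the added directions, so a combination returns to U exactly when
  -- its first coordinates sum to zero along each chain.
  have hsnd : ∀ v : ∀ j, Fin (n j) → 𝕜 × 𝕜, (planeMap p q v).2 = fun j => ∑ i, (v j i).1 := by
    intro v
    rw [planeMap_apply, Prod.snd_sum]
    ext j
    rw [Finset.sum_apply, Fintype.sum_sigma, Finset.sum_eq_single j]
    · simp [hp, hq]
    · intro k _ hk
      simp [hp, hq, hk]
    · simp
  have hf_apply : ∀ v, (f v, (0 : ι → 𝕜)) = planeMap p q (incl v) := by
    intro v
    refine Prod.ext rfl ?_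
    rw [hsnd]
    ext j
    exact (mem_zeroSum.1 (v j).2).symm
  have hAf : ∀ x y : U, A' (x, 0) (y, 0) = A x y := by
    intro x y; simp [hA', extendForm_apply]
  have hBf : ∀ x y : U, B' (x, 0) (y, 0) = B x y := by
    intro x y; simp [hB', extendForm_apply]
  set Z : Submodule 𝕜 U := ⨅ x, (LinearMap.ker (A' (p x) ∘ₗ LinearMap.inl 𝕜 U (ι → 𝕜)) ⊓
    LinearMap.ker (A' (q x) ∘ₗ LinearMap.inl 𝕜 U (ι → 𝕜))) with hZ
  have mem_Z : ∀ {z}, z ∈ Z ↔ ∀ x, A' (p x) (z, 0) = 0 ∧ A' (q x) (z, 0) = 0 := by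
    intro z
    simp only [hZ, Submodule.mem_iInf, Submodule.mem_inf, LinearMap.mem_ker, LinearMap.comp_apply,
      LinearMap.inl_apply]
  have exists_add : ∀ w : U, ∃ z ∈ Z, ∃ v, w = z + f v ∧
      ∀ x : Σ j, Fin (n j), ((v x.1 : Fin (n x.1) → 𝕜 × 𝕜) x.2).1 = -A (g x) w := by
    intro w
    -- The coordinates of the projection to the planes are the pairings with p and q. The first ones
    -- sum to zero because the p along a chain add up to γⱼ(0), in the kernel of A.
    set v : ∀ j, zeroSum 𝕜 (n j) := fun j => ⟨fun i => (-A' (p ⟨j, i⟩) (w, 0), A' (q ⟨j, i⟩) (w, 0)), by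
      rw [mem_zeroSum, Finset.sum_neg_distrib, neg_eq_zero, ← LinearMap.sum_apply, ← map_sum,
        hpsum, hAf, hγ0]⟩ with hv
    refine ⟨w - f v, ?_, v, by simp, fun x => ?_⟩
    · rw [mem_Z]
      intro x
      have h1 : ((w - f v, 0) : U × (ι → 𝕜)) = (w, 0) - planeMap p q (incl v) := by
        rw [← hf_apply]; ext <;> simp
      rw [h1, map_sub, map_sub, hfam.p_planeMap, hfam.q_planeMap]
      simp [hincl_apply, hv]
    · simp only [hv, hp, hAf]
  have orth : ∀ z ∈ Z, ∀ v, A (f v) z = 0 ∧ B (f v) z = 0 := by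
    intro z hz v
    rw [mem_Z] at hz
    rw [← hAf, ← hBf, hf_apply]
    exact hfam.apply_planeMap_eq_zero (fun x => (hz x).1) (fun x => (hz x).2) _
  -- The p are independent, being dual to the q, and there are as many of them as vectors e.
  have hgp : Submodule.span 𝕜 (Set.range g) = Submodule.span 𝕜 (Set.range e) := by
    apply Submodule.eq_of_le_of_finrank_eq
    · rw [Submodule.span_le]
      rintro _ ⟨x, rfl⟩
      exact Submodule.smul_mem _ _ (hgS _ _)
    · rw [finrank_span_eq_card he, finrank_span_eq_card]
      have := hfam.linearIndependent_p
      exact LinearIndependent.of_comp (LinearMap.inl 𝕜 U (ι → 𝕜)) this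
  have hgf : ∀ v : ∀ j, zeroSum 𝕜 (n j), (∀ j i, ((v j : Fin (n j) → 𝕜 × 𝕜) i).1 = 0) →
      f v ∈ Submodule.span 𝕜 (Set.range e) := by
    intro v hv
    have : f v = (planeMap p q (incl v)).1 := rfl
    rw [this, planeMap_apply, Prod.fst_sum, ← hgp]
    refine Submodule.sum_mem _ fun x _ => ?_
    simp only [hincl_apply, hv, zero_smul, zero_add]
    exact Submodule.smul_mem _ _ (Submodule.subset_span ⟨x, rfl⟩)
  refine ⟨Z, f, ?_, ?_, orth, fun w => ?_, ?_, ?_, ?_, ?_⟩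
  · intro v v'
    rw [← hAf, hf_apply, hf_apply, hfam.planeMap_planeMap]
    rfl
  · intro v v'
    rw [← hBf, hf_apply, hf_apply, hfam.planeMap_planeMap']
    rfl
  · obtain ⟨z, hz, v, h, -⟩ := exists_add w
    exact ⟨z, hz, v, h⟩
  · intro z hz v h
    rw [mem_Z] at hz
    have h1 : ((z, 0) : U × (ι → 𝕜)) + planeMap p q (incl v) = 0 := by
      rw [← hf_apply]
      refine Prod.ext ?_ ?_
      · exact h
      · simp
    have hv : v = 0 := by
      funext j
      apply Subtype.ext
      funext i
      have e1 := congrArg (A' (p ⟨j, i⟩)) h1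
      have e2 := congrArg (A' (q ⟨j, i⟩)) h1
      rw [map_add, map_zero, hfam.p_planeMap, (hz _).1, zero_add, neg_eq_zero] at e1
      rw [map_add, map_zero, hfam.q_planeMap, (hz _).2, zero_add] at e2
      exact Prod.ext e1 e2
    subst hv
    exact ⟨by simpa using h, rfl⟩
  · rw [disjoint_iff, eq_bot_iff]
    rintro z ⟨hz, hzS⟩
    rw [SetLike.mem_coe, mem_Z] at hz
    rw [SetLike.mem_coe, ← hgp, Submodule.mem_span_range_iff_exists_fun] at hzS
    obtain ⟨a, rfl⟩ := hzS
    have ha : ∀ x, a x = 0 := by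
      intro x
      have := (hz x).2
      have h2 : ((∑ y, a y • g y, 0) : U × (ι → 𝕜)) = ∑ y, a y • p y := by
        refine Prod.ext ?_ ?_
        · simp [hp, Prod.fst_sum]
        · simp [hp, Prod.snd_sum]
      rw [h2, map_sum, Finset.sum_eq_single x (fun y _ hy => by
        rw [map_smul, hqpne x y hy.symm, smul_zero]) (by simp), map_smul, hqp] at this
      simpa using this
    simp [ha]
  · intro z hz s hs
    rw [mem_Z] at hz
    have : Submodule.span 𝕜 (Set.range e) ≤ LinearMap.ker (A.flip z) := by
      rw [← hgp, Submodule.span_le]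
      rintro _ ⟨x, rfl⟩
      have := (hz x).1
      rw [hp, hAf] at this
      exact this
    exact this hs
  · intro w hw
    -- Orthogonality to the span of the e annihilates the first coordinates, so the projection
    -- involves only the p and lies in that span.
    obtain ⟨z, hz, v, h, hv⟩ := exists_add w
    refine ⟨z, hz, f v, hgf v fun j i => ?_, h⟩
    rw [hv ⟨j, i⟩, hw, neg_zero]
    rw [← hgp]
    exact Submodule.subset_span ⟨_, rfl⟩

end Splitting

/-! ### Kronecker elementary pairs on the zero-sum hyperplane. -/

section KroneckerModel

variable {𝕜 : Type*} [Field 𝕜] {n : ℕ}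

theorem map_toDual_zeroSum :
    (zeroSum 𝕜 n).map (((weightedForm 1 : LinearMap.BilinForm 𝕜 (Fin n → 𝕜 × 𝕜)).toDual
      (weightedForm_nondegenerate fun _ => one_ne_zero)).toLinearMap) =
      (kroneckerLine 𝕜 n).dualAnnihilator := by
  have key : ∀ v : Fin n → 𝕜 × 𝕜, (weightedForm 1 : LinearMap.BilinForm 𝕜 (Fin n → 𝕜 × 𝕜)) v ∈
      (kroneckerLine 𝕜 n).dualAnnihilator ↔ v ∈ zeroSum 𝕜 n := by
    intro v
    rw [Submodule.mem_dualAnnihilator, kroneckerLine, mem_zeroSum]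
    have h1 : (weightedForm 1 : LinearMap.BilinForm 𝕜 (Fin n → 𝕜 × 𝕜)) v (fun _ => (0, -1)) =
        -∑ i, (v i).1 := by
      rw [weightedForm_apply, ← Finset.sum_neg_distrib]
      exact Finset.sum_congr rfl fun i _ => by simp
    constructor
    · intro h
      have := h _ (Submodule.mem_span_singleton_self _)
      rwa [h1, neg_eq_zero] at this
    · intro h w hw
      obtain ⟨c, rfl⟩ := Submodule.mem_span_singleton.1 hw
      rw [map_smul, h1, h, neg_zero, smul_zero]
  ext φ
  constructor
  · rintro ⟨v, hv, rfl⟩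
    exact (key v).2 hv
  · intro hφ
    obtain ⟨v, rfl⟩ := ((weightedForm 1 : LinearMap.BilinForm 𝕜 (Fin n → 𝕜 × 𝕜)).toDual
      (weightedForm_nondegenerate fun _ => one_ne_zero)).surjective φ
    exact ⟨v, (key v).1 hφ, rfl⟩

variable (𝕜 n) in
/-- The dual of the space of the Kronecker elementary pair. -/
noncomputable def zeroSumEquivDual : zeroSum 𝕜 n ≃ₗ[𝕜] Dual 𝕜 (KroneckerSpace 𝕜 n) :=
  (LinearEquiv.ofSubmodules _ _ _ map_toDual_zeroSum).trans
    (kroneckerLine 𝕜 n).dualQuotEquivDualAnnihilator.symm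

theorem dualMap_zeroSumEquivDual (v : zeroSum 𝕜 n) :
    (kroneckerLine 𝕜 n).mkQ.dualMap (zeroSumEquivDual 𝕜 n v) =
      weightedForm 1 (v : Fin n → 𝕜 × 𝕜) := rfl

theorem kronecker_zeroSumEquivDual {b : Fin n → 𝕜} (hb : ∀ j, b j ≠ 0) (v v' : zeroSum 𝕜 n) :
    kronecker b hb (zeroSumEquivDual 𝕜 n v) (zeroSumEquivDual 𝕜 n v') =
      weightedForm 1 (v : Fin n → 𝕜 × 𝕜) v' := by
  have key : ∀ v : zeroSum 𝕜 n,
      ((weightedPair b hb).ω.toDual (weightedPair b hb).nondeg).symm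
        ((kroneckerLine 𝕜 n).mkQ.dualMap (zeroSumEquivDual 𝕜 n v)) = v := by
    intro v
    rw [LinearEquiv.symm_apply_eq]
    rfl
  rw [kronecker, pushforward, LinearMap.compl₁₂_apply, SymplecticPair.dual, dualBivector,
    LinearMap.compl₁₂_apply, LinearEquiv.coe_coe, key, key]
  rfl

/-- The dual is identified through Ω, so passing to Ω₁ divides coordinates by b, and b · b⁻¹ · b⁻¹ =
b⁻¹. -/
theorem kronecker₁_zeroSumEquivDual {b : Fin n → 𝕜} (hb : ∀ j, b j ≠ 0) (v v' : zeroSum 𝕜 n) :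
    kronecker₁ b hb (zeroSumEquivDual 𝕜 n v) (zeroSumEquivDual 𝕜 n v') =
      weightedForm b⁻¹ (v : Fin n → 𝕜 × 𝕜) v' := by
  have key : ∀ v : zeroSum 𝕜 n,
      ((weightedPair b hb).ω₁.toDual (weightedPair b hb).nondeg₁).symm
        ((kroneckerLine 𝕜 n).mkQ.dualMap (zeroSumEquivDual 𝕜 n v)) =
          fun j => (b j)⁻¹ • (v : Fin n → 𝕜 × 𝕜) j := by
    intro v
    rw [LinearEquiv.symm_apply_eq, dualMap_zeroSumEquivDual]
    refine LinearMap.ext fun x => ?_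
    change _ = weightedForm b _ x
    rw [weightedForm_apply, weightedForm_apply]
    refine Finset.sum_congr rfl fun j _ => ?_
    have := hb j
    simp only [Prod.smul_fst, Prod.smul_snd, smul_eq_mul, Pi.one_apply]
    field_simp
  rw [kronecker₁, pushforward, LinearMap.compl₁₂_apply, SymplecticPair.dual₁, dualBivector,
    LinearMap.compl₁₂_apply, LinearEquiv.coe_coe, key, key]
  change weightedForm b _ _ = _
  rw [weightedForm_apply, weightedForm_apply]
  refine Finset.sum_congr rfl fun j _ => ?_
  have := hb j
  simp only [Prod.smul_fst, Prod.smul_snd, smul_eq_mul, Pi.inv_apply]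
  field_simp

/-- The restriction of a weighted form to `zeroSum`. -/
noncomputable def zeroSumForm (b : Fin n → 𝕜) : LinearMap.BilinForm 𝕜 (zeroSum 𝕜 n) :=
  (weightedForm b).compl₁₂ (zeroSum 𝕜 n).subtype (zeroSum 𝕜 n).subtype

theorem zeroSumForm_apply (b : Fin n → 𝕜) (v w : zeroSum 𝕜 n) :
    zeroSumForm b v w = weightedForm b (v : Fin n → 𝕜 × 𝕜) w := rfl

theorem pencil_zeroSumForm (b : Fin n → 𝕜) (t : 𝕜) (v w : zeroSum 𝕜 n) :
    (zeroSumForm 1 + t • zeroSumForm b⁻¹ : LinearMap.BilinForm 𝕜 (zeroSum 𝕜 n)) v w =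
      ∑ i, (1 + t * (b i)⁻¹) * (((v : Fin n → 𝕜 × 𝕜) i).1 * ((w : Fin n → 𝕜 × 𝕜) i).2 -
        ((v : Fin n → 𝕜 × 𝕜) i).2 * ((w : Fin n → 𝕜 × 𝕜) i).1) := by
  rw [LinearMap.add_apply, LinearMap.smul_apply, LinearMap.add_apply, LinearMap.smul_apply,
    zeroSumForm_apply, zeroSumForm_apply, weightedForm_apply, weightedForm_apply, smul_eq_mul,
    Finset.mul_sum, ← Finset.sum_add_distrib]
  exact Finset.sum_congr rfl fun i _ => by simp only [Pi.one_apply, Pi.inv_apply]; ring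

/-- The polynomial `∏_{l ≠ i} (1 + X / b_l)`. -/
noncomputable def complementaryProd (b : Fin n → 𝕜) (i : Fin n) : 𝕜[X] :=
  ∏ l ∈ Finset.univ.erase i, (1 + X * C (b l)⁻¹)

theorem eval_complementaryProd (b : Fin n → 𝕜) (i : Fin n) (t : 𝕜) :
    (complementaryProd b i).eval t = ∏ l ∈ Finset.univ.erase i, (1 + t * (b l)⁻¹) := by
  rw [complementaryProd, eval_prod]
  exact Finset.prod_congr rfl fun l _ => by rw [eval_add, eval_one, eval_mul, eval_X, eval_C]

theorem sum_pow_mul_coeff_complementaryProd (b : Fin n → 𝕜) (i : Fin n) (t : 𝕜) :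
    ∑ k : Fin n, t ^ (k : ℕ) * (complementaryProd b i).coeff k =
      (complementaryProd b i).eval t := by
  have hdeg : (complementaryProd b i).natDegree < n := by
    have h1 : (complementaryProd b i).natDegree ≤ (Finset.univ.erase i).card := by
      refine (natDegree_prod_le _ _).trans ?_
      refine (Finset.sum_le_card_nsmul _ _ 1 fun i _ => ?_).trans (by simp)
      compute_degree
    rw [Finset.card_erase_of_mem (Finset.mem_univ i), Finset.card_univ, Fintype.card_fin] at h1
    have := i.pos
    omega
  rw [eval_eq_sum_range' hdeg,
    ← Fin.sum_univ_eq_sum_range (fun k => (complementaryProd b i).coeff k * t ^ k)]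
  exact Finset.sum_congr rfl fun k _ => mul_comm _ _

/-- The coefficients of the curve of kernels in the model of a Kronecker pair. -/
noncomputable def zeroSumCoeff (b : Fin n → 𝕜) (k : ℕ) : zeroSum 𝕜 n :=
  ⟨fun i => (0, (complementaryProd b i).coeff k), by simp [mem_zeroSum]⟩

theorem sum_pow_smul_zeroSumCoeff (b : Fin n → 𝕜) (t : 𝕜) :
    ((∑ k : Fin n, t ^ (k : ℕ) • zeroSumCoeff b k : zeroSum 𝕜 n) : Fin n → 𝕜 × 𝕜) =
      fun i => (0, (complementaryProd b i).eval t) := by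
  funext i
  rw [Submodule.coe_sum, Finset.sum_apply]
  refine Prod.ext ?_ ?_
  · rw [Prod.fst_sum]
    exact Finset.sum_eq_zero fun k _ => by simp [zeroSumCoeff]
  · rw [Prod.snd_sum, ← sum_pow_mul_coeff_complementaryProd]
    exact Finset.sum_congr rfl fun k _ => by simp [zeroSumCoeff]

/-- At t = -b i the curve is a non-zero multiple of the i-th second-coordinate vector, since all
other complementary products vanish. So n coefficients span n independent vectors. -/
theorem linearIndependent_zeroSumCoeff {b : Fin n → 𝕜} (hb : ∀ i, b i ≠ 0)
    (hinj : Function.Injective b) :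
    LinearIndependent 𝕜 fun k : Fin n => zeroSumCoeff b k := by
  set s : Fin n → zeroSum 𝕜 n := fun i => ⟨Pi.single i (0, 1), by
    rw [mem_zeroSum]
    refine Finset.sum_eq_zero fun j _ => ?_
    by_cases hj : j = i
    · subst hj; simp
    · simp [hj]⟩ with hs
  have hsli : LinearIndependent 𝕜 s := by
    rw [Fintype.linearIndependent_iff]
    intro g hg i
    have h1 := congrArg (fun v : zeroSum 𝕜 n => ((v : Fin n → 𝕜 × 𝕜) i).2) hg
    simp only [Submodule.coe_sum, Finset.sum_apply, Prod.snd_sum] at h1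
    rw [Finset.sum_eq_single i (fun j _ hj => by simp [hs, hj.symm]) (by simp)] at h1
    simpa [hs] using h1
  rw [linearIndependent_iff_card_le_finrank_span]
  refine (linearIndependent_iff_card_le_finrank_span.1 hsli).trans (Submodule.finrank_mono ?_)
  rw [Submodule.span_le]
  rintro _ ⟨i, rfl⟩
  have hne : (complementaryProd b i).eval (-b i) ≠ 0 := by
    rw [eval_complementaryProd]
    refine Finset.prod_ne_zero_iff.2 fun l hl => one_add_neg_mul_inv_ne_zero (hb l) fun h => ?_
    exact (Finset.mem_erase.1 hl).1 (hinj h).symm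
  have h1 : s i = ((complementaryProd b i).eval (-b i))⁻¹ •
      ∑ k : Fin n, (-b i) ^ (k : ℕ) • zeroSumCoeff b k := by
    apply Subtype.ext
    rw [Submodule.coe_smul, sum_pow_smul_zeroSumCoeff]
    funext j
    by_cases hj : j = i
    · subst hj
      simp [hs, inv_mul_cancel₀ hne]
    · have h0 : (complementaryProd b j).eval (-b i) = 0 := by
        rw [eval_complementaryProd]
        refine Finset.prod_eq_zero (Finset.mem_erase.2 ⟨Ne.symm hj, Finset.mem_univ i⟩) ?_
        rw [neg_mul, mul_inv_cancel₀ (hb i), add_neg_cancel]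
      simp only [hs, Pi.single_eq_of_ne hj, Pi.smul_apply, h0, Prod.smul_mk, smul_zero]
      rfl
  rw [SetLike.mem_coe, h1]
  exact Submodule.smul_mem _ _ (Submodule.sum_mem _ fun k _ => Submodule.smul_mem _ _
    (Submodule.subset_span ⟨k, rfl⟩))

/-- Multiplying the i-th complementary product by its missing factor gives the full product,
independent of i, and what remains is a zero sum. -/
theorem sum_pow_smul_zeroSumCoeff_mem_ker (b : Fin n → 𝕜) (t : 𝕜) :
    ∑ k : Fin n, t ^ (k : ℕ) • zeroSumCoeff b k ∈
      LinearMap.ker (zeroSumForm 1 + t • zeroSumForm b⁻¹) := by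
  rw [LinearMap.mem_ker]
  refine LinearMap.ext fun w => ?_
  rw [pencil_zeroSumForm, sum_pow_smul_zeroSumCoeff, LinearMap.zero_apply]
  have h1 : ∀ i, (1 + t * (b i)⁻¹) * (0 * ((w : Fin n → 𝕜 × 𝕜) i).2 -
      (complementaryProd b i).eval t * ((w : Fin n → 𝕜 × 𝕜) i).1) =
      -(∏ l, (1 + t * (b l)⁻¹)) * ((w : Fin n → 𝕜 × 𝕜) i).1 := by
    intro i
    rw [← Finset.mul_prod_erase Finset.univ _ (Finset.mem_univ i), ← eval_complementaryProd]
    ring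
  rw [Finset.sum_congr rfl fun i _ => h1 i, ← Finset.mul_sum, mem_zeroSum.1 w.2, mul_zero]

/-- Testing on second coordinates kills (1 + t/bᵢ) times the first coordinates of a kernel vector;
testing on differences of first coordinates makes (1 + t/bᵢ) times the second ones independent of i.
The kernel is thus a line for every t, so any weights are admissible in a splitting of the model. -/
theorem ker_le_span_sum_pow_smul_zeroSumCoeff {b : Fin n → 𝕜} (hb : ∀ i, b i ≠ 0)
    (hinj : Function.Injective b) (t : 𝕜) :
    LinearMap.ker (zeroSumForm 1 + t • zeroSumForm b⁻¹) ≤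
      𝕜 ∙ (∑ k : Fin n, t ^ (k : ℕ) • zeroSumCoeff b k) := by
  intro v hv
  have hv' : ∀ w, _ := fun w => (pencil_zeroSumForm b t v w).symm.trans (LinearMap.congr_fun hv w)
  rw [Submodule.mem_span_singleton]
  have h1 : ∀ i, (1 + t * (b i)⁻¹) * ((v : Fin n → 𝕜 × 𝕜) i).1 = 0 := by
    intro i
    have := hv' ⟨Pi.single i (0, 1), by
      rw [mem_zeroSum]
      refine Finset.sum_eq_zero fun j _ => ?_
      by_cases hj : j = i
      · subst hj; simp
      · simp [hj]⟩
    rw [Finset.sum_eq_single i (fun j _ hj => by simp [hj]) (by simp)] at this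
    simpa using this
  have h2 : ∀ i j, (1 + t * (b i)⁻¹) * ((v : Fin n → 𝕜 × 𝕜) i).2 =
      (1 + t * (b j)⁻¹) * ((v : Fin n → 𝕜 × 𝕜) j).2 := by
    intro i j
    have := hv' ⟨Pi.single i (1, 0) - Pi.single j (1, 0), by
      rw [mem_zeroSum]
      simp only [Pi.sub_apply, Prod.fst_sub, Finset.sum_sub_distrib]
      have : ∀ l : Fin n, ∑ i, ((Pi.single l (1, 0) : Fin n → 𝕜 × 𝕜) i).1 = 1 := by
        intro l
        rw [Finset.sum_eq_single l (fun k _ hk => by simp [hk]) (by simp)]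
        simp
      rw [this, this, sub_self]⟩
    simp only [Pi.sub_apply, Prod.fst_sub, Prod.snd_sub, mul_sub, Finset.sum_sub_distrib] at this
    have e1 : ∀ l : Fin n, ∑ x, (1 + t * (b x)⁻¹) * (((v : Fin n → 𝕜 × 𝕜) x).1 *
        ((Pi.single l (1, 0) : Fin n → 𝕜 × 𝕜) x).2) = 0 := by
      intro l
      refine Finset.sum_eq_zero fun k _ => ?_
      by_cases hk : k = l
      · subst hk; simp
      · simp [hk]
    have e2 : ∀ l : Fin n, ∑ x, (1 + t * (b x)⁻¹) * (((v : Fin n → 𝕜 × 𝕜) x).2 *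
        ((Pi.single l (1, 0) : Fin n → 𝕜 × 𝕜) x).1) =
        (1 + t * (b l)⁻¹) * ((v : Fin n → 𝕜 × 𝕜) l).2 := by
      intro l
      rw [Finset.sum_eq_single l (fun k _ hk => by simp [hk]) (by simp)]
      simp
    rw [e1, e1, e2, e2, LinearMap.zero_apply] at this
    linear_combination -this
  by_cases hall : ∀ i, 1 + t * (b i)⁻¹ ≠ 0
  · rcases isEmpty_or_nonempty (Fin n) with hn | ⟨⟨i₀⟩⟩
    · exact ⟨0, Subtype.ext (Subsingleton.elim _ _)⟩
    have hP : ∏ l, (1 + t * (b l)⁻¹) ≠ 0 := Finset.prod_ne_zero_iff.2 fun i _ => hall i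
    refine ⟨(1 + t * (b i₀)⁻¹) * ((v : Fin n → 𝕜 × 𝕜) i₀).2 / ∏ l, (1 + t * (b l)⁻¹), ?_⟩
    apply Subtype.ext
    rw [Submodule.coe_smul, sum_pow_smul_zeroSumCoeff]
    funext i
    refine Prod.ext ?_ ?_
    · simpa using ((mul_eq_zero.1 (h1 i)).resolve_left (hall i)).symm
    · rw [Pi.smul_apply, Prod.smul_snd, smul_eq_mul, ← h2 i i₀, div_mul_eq_mul_div, div_eq_iff hP,
        ← Finset.mul_prod_erase Finset.univ _ (Finset.mem_univ i), ← eval_complementaryProd]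
      ring
  -- As the weights are distinct only one factor, the l-th, vanishes. All other coordinates then
  -- vanish, and the zero-sum condition kills the first coordinate at l.
  · push Not at hall
    obtain ⟨l, hl⟩ := hall
    have hne : ∀ i, i ≠ l → 1 + t * (b i)⁻¹ ≠ 0 := by
      intro i hil h0
      apply hil
      apply hinj
      have h3 := hb i
      have h4 := hb l
      field_simp at h0 hl
      linear_combination h0 - hl
    have hne' : (complementaryProd b l).eval t ≠ 0 := by
      rw [eval_complementaryProd]
      exact Finset.prod_ne_zero_iff.2 fun i hi => hne i (Finset.mem_erase.1 hi).1
    have hfst : ∀ i, i ≠ l → ((v : Fin n → 𝕜 × 𝕜) i).1 = 0 := fun i hi =>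
      (mul_eq_zero.1 (h1 i)).resolve_left (hne i hi)
    refine ⟨((v : Fin n → 𝕜 × 𝕜) l).2 / (complementaryProd b l).eval t, ?_⟩
    apply Subtype.ext
    rw [Submodule.coe_smul, sum_pow_smul_zeroSumCoeff]
    funext i
    by_cases hil : i = l
    · subst hil
      refine Prod.ext ?_ ?_
      · have := mem_zeroSum.1 v.2
        rw [Finset.sum_eq_single i (fun j _ hj => hfst j hj) (by simp)] at this
        simp [this]
      · rw [Pi.smul_apply, Prod.smul_snd, smul_eq_mul, div_mul_cancel₀ _ hne']
    · have h0 : (complementaryProd b i).eval t = 0 := by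
        rw [eval_complementaryProd]
        exact Finset.prod_eq_zero (Finset.mem_erase.2 ⟨Ne.symm hil, Finset.mem_univ l⟩) hl
      refine Prod.ext ?_ ?_
      · simp [hfst i hil]
      · have h5 := h2 i l
        rw [hl, zero_mul] at h5
        have := (mul_eq_zero.1 h5).resolve_left (hne i hil)
        simp [h0, this]

/-- Kronecker models of the same size are isomorphic, whatever the weights. -/
theorem exists_equiv_zeroSum (hn : 0 < n) {b b' : Fin n → 𝕜} (hb : ∀ i, b i ≠ 0)
    (hinj : Function.Injective b) (hb' : ∀ i, b' i ≠ 0) (hinj' : Function.Injective b') :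
    ∃ θ : zeroSum 𝕜 n ≃ₗ[𝕜] zeroSum 𝕜 n, ∀ v w, zeroSumForm 1 (θ v) (θ w) = zeroSumForm 1 v w ∧
      zeroSumForm b⁻¹ (θ v) (θ w) = zeroSumForm b'⁻¹ v w := by
  have halt : ∀ c : Fin n → 𝕜, (zeroSumForm c).IsAlt := fun c v => weightedForm_isAlt c _
  have hvero : ∀ (t : 𝕜) (j : Unit), veroneseVector (n := fun _ : Unit => n)
      (fun x => zeroSumCoeff b x.2) t j = ∑ k : Fin n, t ^ (k : ℕ) • zeroSumCoeff b k :=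
    fun t j => rfl
  -- The model with weights b is split using the weights b'. The resulting embedding goes between
  -- spaces of equal dimension, so it is an isomorphism.
  obtain ⟨Z, f, hf⟩ := exists_isKroneckerSplitting (ι := Unit) (n := fun _ => n) (halt 1)
    (halt b⁻¹) (fun _ => hn) (e := fun x => zeroSumCoeff b x.2)
    ((linearIndependent_zeroSumCoeff hb hinj).comp (fun x : Σ _ : Unit, Fin n => x.2)
      (by rintro ⟨⟨⟩, i⟩ ⟨⟨⟩, j⟩ h; simpa using h))
    (b := fun _ => b') (fun _ => hb') (by rintro ⟨⟨⟩, i⟩ ⟨⟨⟩, j⟩ h; simpa using hinj' h)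
    (fun t j => by rw [hvero]; exact sum_pow_smul_zeroSumCoeff_mem_ker b t)
    (fun j i => (ker_le_span_sum_pow_smul_zeroSumCoeff hb hinj _).trans (by
      rw [Submodule.span_singleton_le_iff_mem]
      exact Submodule.subset_span ⟨j, hvero _ _⟩))
  set g : zeroSum 𝕜 n →ₗ[𝕜] zeroSum 𝕜 n :=
    f ∘ₗ (LinearEquiv.funUnique Unit 𝕜 (zeroSum 𝕜 n)).symm.toLinearMap with hg
  have hginj : Function.Injective g := by
    rw [← LinearMap.ker_eq_bot, LinearMap.ker_eq_bot']
    intro v hv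
    have := (hf.eq_zero 0 Z.zero_mem _ (by rw [zero_add]; exact hv)).2
    simpa using this
  refine ⟨LinearEquiv.ofInjectiveEndo g hginj, fun v w => ⟨?_, ?_⟩⟩
  · rw [LinearEquiv.coe_ofInjectiveEndo, hg, LinearMap.comp_apply, LinearMap.comp_apply,
      hf.map_map]
    simp [zeroSumForm_apply]
  · rw [LinearEquiv.coe_ofInjectiveEndo, hg, LinearMap.comp_apply, LinearMap.comp_apply,
      hf.map_map']
    simp [zeroSumForm_apply]

end KroneckerModel

/-! ### Isomorphisms of pairs obtained from isometries of dual spaces. -/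

section Isomorphisms

variable {𝕜 E F : Type*} [Field 𝕜] [AddCommGroup E] [Module 𝕜 E] [AddCommGroup F] [Module 𝕜 F]

/-- Isometries of the dual spaces yield isomorphisms of pairs of bivectors. -/
theorem isomorphic_of_dual [FiniteDimensional 𝕜 E] [FiniteDimensional 𝕜 F]
    {Λ Λ₁ : LinearMap.BilinForm 𝕜 (Dual 𝕜 E)} {Θ Θ₁ : LinearMap.BilinForm 𝕜 (Dual 𝕜 F)}
    (ψ : Dual 𝕜 F ≃ₗ[𝕜] Dual 𝕜 E) (h : ∀ α β, Λ (ψ α) (ψ β) = Θ α β)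
    (h₁ : ∀ α β, Λ₁ (ψ α) (ψ β) = Θ₁ α β) : Isomorphic Λ Λ₁ Θ Θ₁ := by
  set φ : E ≃ₗ[𝕜] F := (evalEquiv 𝕜 E).trans (ψ.dualMap.trans (evalEquiv 𝕜 F).symm) with hφ
  have key : ∀ α : Dual 𝕜 F, φ.toLinearMap.dualMap α = ψ α := by
    intro α
    ext x
    change α ((evalEquiv 𝕜 F).symm (ψ.dualMap (evalEquiv 𝕜 E x))) = ψ α x
    rw [apply_evalEquiv_symm_apply]
    rfl
  refine ⟨φ, ?_, ?_⟩
  · ext α β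
    rw [pushforward, LinearMap.compl₁₂_apply, key, key, h]
  · ext α β
    rw [pushforward, LinearMap.compl₁₂_apply, key, key, h₁]

/-- The dual of `E × ∏ₗ Gₗ`. -/
noncomputable def dualProdPiEquiv {ι : Type*} [Fintype ι] [DecidableEq ι] (𝕜 E : Type*) [Field 𝕜]
    [AddCommGroup E] [Module 𝕜 E] (G : ι → Type*)
    [∀ i, AddCommGroup (G i)] [∀ i, Module 𝕜 (G i)] :
    Dual 𝕜 (E × ∀ i, G i) ≃ₗ[𝕜] Dual 𝕜 E × ∀ i, Dual 𝕜 (G i) :=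
  (LinearMap.coprodEquiv 𝕜).symm.trans
    ((LinearEquiv.refl 𝕜 _).prodCongr (LinearMap.lsum 𝕜 G 𝕜).symm)

theorem prodBivector_piBivector_apply {ι : Type*} [Fintype ι] [DecidableEq ι] {G : ι → Type*}
    [∀ i, AddCommGroup (G i)] [∀ i, Module 𝕜 (G i)] (Θ : LinearMap.BilinForm 𝕜 (Dual 𝕜 E))
    (K : ∀ i, LinearMap.BilinForm 𝕜 (Dual 𝕜 (G i))) (α β : Dual 𝕜 (E × ∀ i, G i)) :
    prodBivector Θ (piBivector K) α β =
      Θ (dualProdPiEquiv 𝕜 E G α).1 (dualProdPiEquiv 𝕜 E G β).1 +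
        ∑ i, K i ((dualProdPiEquiv 𝕜 E G α).2 i) ((dualProdPiEquiv 𝕜 E G β).2 i) := by
  rw [prodBivector, piBivector, LinearMap.add_apply, LinearMap.add_apply]
  congr 1
  simp only [pushforward, LinearMap.compl₁₂_apply, LinearMap.sum_apply]
  rfl

/-- A pair of bivectors whose dual is isometric to a product of a dual space and Kronecker models. -/
theorem isomorphic_of_model {𝕜 W E ι Z : Type*} [Field 𝕜] [AddCommGroup W] [Module 𝕜 W]
    [FiniteDimensional 𝕜 W] [AddCommGroup E] [Module 𝕜 E] [FiniteDimensional 𝕜 E] [Fintype ι]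
    [DecidableEq ι] [AddCommGroup Z] [Module 𝕜 Z] {Λ Λ₁ : LinearMap.BilinForm 𝕜 (Dual 𝕜 W)}
    {Θ Θ₁ : LinearMap.BilinForm 𝕜 (Dual 𝕜 E)} {n : ι → ℕ} (ζ : Z ≃ₗ[𝕜] Dual 𝕜 E)
    (m : (Z × ∀ j, zeroSum 𝕜 (n j)) ≃ₗ[𝕜] Dual 𝕜 W) (b : ∀ l, Fin (n l) → 𝕜)
    (hb : ∀ l i, b l i ≠ 0)
    (hm : ∀ x y, Λ (m x) (m y) = Θ (ζ x.1) (ζ y.1) + ∑ j, zeroSumForm 1 (x.2 j) (y.2 j))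
    (hm₁ : ∀ x y, Λ₁ (m x) (m y) =
      Θ₁ (ζ x.1) (ζ y.1) + ∑ j, zeroSumForm (b j)⁻¹ (x.2 j) (y.2 j)) :
    Isomorphic Λ Λ₁ (prodBivector Θ (piBivector fun l => kronecker (b l) (hb l)))
      (prodBivector Θ₁ (piBivector fun l => kronecker₁ (b l) (hb l))) := by
  let ψ₁ : Dual 𝕜 (E × ∀ l, KroneckerSpace 𝕜 (n l)) ≃ₗ[𝕜] (Z × ∀ j, zeroSum 𝕜 (n j)) :=
    (dualProdPiEquiv 𝕜 E fun l => KroneckerSpace 𝕜 (n l)).trans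
      (ζ.symm.prodCongr (LinearEquiv.piCongrRight fun l => (zeroSumEquivDual 𝕜 (n l)).symm))
  have h1 : ∀ α, ζ (ψ₁ α).1 = (dualProdPiEquiv 𝕜 E (fun l => KroneckerSpace 𝕜 (n l)) α).1 :=
    fun α => ζ.apply_symm_apply _
  have h2 : ∀ α l, zeroSumEquivDual 𝕜 (n l) ((ψ₁ α).2 l) =
      (dualProdPiEquiv 𝕜 E (fun l => KroneckerSpace 𝕜 (n l)) α).2 l :=
    fun α l => (zeroSumEquivDual 𝕜 (n l)).apply_symm_apply _
  refine isomorphic_of_dual (ψ₁.trans m) (fun α β => ?_) (fun α β => ?_)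
  · change Λ (m (ψ₁ α)) (m (ψ₁ β)) = _
    rw [prodBivector_piBivector_apply, hm, h1, h1]
    refine congrArg _ (Finset.sum_congr rfl fun l _ => ?_)
    rw [← h2, ← h2, kronecker_zeroSumEquivDual, zeroSumForm_apply]
  · change Λ₁ (m (ψ₁ α)) (m (ψ₁ β)) = _
    rw [prodBivector_piBivector_apply, hm₁, h1, h1]
    refine congrArg _ (Finset.sum_congr rfl fun l _ => ?_)
    rw [← h2, ← h2, kronecker₁_zeroSumEquivDual, zeroSumForm_apply]

end Isomorphisms

theorem exists_injective_mem_of_infinite (X : Type*) [Fintype X] {𝕜 : Type*} {s : Set 𝕜}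
    (hs : s.Infinite) : ∃ b : X → 𝕜, Function.Injective b ∧ ∀ x, b x ∈ s :=
  have := hs.to_subtype
  let g : X ↪ s := (Fintype.equivFin X).toEmbedding.trans
    (Fin.valEmbedding.trans (Infinite.natEmbedding s))
  ⟨fun x => g x, Subtype.val_injective.comp g.injective, fun x => (g x).2⟩

theorem _root_.Module.Basis.linearIndependent_coe {𝕜 U κ : Type*} [Field 𝕜] [AddCommGroup U]
    [Module 𝕜 U] {S : Submodule 𝕜 U} (e : Basis κ 𝕜 S) :
    LinearIndependent 𝕜 fun x => (e x : U) :=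
  e.linearIndependent.map' S.subtype (Submodule.ker_subtype _)

theorem _root_.Module.Basis.span_range_coe {𝕜 U κ : Type*} [Field 𝕜] [AddCommGroup U]
    [Module 𝕜 U] {S : Submodule 𝕜 U} (e : Basis κ 𝕜 S) :
    Submodule.span 𝕜 (Set.range fun x => (e x : U)) = S := by
  have : (Set.range fun x => (e x : U)) = S.subtype '' Set.range e := by
    rw [← Set.range_comp]; rfl
  rw [this, ← Submodule.map_span, e.span_eq, Submodule.map_top, Submodule.range_subtype]

/-! ### Decomposition of a maximal pair. -/

section Decomposition

variable {𝕜 W : Type*} [Field 𝕜] [Infinite 𝕜] [AddCommGroup W] [Module 𝕜 W]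
  [FiniteDimensional 𝕜 W] {Λ Λ₁ : LinearMap.BilinForm 𝕜 (Dual 𝕜 W)}

namespace IsMaximal

variable (h : IsMaximal Λ Λ₁)
include h

theorem apply_eq_zero_of_orthogonal {z : Dual 𝕜 W} (hz : ∀ s ∈ kernelSpan Λ Λ₁, Λ s z = 0) :
    ∀ s ∈ kernelSpan Λ Λ₁, Λ₁ s z = 0 := by
  intro s hs
  have : Λ₁ s ∈ (kernelSpan Λ Λ₁).map Λ := by
    rw [h.isRegularPencil.map_kernelSpan_eq]
    exact Submodule.mem_map_of_mem hs
  obtain ⟨s', hs', h'⟩ := this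
  rw [← h', hz s' hs']

/-- The functional on `L₀ / L₁` induced by an element orthogonal to the annihilator of `L₀`. -/
noncomputable def toDualReduced (Z : Submodule 𝕜 (Dual 𝕜 W))
    (hZ : ∀ z ∈ Z, ∀ s ∈ kernelSpan Λ Λ₁, Λ s z = 0) : Z →ₗ[𝕜] Dual 𝕜 (ReducedSpace Λ Λ₁) :=
  ((coreKernel Λ Λ₁).submoduleOf (core Λ Λ₁)).dualQuotEquivDualAnnihilator.symm.toLinearMap ∘ₗ
    LinearMap.codRestrict _ ((core Λ Λ₁).dualRestrict ∘ₗ Z.subtype) (fun z => by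
      rw [Submodule.mem_dualAnnihilator]
      rintro ⟨y, hy⟩ hy'
      rw [Submodule.submoduleOf, Submodule.mem_comap, h.coreKernel_eq] at hy'
      obtain ⟨s, hs, hs'⟩ := hy'
      have hs' : sharp Λ s = y := hs'
      change (z : Dual 𝕜 W) y = 0
      rw [← hs', apply_sharp, hZ z z.2 s hs])

omit [Infinite 𝕜] in
theorem toDualReduced_apply_mk (Z : Submodule 𝕜 (Dual 𝕜 W))
    (hZ : ∀ z ∈ Z, ∀ s ∈ kernelSpan Λ Λ₁, Λ s z = 0) (z : Z) (x : core Λ Λ₁) :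
    h.toDualReduced Z hZ z (Submodule.Quotient.mk x) = (z : Dual 𝕜 W) x := rfl

/-- An element of Z vanishing on L₀ lies in S, hence is zero. Conversely, extend a functional on L₀
that vanishes on L₁ to W: it is orthogonal to S, so it lies in Z + S, and the S-part is invisible on
L₀. -/
theorem toDualReduced_bijective (Z : Submodule 𝕜 (Dual 𝕜 W))
    (hZ : ∀ z ∈ Z, ∀ s ∈ kernelSpan Λ Λ₁, Λ s z = 0) (hdisj : Disjoint Z (kernelSpan Λ Λ₁))
    (hZ' : ∀ u, (∀ s ∈ kernelSpan Λ Λ₁, Λ s u = 0) → ∃ z ∈ Z, ∃ s ∈ kernelSpan Λ Λ₁, u = z + s) :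
    Function.Bijective (h.toDualReduced Z hZ) := by
  constructor
  · rw [injective_iff_map_eq_zero]
    intro z hz
    have : (z : Dual 𝕜 W) ∈ kernelSpan Λ Λ₁ := by
      rw [← h.dualAnnihilator_core, Submodule.mem_dualAnnihilator]
      intro y hy
      rw [← h.toDualReduced_apply_mk Z hZ z ⟨y, hy⟩, hz, LinearMap.zero_apply]
    exact Subtype.ext (Submodule.disjoint_def.1 hdisj _ z.2 this)
  · intro φ
    obtain ⟨α, hα⟩ := (φ ∘ₗ ((coreKernel Λ Λ₁).submoduleOf (core Λ Λ₁)).mkQ).exists_extend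
    have hα' : ∀ x : core Λ Λ₁, α x = φ (Submodule.Quotient.mk x) := fun x =>
      LinearMap.congr_fun hα x
    obtain ⟨z, hz, s, hs, rfl⟩ := hZ' α fun s hs => by
      have hmem : sharp Λ s ∈ coreKernel Λ Λ₁ := by
        rw [h.coreKernel_eq]; exact Submodule.mem_map_of_mem hs
      rw [← apply_sharp, hα' ⟨_, h.coreKernel_le_core hmem⟩,
        (Submodule.Quotient.mk_eq_zero _).2 (by exact hmem), map_zero]
    refine ⟨⟨z, hz⟩, ?_⟩
    ext x
    have h1 := hα' x
    rw [LinearMap.add_apply, h.mem_core.1 x.2 s hs, add_zero] at h1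
    exact h1

omit h [Infinite 𝕜] in
theorem dualBivector_apply {E : Type*} [AddCommGroup E] [Module 𝕜 E] [FiniteDimensional 𝕜 E]
    {ω : LinearMap.BilinForm 𝕜 E} (hω : ω.Nondegenerate) {α β : Dual 𝕜 E} {v w : E}
    (hv : ω v = α) (hw : ω w = β) : dualBivector ω hω α β = ω v w := by
  have key : ∀ {α : Dual 𝕜 E} {v : E}, ω v = α → (ω.toDual hω).symm α = v := by
    intro α v hv
    rw [LinearEquiv.symm_apply_eq]
    exact hv.symm
  rw [dualBivector, LinearMap.compl₁₂_apply, LinearEquiv.coe_coe, key hv, key hw]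

-- Under ω, the functional defined by z corresponds to the class of Λ(-z, ·), the sign being that of
-- `imageForm_apply`.
omit [Infinite 𝕜] in
theorem dual_toDualReduced {σ : SymplecticPair 𝕜 (ReducedSpace Λ Λ₁)} (hσ : IsReducedPair Λ Λ₁ σ)
    (Z : Submodule 𝕜 (Dual 𝕜 W)) (hZ : ∀ z ∈ Z, ∀ s ∈ kernelSpan Λ Λ₁, Λ s z = 0) (z z' : Z) :
    σ.dual (h.toDualReduced Z hZ z) (h.toDualReduced Z hZ z') = Λ z z' := by
  have hmem : ∀ z : Z, sharp Λ (-z) ∈ core Λ Λ₁ := fun z => h.mem_core.2 fun s hs => by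
    rw [apply_sharp, ← h.alt.neg_eq, map_neg, neg_neg]; exact hZ z z.2 s hs
  have key : ∀ z : Z, σ.ω (Submodule.Quotient.mk ⟨sharp Λ (-z), hmem z⟩) =
      h.toDualReduced Z hZ z := by
    intro z
    ext y
    change σ.ω _ (Submodule.Quotient.mk y) = _
    rw [hσ.ω_apply h (α := -z) rfl]
    simp [toDualReduced_apply_mk]
  rw [SymplecticPair.dual, dualBivector_apply _ (key z) (key z'), hσ.ω_apply h (α := -z) rfl]
  simp only [LinearMap.neg_apply, neg_neg]
  rw [apply_sharp, map_neg, LinearMap.neg_apply, h.alt.neg_eq]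

theorem dual₁_toDualReduced {σ : SymplecticPair 𝕜 (ReducedSpace Λ Λ₁)} (hσ : IsReducedPair Λ Λ₁ σ)
    (Z : Submodule 𝕜 (Dual 𝕜 W)) (hZ : ∀ z ∈ Z, ∀ s ∈ kernelSpan Λ Λ₁, Λ s z = 0) (z z' : Z) :
    σ.dual₁ (h.toDualReduced Z hZ z) (h.toDualReduced Z hZ z') = Λ₁ z z' := by
  have hmem : ∀ z : Z, sharp Λ₁ (-z) ∈ core Λ Λ₁ := fun z => h.mem_core.2 fun s hs => by
    rw [apply_sharp, ← h.alt₁.neg_eq, map_neg, neg_neg]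
    exact h.apply_eq_zero_of_orthogonal (hZ z z.2) s hs
  have key : ∀ z : Z, σ.ω₁ (Submodule.Quotient.mk ⟨sharp Λ₁ (-z), hmem z⟩) =
      h.toDualReduced Z hZ z := by
    intro z
    ext y
    change σ.ω₁ _ (Submodule.Quotient.mk y) = _
    rw [hσ.ω₁_apply h (α := -z) rfl]
    simp [toDualReduced_apply_mk]
  rw [SymplecticPair.dual₁, dualBivector_apply _ (key z) (key z'), hσ.ω₁_apply h (α := -z) rfl]
  simp only [LinearMap.neg_apply, neg_neg]
  rw [apply_sharp, map_neg, LinearMap.neg_apply, h.alt₁.neg_eq]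

theorem exists_regular_weights (X : Type*) [Fintype X] : ∃ b : X → 𝕜, Function.Injective b ∧
    (∀ x, b x ≠ 0) ∧ ∀ x, -b x ∈ regularSet Λ Λ₁ := by
  have hinf : ({t : 𝕜 | t ≠ 0 ∧ -t ∈ regularSet Λ Λ₁}).Infinite := by
    refine (((h.isRegularPencil.finite_compl_regularSet.preimage
      (neg_injective (G := 𝕜)).injOn).union (Set.finite_singleton 0)).infinite_compl).mono ?_
    intro t ht
    simp only [Set.compl_union, Set.mem_inter_iff, Set.mem_compl_iff, Set.mem_preimage, not_not,
      Set.mem_singleton_iff] at ht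
    exact ⟨ht.2, ht.1⟩
  obtain ⟨b, hb, hmem⟩ := exists_injective_mem_of_infinite X hinf
  exact ⟨b, hb, fun x => (hmem x).1, fun x => (hmem x).2⟩

omit [Infinite 𝕜] in
theorem exists_linearIndependent_veroneseVector {r : ℕ} {n : Fin r → ℕ}
    (hn : HasCharacteristicNumbers (web Λ Λ₁) n) :
    ∃ e : (Σ j, Fin (n j)) → Dual 𝕜 W, LinearIndependent 𝕜 e ∧
      Submodule.span 𝕜 (Set.range e) = kernelSpan Λ Λ₁ ∧
      ∀ t : 𝕜, LinearMap.ker (Λ + t • Λ₁) ⊓ kernelSpan Λ Λ₁ =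
        Submodule.span 𝕜 (Set.range (veroneseVector e t)) := by
  rw [h.hasCharacteristicNumbers_web_iff] at hn
  obtain ⟨-, e, he⟩ := hn
  exact ⟨fun x => e x, e.linearIndependent_coe, e.span_range_coe, he⟩

omit [Infinite 𝕜] in
/-- The splitting of a maximal pair for weights which are distinct and have regular negatives. -/
theorem exists_splitting {r : ℕ} {n : Fin r → ℕ} (hn : HasCharacteristicNumbers (web Λ Λ₁) n)
    {b : (Σ j, Fin (n j)) → 𝕜} (hinj : Function.Injective b) (hb : ∀ x, b x ≠ 0)
    (hreg : ∀ x, -b x ∈ regularSet Λ Λ₁) :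
    ∃ (Z : Submodule 𝕜 (Dual 𝕜 W)) (f : (∀ j, zeroSum 𝕜 (n j)) →ₗ[𝕜] Dual 𝕜 W),
      IsKroneckerSplitting Λ Λ₁ (kernelSpan Λ Λ₁) (fun j i => b ⟨j, i⟩) Z f := by
  obtain ⟨e, hli, hspan, he⟩ := h.exists_linearIndependent_veroneseVector hn
  have hker : ∀ (t : 𝕜) j, veroneseVector e t j ∈ LinearMap.ker (Λ + t • Λ₁) := by
    intro t j
    have : veroneseVector e t j ∈ LinearMap.ker (Λ + t • Λ₁) ⊓ kernelSpan Λ Λ₁ := by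
      rw [he]
      exact Submodule.subset_span ⟨j, rfl⟩
    exact this.1
  have hker' : ∀ j i, LinearMap.ker (Λ + (-b ⟨j, i⟩ : 𝕜) • Λ₁) ≤
      Submodule.span 𝕜 (Set.range (veroneseVector e (-b ⟨j, i⟩))) := by
    intro j i
    rw [← he]
    exact le_inf le_rfl (IsRegularPencil.ker_le_kernelSpan_of_mem (hreg ⟨j, i⟩))
  have := exists_isKroneckerSplitting (b := fun j i => b ⟨j, i⟩) h.alt h.alt₁ hn.1 hli
    (fun j i => hb _) hinj hker hker'
  rwa [hspan] at this

omit h [FiniteDimensional 𝕜 W] [Infinite 𝕜] in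
theorem _root_.BivectorPair.IsKroneckerSplitting.exists_equiv {S : Submodule 𝕜 (Dual 𝕜 W)} {r : ℕ}
    {n : Fin r → ℕ} {b : ∀ j, Fin (n j) → 𝕜} {Z : Submodule 𝕜 (Dual 𝕜 W)}
    {f : (∀ j, zeroSum 𝕜 (n j)) →ₗ[𝕜] Dual 𝕜 W} (hΛ : Λ.IsAlt) (hΛ₁ : Λ₁.IsAlt)
    (hf : IsKroneckerSplitting Λ Λ₁ S b Z f) :
    ∃ m : (Z × ∀ j, zeroSum 𝕜 (n j)) ≃ₗ[𝕜] Dual 𝕜 W, ∀ x y,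
      Λ (m x) (m y) = Λ x.1 y.1 + ∑ j, zeroSumForm 1 (x.2 j) (y.2 j) ∧
      Λ₁ (m x) (m y) = Λ₁ x.1 y.1 + ∑ j, zeroSumForm (b j)⁻¹ (x.2 j) (y.2 j) := by
  have hm : Function.Bijective (Z.subtype.coprod f) := by
    constructor
    · rw [injective_iff_map_eq_zero]
      rintro ⟨z, v⟩ hzv
      obtain ⟨h1, h2⟩ := hf.eq_zero z z.2 v hzv
      exact Prod.ext (Subtype.ext h1) h2
    · intro u
      obtain ⟨z, hz, v, rfl⟩ := hf.exists_add u
      exact ⟨(⟨z, hz⟩, v), rfl⟩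
  refine ⟨LinearEquiv.ofBijective _ hm, fun x y => ⟨?_, ?_⟩⟩
  · have hx : Λ x.1 (f y.2) = 0 := by
      rw [← hΛ.neg_eq, (hf.orthogonal _ x.1.2 _).1, neg_zero]
    change Λ (x.1 + f x.2) (y.1 + f y.2) = _
    rw [map_add, map_add, LinearMap.add_apply, LinearMap.add_apply, hf.map_map,
      (hf.orthogonal _ y.1.2 _).1, hx, add_zero, zero_add]
    rfl
  · have hx : Λ₁ x.1 (f y.2) = 0 := by
      rw [← hΛ₁.neg_eq, (hf.orthogonal _ x.1.2 _).2, neg_zero]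
    change Λ₁ (x.1 + f x.2) (y.1 + f y.2) = _
    rw [map_add, map_add, LinearMap.add_apply, LinearMap.add_apply, hf.map_map',
      (hf.orthogonal _ y.1.2 _).2, hx, add_zero, zero_add]
    rfl

/-- Decomposition of a maximal pair. -/
theorem isomorphic_prodBivector {σ : SymplecticPair 𝕜 (ReducedSpace Λ Λ₁)}
    (hσ : IsReducedPair Λ Λ₁ σ) {r : ℕ} {n : Fin r → ℕ}
    (hn : HasCharacteristicNumbers (web Λ Λ₁) n) (b : ∀ l, Fin (n l) → 𝕜)
    (hb : ∀ l i, b l i ≠ 0) (hinj : ∀ l, Function.Injective (b l)) :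
    Isomorphic Λ Λ₁ (prodBivector σ.dual (piBivector fun l => kronecker (b l) (hb l)))
      (prodBivector σ.dual₁ (piBivector fun l => kronecker₁ (b l) (hb l))) := by
  -- The given weights may repeat between blocks or have singular negatives. The splitting uses
  -- generic weights b', which are then exchanged block by block.
  obtain ⟨b', hb'inj, hb'0, hb'reg⟩ := h.exists_regular_weights (Σ j, Fin (n j))
  obtain ⟨Z, f, hf⟩ := h.exists_splitting hn hb'inj hb'0 hb'reg
  obtain ⟨m, hm⟩ := hf.exists_equiv h.alt h.alt₁
  choose θ hθ using fun j => exists_equiv_zeroSum (hn.1 j) (b := fun i => b' ⟨j, i⟩) (b' := b j)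
    (fun i => hb'0 _) (fun i i' hii => by simpa using hb'inj hii) (hb j) (hinj j)
  let ζ : Z ≃ₗ[𝕜] Dual 𝕜 (ReducedSpace Λ Λ₁) := LinearEquiv.ofBijective
    (h.toDualReduced Z hf.apply_eq_zero)
    (h.toDualReduced_bijective Z hf.apply_eq_zero hf.disjoint hf.exists_add_of_orthogonal)
  refine isomorphic_of_model (Z := Z) ζ (((LinearEquiv.refl 𝕜 Z).prodCongr
    (LinearEquiv.piCongrRight θ)).trans m) b hb (fun x y => ?_) (fun x y => ?_)
  · rw [LinearEquiv.trans_apply, LinearEquiv.trans_apply, (hm _ _).1]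
    congr 1
    · exact (h.dual_toDualReduced hσ Z hf.apply_eq_zero x.1 y.1).symm
    · exact Finset.sum_congr rfl fun j _ => (hθ j _ _).1
  · rw [LinearEquiv.trans_apply, LinearEquiv.trans_apply, (hm _ _).2]
    congr 1
    · exact (h.dual₁_toDualReduced hσ Z hf.apply_eq_zero x.1 y.1).symm
    · exact Finset.sum_congr rfl fun j _ => (hθ j _ _).2

end IsMaximal

end Decomposition

/-! ### The residue functional modulo a monic polynomial. -/

section Residue

variable {𝕜 : Type*} [Field 𝕜]

/-- The coefficient of degree `deg m - 1` of the remainder modulo `m`. -/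
noncomputable def residue (m : 𝕜[X]) : 𝕜[X] →ₗ[𝕜] 𝕜 :=
  lcoeff 𝕜 (m.natDegree - 1) ∘ₗ modByMonicHom m

theorem residue_apply (m f : 𝕜[X]) : residue m f = (f %ₘ m).coeff (m.natDegree - 1) := rfl

theorem residue_eq_zero_of_dvd {m f : 𝕜[X]} (hm : m.Monic) (h : m ∣ f) : residue m f = 0 := by
  rw [residue_apply, (modByMonic_eq_zero_iff_dvd hm).2 h, coeff_zero]

/-- A suitable power of X moves the leading coefficient of a non-zero remainder into degree deg m -
1. The residue pairing on 𝕜[X]/(m) is therefore non-degenerate. -/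
theorem dvd_of_residue_eq_zero {m f : 𝕜[X]} (hm : m.Monic)
    (h : ∀ g, residue m (f * g) = 0) : m ∣ f := by
  rw [← modByMonic_eq_zero_iff_dvd hm]
  by_contra hr
  have hlt : (f %ₘ m).natDegree < m.natDegree :=
    natDegree_lt_natDegree hr (degree_modByMonic_lt f hm)
  set r := f %ₘ m with hrdef
  have h1 := h (X ^ (m.natDegree - 1 - r.natDegree))
  have h2 : (f * X ^ (m.natDegree - 1 - r.natDegree)) %ₘ m =
      r * X ^ (m.natDegree - 1 - r.natDegree) := by
    have h3 : (r * X ^ (m.natDegree - 1 - r.natDegree)).natDegree < m.natDegree := by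
      rw [natDegree_mul_X_pow _ hr]
      omega
    rw [← (modByMonic_eq_self_iff hm).2 (degree_lt_degree h3)]
    refine modByMonic_eq_of_dvd_sub hm ?_
    rw [← sub_mul]
    refine Dvd.dvd.mul_right ⟨f /ₘ m, ?_⟩ _
    rw [sub_eq_iff_eq_add', hrdef, modByMonic_add_div f]
  rw [residue_apply, h2, show m.natDegree - 1 = r.natDegree + (m.natDegree - 1 - r.natDegree) by
    omega] at h1
  rw [show m.natDegree - 1 = r.natDegree + (m.natDegree - 1 - r.natDegree) by omega,
    Nat.add_sub_cancel_left, coeff_mul_X_pow] at h1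
  exact hr (leadingCoeff_eq_zero.1 h1)

end Residue

/-! ### Dimensions of ker f(J) as cancellable invariants. -/

section Intertwining

variable {𝕜 E E' : Type*} [Field 𝕜] [AddCommGroup E] [Module 𝕜 E] [AddCommGroup E'] [Module 𝕜 E']

theorem aeval_apply_of_intertwining {J : Module.End 𝕜 E} {J' : Module.End 𝕜 E'} {φ : E →ₗ[𝕜] E'}
    (h : ∀ x, φ (J x) = J' (φ x)) (f : 𝕜[X]) (x : E) :
    φ (aeval J f x) = aeval J' f (φ x) := by
  induction f using Polynomial.induction_on' with
  | add p q hp hq => simp [hp, hq]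
  | monomial k a =>
    rw [aeval_monomial, aeval_monomial, Module.algebraMap_end_eq_smul_id,
      Module.algebraMap_end_eq_smul_id]
    simp only [Module.End.mul_apply, LinearMap.smul_apply, LinearMap.id_apply, map_smul]
    congr 1
    induction k generalizing x with
    | zero => simp
    | succ k ih => rw [pow_succ, pow_succ, Module.End.mul_apply, Module.End.mul_apply, ih, h]

theorem finrank_ker_aeval_eq {J : Module.End 𝕜 E} {J' : Module.End 𝕜 E'} {φ : E ≃ₗ[𝕜] E'}
    (h : ∀ x, φ (J x) = J' (φ x)) (f : 𝕜[X]) :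
    finrank 𝕜 (LinearMap.ker (aeval J f)) = finrank 𝕜 (LinearMap.ker (aeval J' f)) := by
  refine LinearEquiv.finrank_eq (φ.ofSubmodules _ _ ?_)
  ext y
  have key := aeval_apply_of_intertwining (φ := φ.toLinearMap) h f
  constructor
  · rintro ⟨x, hx, rfl⟩
    rw [LinearMap.mem_ker, ← key, LinearMap.mem_ker.1 hx, map_zero]
  · intro hy
    refine ⟨φ.symm y, ?_, φ.apply_symm_apply y⟩
    rw [SetLike.mem_coe, LinearMap.mem_ker, ← φ.map_eq_zero_iff]
    refine (key _).trans ?_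
    rw [LinearEquiv.coe_coe, φ.apply_symm_apply, LinearMap.mem_ker.1 hy]

theorem finrank_submodule_prod [FiniteDimensional 𝕜 E] [FiniteDimensional 𝕜 E']
    (p : Submodule 𝕜 E) (q : Submodule 𝕜 E') :
    finrank 𝕜 (p.prod q) = finrank 𝕜 p + finrank 𝕜 q := by
  rw [← finrank_prod]
  exact LinearEquiv.finrank_eq
    { toFun := fun x => (⟨x.1.1, x.2.1⟩, ⟨x.1.2, x.2.2⟩)
      invFun := fun x => ⟨(x.1, x.2), x.1.2, x.2.2⟩
      map_add' := fun _ _ => rfl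
      map_smul' := fun _ _ => rfl
      left_inv := fun _ => rfl
      right_inv := fun _ => rfl }

theorem finrank_ker_eq_finrank_iff [FiniteDimensional 𝕜 E] (g : E →ₗ[𝕜] E') :
    finrank 𝕜 (LinearMap.ker g) = finrank 𝕜 E ↔ g = 0 := by
  constructor
  · intro h
    exact LinearMap.ker_eq_top.1 (Submodule.eq_top_of_finrank_eq h)
  · intro h
    rw [LinearMap.ker_eq_top.2 h, finrank_top]

theorem finrank_ker_aeval_add [FiniteDimensional 𝕜 E] {J : Module.End 𝕜 E} {H K : Submodule 𝕜 E}
    (hHK : IsCompl H K) (hH : ∀ x ∈ H, J x ∈ H) (hK : ∀ x ∈ K, J x ∈ K) (f : 𝕜[X]) :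
    finrank 𝕜 (LinearMap.ker (aeval J f)) = finrank 𝕜 (LinearMap.ker (aeval (J.restrict hH) f)) +
      finrank 𝕜 (LinearMap.ker (aeval (J.restrict hK) f)) := by
  have h1 : ∀ x, H.prodEquivOfIsCompl K hHK (LinearMap.prodMap (J.restrict hH) (J.restrict hK) x) =
      J (H.prodEquivOfIsCompl K hHK x) := by
    intro x
    simp [map_add]
  rw [← finrank_ker_aeval_eq h1 f]
  have h2 : aeval (LinearMap.prodMap (J.restrict hH) (J.restrict hK)) f =
      LinearMap.prodMap (aeval (J.restrict hH) f) (aeval (J.restrict hK) f) := by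
    refine (aeval_algHom_apply (LinearMap.prodMapAlgHom 𝕜 H K) (J.restrict hH, J.restrict hK)
      f).trans ?_
    rw [aeval_prod_apply]
    rfl
  rw [h2, LinearMap.ker_prodMap, finrank_submodule_prod]

/-- Linear maps with equal kernels have isomorphic ranges. -/
theorem exists_equiv_range {M : Type*} [AddCommGroup M] [Module 𝕜 M] {P : M →ₗ[𝕜] E}
    {P' : M →ₗ[𝕜] E'} (h : LinearMap.ker P = LinearMap.ker P') :
    ∃ φ : LinearMap.range P ≃ₗ[𝕜] LinearMap.range P', ∀ x, φ (P.rangeRestrict x) =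
      P'.rangeRestrict x := by
  refine ⟨P.quotKerEquivRange.symm.trans ((Submodule.quotEquivOfEq _ _ h).trans
    P'.quotKerEquivRange), fun x => ?_⟩
  have : P.quotKerEquivRange.symm (P.rangeRestrict x) = Submodule.Quotient.mk x := by
    rw [LinearEquiv.symm_apply_eq]
    rfl
  rw [LinearEquiv.trans_apply, LinearEquiv.trans_apply, this]
  rfl

end Intertwining

/-! ### Symplectic classification of skew-Hamiltonian endomorphisms. -/

/-- `ω` is a symplectic form and `(x, y) ↦ ω(J x, y)` is alternating. -/
structure IsSkewHamiltonian {𝕜 E : Type*} [Field 𝕜] [AddCommGroup E] [Module 𝕜 E]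
    (ω : LinearMap.BilinForm 𝕜 E) (J : Module.End 𝕜 E) : Prop where
  alt : ω.IsAlt
  nondeg : ω.Nondegenerate
  apply_self : ∀ x, ω (J x) x = 0

namespace IsSkewHamiltonian

variable {𝕜 E : Type*} [Field 𝕜] [AddCommGroup E] [Module 𝕜 E]
  {ω : LinearMap.BilinForm 𝕜 E} {J : Module.End 𝕜 E}

theorem apply_left (h : IsSkewHamiltonian ω J) (x y : E) : ω (J x) y = ω x (J y) := by
  have := h.apply_self (x + y)
  simp only [map_add, LinearMap.add_apply, h.apply_self, zero_add, add_zero] at this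
  rw [eq_neg_of_add_eq_zero_right this, h.alt.neg_eq]

theorem pow_left (h : IsSkewHamiltonian ω J) (k : ℕ) (x y : E) :
    ω ((J ^ k) x) y = ω x ((J ^ k) y) := by
  induction k generalizing x with
  | zero => rfl
  | succ k ih =>
    rw [pow_succ, Module.End.mul_apply, ih, h.apply_left, ← Module.End.mul_apply J, ← pow_succ',
      ← pow_succ]

theorem aeval_left (h : IsSkewHamiltonian ω J) (f : 𝕜[X]) (x y : E) :
    ω (aeval J f x) y = ω x (aeval J f y) := by
  induction f using Polynomial.induction_on' with
  | add p q hp hq => simp [hp, hq]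
  | monomial k a =>
    rw [aeval_monomial, Module.algebraMap_end_eq_smul_id]
    simp [h.pow_left]

/-- Half of each power of J can be moved to the other argument, leaving ω(y, y) or ω(Jy, y). Cyclic
subspaces are thus isotropic. -/
theorem aeval_self (h : IsSkewHamiltonian ω J) (f : 𝕜[X]) (x : E) :
    ω (aeval J f x) x = 0 := by
  induction f using Polynomial.induction_on' with
  | add p q hp hq => simp [hp, hq]
  | monomial k a =>
    rw [aeval_monomial, Module.algebraMap_end_eq_smul_id]
    suffices ω ((J ^ k) x) x = 0 by simp [this]
    obtain ⟨i, rfl | rfl⟩ := Nat.even_or_odd' k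
    · rw [two_mul, pow_add, Module.End.mul_apply, h.pow_left]
      exact h.alt _
    · rw [two_mul, add_assoc, pow_add, Module.End.mul_apply, h.pow_left, pow_succ',
        Module.End.mul_apply]
      exact h.apply_self _

theorem aeval_aeval_self (h : IsSkewHamiltonian ω J) (f g : 𝕜[X]) (x : E) :
    ω (aeval J f x) (aeval J g x) = 0 := by
  rw [← h.aeval_left, ← Module.End.mul_apply, ← map_mul, h.aeval_self]

theorem _root_.Module.End.exists_aeval_apply_eq_zero_iff [FiniteDimensional 𝕜 E]
    (J : Module.End 𝕜 E) : ∃ v, ∀ f : 𝕜[X], aeval J f v = 0 ↔ minpoly 𝕜 J ∣ f := by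
  obtain ⟨x, hx⟩ := exists_ker_toSpanSingleton_eq_annihilator 𝕜[X] (AEval' J)
  obtain ⟨v, rfl⟩ := (AEval'.of J).surjective x
  refine ⟨v, fun f => ?_⟩
  have h1 := SetLike.ext_iff.1 hx f
  rw [AEval.annihilator_eq_ker_aeval, RingHom.mem_ker] at h1
  rw [minpoly.dvd_iff]
  refine Iff.trans ?_ h1
  rw [LinearMap.mem_ker, LinearMap.toSpanSingleton_apply]
  exact ((AEval'.of J).map_eq_zero_iff (x := aeval J f v)).symm

/-- Since f(J)v determines f modulo the minimal polynomial, the residue is a well-defined functional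
on the cyclic space of v; non-degeneracy of ω represents it by a vector w. -/
theorem exists_residue [FiniteDimensional 𝕜 E] (h : IsSkewHamiltonian ω J) :
    ∃ v w, (∀ f : 𝕜[X], aeval J f v = 0 ↔ minpoly 𝕜 J ∣ f) ∧
      ∀ f : 𝕜[X], ω (aeval J f v) w = residue (minpoly 𝕜 J) f := by
  obtain ⟨v, hv⟩ := J.exists_aeval_apply_eq_zero_iff
  have hm : (minpoly 𝕜 J).Monic := minpoly.monic (Algebra.IsIntegral.isIntegral J)
  let Q : 𝕜[X] →ₗ[𝕜] E := (LinearMap.applyₗ v) ∘ₗ (aeval J).toLinearMap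
  have hQ : ∀ f, Q f = aeval J f v := fun f => rfl
  have h1 : residue (minpoly 𝕜 J) ∈ LinearMap.range Q.dualMap := by
    rw [LinearMap.range_dualMap_eq_dualAnnihilator_ker, Submodule.mem_dualAnnihilator]
    intro f hf
    rw [LinearMap.mem_ker, hQ, hv] at hf
    exact residue_eq_zero_of_dvd hm hf
  obtain ⟨μ, hμ⟩ := h1
  obtain ⟨u, hu⟩ := (ω.toDual h.nondeg).surjective (-μ)
  refine ⟨v, u, hv, fun f => ?_⟩
  rw [← hμ, ← h.alt.neg_eq]
  have : ω u = -μ := hu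
  rw [this, LinearMap.neg_apply, neg_neg]
  rfl

/-- The map `(f, g) ↦ f(J) v + g(J) w`. -/
noncomputable def pairMap (J : Module.End 𝕜 E) (v w : E) : 𝕜[X] × 𝕜[X] →ₗ[𝕜] E :=
  ((LinearMap.applyₗ v) ∘ₗ (aeval J).toLinearMap).coprod
    ((LinearMap.applyₗ w) ∘ₗ (aeval J).toLinearMap)

theorem pairMap_apply (J : Module.End 𝕜 E) (v w : E) (x : 𝕜[X] × 𝕜[X]) :
    pairMap J v w x = aeval J x.1 v + aeval J x.2 w := rfl

theorem apply_pairMap (J : Module.End 𝕜 E) (v w : E) (x : 𝕜[X] × 𝕜[X]) :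
    J (pairMap J v w x) = pairMap J v w (X * x.1, X * x.2) := by
  simp [pairMap_apply]

section Pair

variable [FiniteDimensional 𝕜 E] (h : IsSkewHamiltonian ω J) {v w : E}
  (hv : ∀ f : 𝕜[X], aeval J f v = 0 ↔ minpoly 𝕜 J ∣ f)
  (hw : ∀ f : 𝕜[X], ω (aeval J f v) w = residue (minpoly 𝕜 J) f)
include h hw

-- Both cyclic spaces are isotropic and the cross terms are residues, so the form depends only on
-- the minimal polynomial.
omit [FiniteDimensional 𝕜 E] in
theorem form_pairMap (x y : 𝕜[X] × 𝕜[X]) : ω (pairMap J v w x) (pairMap J v w y) =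
    residue (minpoly 𝕜 J) (x.1 * y.2) - residue (minpoly 𝕜 J) (x.2 * y.1) := by
  simp only [pairMap_apply, map_add, LinearMap.add_apply, h.aeval_aeval_self]
  have key : ∀ f g : 𝕜[X], ω (aeval J f v) (aeval J g w) = residue (minpoly 𝕜 J) (f * g) := by
    intro f g
    rw [← h.aeval_left, ← Module.End.mul_apply, ← map_mul, hw, mul_comm]
  rw [key, ← h.alt.neg_eq, key, mul_comm x.2]
  ring

theorem dvd_of_orthogonal {x : 𝕜[X] × 𝕜[X]}
    (hx : ∀ y, ω (pairMap J v w x) (pairMap J v w y) = 0) :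
    minpoly 𝕜 J ∣ x.1 ∧ minpoly 𝕜 J ∣ x.2 := by
  have hm : (minpoly 𝕜 J).Monic := minpoly.monic (Algebra.IsIntegral.isIntegral J)
  refine ⟨dvd_of_residue_eq_zero hm fun g => ?_, dvd_of_residue_eq_zero hm fun g => ?_⟩
  · simpa [h.form_pairMap hw] using hx (0, g)
  · simpa [h.form_pairMap hw] using hx (g, 0)

theorem pairMap_eq_zero_iff (x : 𝕜[X] × 𝕜[X]) :
    pairMap J v w x = 0 ↔ minpoly 𝕜 J ∣ x.1 ∧ minpoly 𝕜 J ∣ x.2 := by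
  constructor
  · intro hx
    exact h.dvd_of_orthogonal hw fun y => by rw [hx, map_zero, LinearMap.zero_apply]
  · rintro ⟨h1, h2⟩
    rw [minpoly.dvd_iff] at h1 h2
    rw [pairMap_apply, h1, h2, LinearMap.zero_apply, LinearMap.zero_apply, add_zero]

theorem isCompl_range_pairMap : IsCompl (LinearMap.range (pairMap J v w))
    (ω.orthogonal (LinearMap.range (pairMap J v w))) := by
  rw [LinearMap.BilinForm.isCompl_orthogonal_iff_disjoint h.alt.isRefl, Submodule.disjoint_def]
  rintro _ ⟨x, rfl⟩ hx
  rw [h.pairMap_eq_zero_iff hw]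
  refine h.dvd_of_orthogonal hw fun y => ?_
  rw [← h.alt.neg_eq, neg_eq_zero]
  exact LinearMap.BilinForm.mem_orthogonal_iff.1 hx _ ⟨y, rfl⟩

end Pair

theorem apply_mem_range_pairMap (J : Module.End 𝕜 E) (v w : E) :
    ∀ x ∈ LinearMap.range (pairMap J v w), J x ∈ LinearMap.range (pairMap J v w) := by
  rintro _ ⟨x, rfl⟩
  exact ⟨_, (apply_pairMap J v w x).symm⟩

theorem apply_mem_orthogonal (h : IsSkewHamiltonian ω J) {H : Submodule 𝕜 E}
    (hH : ∀ x ∈ H, J x ∈ H) : ∀ x ∈ ω.orthogonal H, J x ∈ ω.orthogonal H := by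
  intro x hx
  rw [LinearMap.BilinForm.mem_orthogonal_iff] at hx ⊢
  intro y hy
  have := hx (J y) (hH y hy)
  exact (h.apply_left y x).symm.trans this

theorem restrict (h : IsSkewHamiltonian ω J) {K : Submodule 𝕜 E} (hK : ∀ x ∈ K, J x ∈ K)
    (hdisj : Disjoint K (ω.orthogonal K)) :
    IsSkewHamiltonian (ω.restrict K) (J.restrict hK) where
  alt x := h.alt x
  nondeg := ω.nondegenerate_restrict_of_disjoint_orthogonal h.alt.isRefl hdisj
  apply_self x := h.apply_self x

theorem disjoint_orthogonal [FiniteDimensional 𝕜 E] (h : IsSkewHamiltonian ω J)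
    {L : Submodule 𝕜 E} (hL : IsCompl L (ω.orthogonal L)) :
    Disjoint (ω.orthogonal L) (ω.orthogonal (ω.orthogonal L)) := by
  rw [LinearMap.BilinForm.orthogonal_orthogonal h.nondeg h.alt.isRefl]
  exact hL.disjoint.symm

theorem finrank_eq_of_ker {E' : Type*} [AddCommGroup E'] [Module 𝕜 E'] [FiniteDimensional 𝕜 E]
    [FiniteDimensional 𝕜 E'] {J : Module.End 𝕜 E} {J' : Module.End 𝕜 E'}
    (hJ : ∀ f : 𝕜[X], finrank 𝕜 (LinearMap.ker (aeval J f)) =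
      finrank 𝕜 (LinearMap.ker (aeval J' f))) : finrank 𝕜 E = finrank 𝕜 E' := by
  rw [← (finrank_ker_eq_finrank_iff (aeval J (0 : 𝕜[X]))).2 (map_zero _), hJ,
    (finrank_ker_eq_finrank_iff _).2 (map_zero _)]

theorem minpoly_eq {E' : Type*} [AddCommGroup E'] [Module 𝕜 E'] [FiniteDimensional 𝕜 E]
    [FiniteDimensional 𝕜 E'] {J : Module.End 𝕜 E} {J' : Module.End 𝕜 E'}
    (hJ : ∀ f : 𝕜[X], finrank 𝕜 (LinearMap.ker (aeval J f)) =
      finrank 𝕜 (LinearMap.ker (aeval J' f))) : minpoly 𝕜 J = minpoly 𝕜 J' := by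
  have key : ∀ f : 𝕜[X], aeval J f = 0 ↔ aeval J' f = 0 := by
    intro f
    rw [← finrank_ker_eq_finrank_iff, ← finrank_ker_eq_finrank_iff, hJ f, finrank_eq_of_ker hJ]
  exact eq_of_monic_of_associated (minpoly.monic (Algebra.IsIntegral.isIntegral J))
    (minpoly.monic (Algebra.IsIntegral.isIntegral J')) (associated_of_dvd_dvd
      (minpoly.dvd _ _ ((key _).2 (minpoly.aeval _ _)))
      (minpoly.dvd _ _ ((key _).1 (minpoly.aeval _ _))))

/-- Symplectic forms on complementary orthogonal subspaces can be compared separately. -/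
theorem exists_equiv_of_isCompl {E' : Type*} [AddCommGroup E'] [Module 𝕜 E']
    {ω' : LinearMap.BilinForm 𝕜 E'} {J' : Module.End 𝕜 E'} {H K : Submodule 𝕜 E}
    {H' K' : Submodule 𝕜 E'} (hω : ω.IsAlt) (hω' : ω'.IsAlt) (hHK : IsCompl H K)
    (hHK' : IsCompl H' K') (hort : ∀ x ∈ H, ∀ y ∈ K, ω x y = 0)
    (hort' : ∀ x ∈ H', ∀ y ∈ K', ω' x y = 0) (φ : H ≃ₗ[𝕜] H') (ψ : K ≃ₗ[𝕜] K')
    (hφ : ∀ x y, ω' (φ x) (φ y) = ω x y) (hψ : ∀ x y, ω' (ψ x) (ψ y) = ω x y)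
    (hφJ : ∀ x y : H, J x = y → J' (φ x) = φ y)
    (hψJ : ∀ x y : K, J x = y → J' (ψ x) = ψ y)
    (hH : ∀ x ∈ H, J x ∈ H) (hK : ∀ x ∈ K, J x ∈ K) :
    ∃ θ : E ≃ₗ[𝕜] E', (∀ x y, ω' (θ x) (θ y) = ω x y) ∧ ∀ x, θ (J x) = J' (θ x) := by
  have hort2 : ∀ x ∈ H, ∀ y ∈ K, ω y x = 0 := fun x hx y hy => by
    rw [← hω.neg_eq, hort x hx y hy, neg_zero]
  have hort2' : ∀ x ∈ H', ∀ y ∈ K', ω' y x = 0 := fun x hx y hy => by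
    rw [← hω'.neg_eq, hort' x hx y hy, neg_zero]
  let a := H.prodEquivOfIsCompl K hHK
  let a' := H'.prodEquivOfIsCompl K' hHK'
  have ha : ∀ x, a x = (x.1 : E) + x.2 := fun x => rfl
  have hθ : ∀ x, (a.symm.trans ((φ.prodCongr ψ).trans a')) (a x) = (φ x.1 : E') + ψ x.2 := by
    intro x
    rw [LinearEquiv.trans_apply, a.symm_apply_apply]
    rfl
  refine ⟨a.symm.trans ((φ.prodCongr ψ).trans a'), fun x y => ?_, fun x => ?_⟩
  · obtain ⟨x, rfl⟩ := a.surjective x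
    obtain ⟨y, rfl⟩ := a.surjective y
    rw [hθ, hθ, ha, ha]
    simp only [map_add, LinearMap.add_apply, hφ, hψ, hort _ x.1.2 _ y.2.2, hort2 _ y.1.2 _ x.2.2,
      hort' _ (φ x.1).2 _ (ψ y.2).2, hort2' _ (φ y.1).2 _ (ψ x.2).2]
  · obtain ⟨x, rfl⟩ := a.surjective x
    have : J (a x) = a (⟨J x.1, hH _ x.1.2⟩, ⟨J x.2, hK _ x.2.2⟩) := by
      rw [ha, ha, map_add]
    rw [this, hθ, hθ, map_add, hφJ x.1 ⟨J x.1, hH _ x.1.2⟩ rfl, hψJ x.2 ⟨J x.2, hK _ x.2.2⟩ rfl]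

universe u v

/-- Skew-Hamiltonian endomorphisms with kernels of equal dimensions are symplectically
equivalent. -/
theorem exists_equiv {𝕜 : Type*} [Field 𝕜] (N : ℕ) : ∀ {E : Type u} {E' : Type v} [AddCommGroup E]
    [Module 𝕜 E] [FiniteDimensional 𝕜 E] [AddCommGroup E'] [Module 𝕜 E'] [FiniteDimensional 𝕜 E']
    {ω : LinearMap.BilinForm 𝕜 E} {J : Module.End 𝕜 E}
    {ω' : LinearMap.BilinForm 𝕜 E'} {J' : Module.End 𝕜 E'}, IsSkewHamiltonian ω J →
    IsSkewHamiltonian ω' J' → finrank 𝕜 E = N → (∀ f : 𝕜[X], finrank 𝕜 (LinearMap.ker (aeval J f)) =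
      finrank 𝕜 (LinearMap.ker (aeval J' f))) →
    ∃ θ : E ≃ₗ[𝕜] E', (∀ x y, ω' (θ x) (θ y) = ω x y) ∧ ∀ x, θ (J x) = J' (θ x) := by
  induction N using Nat.strong_induction_on with
  | _ N ih =>
  intro E E' _ _ _ _ _ _ ω J ω' J' h h' hN hJ
  have hfin := finrank_eq_of_ker hJ
  rcases Nat.eq_zero_or_pos N with h0 | hpos
  · have : Subsingleton E := finrank_zero_iff.1 (hN.trans h0)
    refine ⟨LinearEquiv.ofFinrankEq E E' hfin, fun x y => ?_, fun x => ?_⟩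
    · simp [Subsingleton.elim x 0]
    · simp [Subsingleton.elim x 0]
  have hmin := minpoly_eq hJ
  obtain ⟨v, w, hv, hw⟩ := h.exists_residue
  obtain ⟨v', w', hv', hw'⟩ := h'.exists_residue
  -- Both kernels consist of the pairs of multiples of the common minimal polynomial, so the two
  -- generated subspaces are canonically identified.
  have hker : LinearMap.ker (pairMap J v w) = LinearMap.ker (pairMap J' v' w') := by
    ext x
    rw [LinearMap.mem_ker, LinearMap.mem_ker, h.pairMap_eq_zero_iff hw,
      h'.pairMap_eq_zero_iff hw', hmin]
  obtain ⟨φ, hφ⟩ := exists_equiv_range hker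
  have hφJ : ∀ x, φ (J.restrict (apply_mem_range_pairMap J v w) x) =
      J'.restrict (apply_mem_range_pairMap J' v' w') (φ x) := by
    intro x
    obtain ⟨x, rfl⟩ := (pairMap J v w).surjective_rangeRestrict x
    have h1 : J.restrict (apply_mem_range_pairMap J v w) ((pairMap J v w).rangeRestrict x) =
        (pairMap J v w).rangeRestrict (X * x.1, X * x.2) :=
      Subtype.ext (apply_pairMap J v w x)
    have h2 : J'.restrict (apply_mem_range_pairMap J' v' w')
        ((pairMap J' v' w').rangeRestrict x) =
        (pairMap J' v' w').rangeRestrict (X * x.1, X * x.2) :=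
      Subtype.ext (apply_pairMap J' v' w' x)
    rw [h1, hφ, hφ, h2]
  have hc := h.isCompl_range_pairMap hw
  have hc' := h'.isCompl_range_pairMap hw'
  have hK := h.apply_mem_orthogonal (apply_mem_range_pairMap J v w)
  have hK' := h'.apply_mem_orthogonal (apply_mem_range_pairMap J' v' w')
  have hvH : v ∈ LinearMap.range (pairMap J v w) := ⟨(1, 0), by simp [pairMap_apply]⟩
  have hv0 : v ≠ 0 := by
    intro hv0
    have h1 := (hv 1).1 (by rw [hv0, map_zero])
    have : Nontrivial E := nontrivial_of_finrank_pos (hN ▸ hpos)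
    exact minpoly.not_isUnit 𝕜 J (isUnit_of_dvd_one h1)
  have hHpos : 0 < finrank 𝕜 (LinearMap.range (pairMap J v w)) := by
    have : Nontrivial (LinearMap.range (pairMap J v w)) := ⟨⟨v, hvH⟩, 0, fun h => hv0 (congrArg Subtype.val h)⟩
    exact finrank_pos
  have hsum := Submodule.finrank_add_eq_of_isCompl hc
  -- Kernel dimensions add over the invariant splitting, so the equal contributions of the generated
  -- subspaces cancel and the complements satisfy the same hypothesis.
  obtain ⟨ψ, hψ, hψJ⟩ := ih (finrank 𝕜 (ω.orthogonal (LinearMap.range (pairMap J v w)))) (by omega)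
    (h.restrict hK (h.disjoint_orthogonal hc))
    (h'.restrict hK' (h'.disjoint_orthogonal hc')) rfl (fun f => by
      have h1 := finrank_ker_aeval_add hc (apply_mem_range_pairMap J v w) hK f
      have h2 := finrank_ker_aeval_add hc' (apply_mem_range_pairMap J' v' w') hK' f
      have h3 := finrank_ker_aeval_eq hφJ f
      exact Nat.add_left_cancel
        ((h1.symm.trans ((hJ f).trans h2)).trans (congrArg (· + _) h3.symm)))
  refine exists_equiv_of_isCompl h.alt h'.alt hc hc'
    (fun x hx y hy => LinearMap.BilinForm.mem_orthogonal_iff.1 hy x hx)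
    (fun x hx y hy => LinearMap.BilinForm.mem_orthogonal_iff.1 hy x hx) φ ψ ?_ hψ ?_ ?_
    (apply_mem_range_pairMap J v w) hK
  · intro x y
    obtain ⟨x, rfl⟩ := (pairMap J v w).surjective_rangeRestrict x
    obtain ⟨y, rfl⟩ := (pairMap J v w).surjective_rangeRestrict y
    rw [hφ, hφ]
    exact (h'.form_pairMap hw' x y).trans ((hmin ▸ h.form_pairMap hw x y).symm)
  · rintro x y hxy
    have := hφJ x
    rw [show J.restrict (apply_mem_range_pairMap J v w) x = y from Subtype.ext hxy] at this
    exact (congrArg Subtype.val this).symm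
  · rintro x y hxy
    have := hψJ x
    rw [show J.restrict hK x = y from Subtype.ext hxy] at this
    exact (congrArg Subtype.val this).symm

end IsSkewHamiltonian

/-! ### Reindexing of direct sums. -/

section DirectSums

/-- Reindexing a direct sum along an injection whose image contains all nontrivial summands. -/
theorem nonempty_directSum_equiv {R ι κ : Type*} [Ring R] [Fintype ι] [DecidableEq ι] [Fintype κ]
    [DecidableEq κ] {M : ι → Type*} [∀ i, AddCommGroup (M i)] [∀ i, Module R (M i)]
    {N : κ → Type*} [∀ a, AddCommGroup (N a)] [∀ a, Module R (N a)] {g : κ → ι}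
    (hg : Function.Injective g) (h0 : ∀ i, i ∉ Set.range g → Subsingleton (M i))
    (φ : ∀ a, M (g a) ≃ₗ[R] N a) : Nonempty ((⨁ i, M i) ≃ₗ[R] ⨁ a, N a) := by
  let P : (∀ i, M i) →ₗ[R] ∀ a, M (g a) := LinearMap.pi fun a => LinearMap.proj (g a)
  have hP : Function.Bijective P := by
    constructor
    · rw [injective_iff_map_eq_zero]
      intro x hx
      funext i
      by_cases hi : i ∈ Set.range g
      · obtain ⟨a, rfl⟩ := hi
        exact congrFun hx a
      · have := h0 i hi
        exact Subsingleton.elim _ _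
    · intro y
      refine ⟨∑ a, Pi.single (g a) (y a), funext fun b => ?_⟩
      change (∑ a, Pi.single (g a) (y a) : ∀ i, M i) (g b) = y b
      rw [Finset.sum_apply, Finset.sum_eq_single b (fun a _ hab => Pi.single_eq_of_ne
        (fun h => hab (hg h.symm)) _) (fun h => absurd (Finset.mem_univ b) h), Pi.single_eq_same]
  exact ⟨(DirectSum.linearEquivFunOnFintype R ι M).trans ((LinearEquiv.ofBijective P hP).trans
    ((LinearEquiv.piCongrRight φ).trans (DirectSum.linearEquivFunOnFintype R κ N).symm))⟩

theorem exists_equiv_of_map_univ_eq {ι κ X : Type*} [Fintype ι] [Fintype κ] {f : ι → X} {g : κ → X}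
    (h : Finset.univ.val.map f = Finset.univ.val.map g) : ∃ c : ι ≃ κ, ∀ i, g (c i) = f i := by
  classical
  have key : ∀ x, Nonempty ({i // f i = x} ≃ {j // g j = x}) := by
    intro x
    rw [← Fintype.card_eq, Fintype.card_subtype, Fintype.card_subtype]
    have h1 := congrArg (Multiset.count x) h
    rw [Multiset.count_map, Multiset.count_map] at h1
    simpa only [Finset.card_def, Finset.filter_val, eq_comm] using h1
  exact ⟨Equiv.ofFiberEquiv fun x => (key x).some, fun i => Equiv.ofFiberEquiv_map _ i⟩

end DirectSums

/-! ### Elementary divisors of symplectic pairs. -/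

namespace SymplecticPair

variable {𝕜 E E' : Type*} [Field 𝕜] [AddCommGroup E] [Module 𝕜 E] [FiniteDimensional 𝕜 E]
  [AddCommGroup E'] [Module 𝕜 E'] [FiniteDimensional 𝕜 E']

theorem isSkewHamiltonian (σ : SymplecticPair 𝕜 E) : IsSkewHamiltonian σ.ω σ.endo where
  alt := σ.alt
  nondeg := σ.nondeg
  apply_self x := by rw [σ.ω_endo]; exact σ.alt₁ x

/-- The structure theorem for torsion modules may return zero exponents and non-monic primes; the
former give trivial summands and are dropped, the latter are normalised. -/
theorem exists_hasElementaryDivisors (σ : SymplecticPair 𝕜 E) :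
    ∃ s, σ.HasElementaryDivisors s := by
  classical
  obtain ⟨ι, _, p, hp, e, ⟨θ⟩⟩ := equiv_directSum_of_isTorsion
    (AEval.isTorsion_of_finiteDimensional 𝕜 E σ.endo)
  let c := Fintype.equivFin {i // e i ≠ 0}
  let g : Fin (Fintype.card {i // e i ≠ 0}) → ι := fun a => (c.symm a).1
  have hg : Function.Injective g := Subtype.val_injective.comp c.symm.injective
  have hge : ∀ a, e (g a) ≠ 0 := fun a => (c.symm a).2
  have hspan : ∀ a, Submodule.span 𝕜[X] {p (g a) ^ e (g a)} =
      Ideal.span {normalize (p (g a)) ^ e (g a)} := fun a =>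
    Ideal.span_singleton_eq_span_singleton.2 ((associated_normalize _).pow_pow)
  have h0 : ∀ i, i ∉ Set.range g → Subsingleton (𝕜[X] ⧸ Submodule.span 𝕜[X] {p i ^ e i}) := by
    intro i hi
    have hei : e i = 0 := by
      by_contra hei
      exact hi ⟨c ⟨i, hei⟩, congrArg Subtype.val (c.symm_apply_apply ⟨i, hei⟩)⟩
    rw [hei, pow_zero]
    exact Submodule.Quotient.subsingleton_iff.2 Ideal.span_singleton_one
  obtain ⟨ψ⟩ := nonempty_directSum_equiv (R := 𝕜[X]) hg h0
    (fun a => Submodule.quotEquivOfEq _ _ (hspan a))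
  exact ⟨_, _, fun a => normalize (p (g a)), fun a => e (g a), fun a =>
    ⟨monic_normalize (hp _).ne_zero, (normalize_associated _).irreducible_iff.2 (hp _),
      Nat.pos_of_ne_zero (hge a)⟩, rfl, ⟨θ.trans ψ⟩⟩

/-- Equality of elementary divisors implies that the pairs of symplectic forms are isometric. -/
theorem exists_isometry {σ : SymplecticPair 𝕜 E} {σ' : SymplecticPair 𝕜 E'} {s : Multiset 𝕜[X]}
    (h : σ.HasElementaryDivisors s) (h' : σ'.HasElementaryDivisors s) :
    ∃ θ : E ≃ₗ[𝕜] E', ∀ x y, σ'.ω (θ x) (θ y) = σ.ω x y ∧ σ'.ω₁ (θ x) (θ y) = σ.ω₁ x y := by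
  obtain ⟨k, p, e, -, hs, ⟨θ⟩⟩ := h
  obtain ⟨k', p', e', -, hs', ⟨θ'⟩⟩ := h'
  obtain ⟨c, hc⟩ := exists_equiv_of_map_univ_eq (hs'.symm.trans hs)
  obtain ⟨ψ⟩ := nonempty_directSum_equiv (R := 𝕜[X])
    (M := fun i => 𝕜[X] ⧸ Ideal.span {p i ^ e i}) (N := fun i => 𝕜[X] ⧸ Ideal.span {p' i ^ e' i})
    c.injective (fun i hi => absurd (c.surjective i) hi)
    (fun a => Submodule.quotEquivOfEq _ _ (by rw [hc]))
  let Θ : AEval' σ.endo ≃ₗ[𝕜[X]] AEval' σ'.endo := θ.trans (ψ.trans θ'.symm)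
  let φ : E ≃ₗ[𝕜] E' := (AEval'.of σ.endo).trans
    ((Θ.restrictScalars 𝕜).trans (AEval'.of σ'.endo).symm)
  have hφ : ∀ x, φ (σ.endo x) = σ'.endo (φ x) := by
    intro x
    change (AEval'.of σ'.endo).symm (Θ (AEval'.of σ.endo (σ.endo x))) =
      σ'.endo ((AEval'.of σ'.endo).symm (Θ (AEval'.of σ.endo x)))
    rw [← AEval'.X_smul_of, map_smul, AEval'.of_symm_X_smul]
  -- The module isomorphism φ need not respect the forms. It serves only to equate the dimensions of
  -- ker f(J).
  obtain ⟨η, hη, hηJ⟩ := IsSkewHamiltonian.exists_equiv _ σ.isSkewHamiltonian σ'.isSkewHamiltonian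
    rfl (finrank_ker_aeval_eq hφ)
  refine ⟨η, fun x y => ⟨hη x y, ?_⟩⟩
  rw [← σ'.ω_endo, ← σ.ω_endo, ← hηJ, hη]

theorem HasElementaryDivisors.of_isometry {σ : SymplecticPair 𝕜 E} {σ' : SymplecticPair 𝕜 E'}
    {s : Multiset 𝕜[X]} (h : σ.HasElementaryDivisors s) (θ : E ≃ₗ[𝕜] E')
    (hθ : ∀ x y, σ'.ω (θ x) (θ y) = σ.ω x y ∧ σ'.ω₁ (θ x) (θ y) = σ.ω₁ x y) :
    σ'.HasElementaryDivisors s := by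
  obtain ⟨k, p, e, hp, hs, ⟨ψ⟩⟩ := h
  refine ⟨k, p, e, hp, hs, ?_⟩
  have hJ : ∀ x, θ (σ.endo x) = σ'.endo (θ x) := by
    intro x
    rw [← sub_eq_zero]
    refine σ'.nondeg.1 _ fun y => ?_
    obtain ⟨y, rfl⟩ := θ.surjective y
    rw [map_sub, LinearMap.sub_apply, (hθ _ _).1, σ.ω_endo, σ'.ω_endo, (hθ _ _).2, sub_self]
  refine ⟨(LinearEquiv.ofAEval σ.endo (θ.trans (AEval'.of σ'.endo)) fun x => ?_).symm.trans ψ⟩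
  change AEval'.of σ'.endo (θ (σ.endo x)) = _
  rw [hJ]
  exact (AEval'.X_smul_of _ _).symm

end SymplecticPair

/-! ### Functoriality of bivectors and of duals of symplectic forms. -/

section Pushforward

variable {𝕜 E E' F G : Type*} [Field 𝕜] [AddCommGroup E] [Module 𝕜 E]
  [AddCommGroup E'] [Module 𝕜 E'] [AddCommGroup F] [Module 𝕜 F] [AddCommGroup G] [Module 𝕜 G]

theorem pushforward_apply (π : E →ₗ[𝕜] F) (Λ : LinearMap.BilinForm 𝕜 (Dual 𝕜 E))
    (α β : Dual 𝕜 F) : pushforward π Λ α β = Λ (α ∘ₗ π) (β ∘ₗ π) := rfl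

theorem Isomorphic.symm {Λ Λ₁ : LinearMap.BilinForm 𝕜 (Dual 𝕜 E)}
    {Θ Θ₁ : LinearMap.BilinForm 𝕜 (Dual 𝕜 F)} (h : Isomorphic Λ Λ₁ Θ Θ₁) :
    Isomorphic Θ Θ₁ Λ Λ₁ := by
  obtain ⟨φ, rfl, rfl⟩ := h
  refine ⟨φ.symm, ?_, ?_⟩ <;>
  · ext α β
    rw [pushforward_apply, pushforward_apply]
    simp only [LinearMap.comp_assoc, LinearEquiv.symm_comp, LinearMap.comp_id]

theorem Isomorphic.trans {Λ Λ₁ : LinearMap.BilinForm 𝕜 (Dual 𝕜 E)}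
    {Θ Θ₁ : LinearMap.BilinForm 𝕜 (Dual 𝕜 F)} {Ξ Ξ₁ : LinearMap.BilinForm 𝕜 (Dual 𝕜 G)}
    (h : Isomorphic Λ Λ₁ Θ Θ₁) (h' : Isomorphic Θ Θ₁ Ξ Ξ₁) : Isomorphic Λ Λ₁ Ξ Ξ₁ := by
  obtain ⟨φ, rfl, rfl⟩ := h
  obtain ⟨ψ, rfl, rfl⟩ := h'
  exact ⟨φ.trans ψ, rfl, rfl⟩

theorem pushforward_prodBivector (θ : E →ₗ[𝕜] E') (Λ : LinearMap.BilinForm 𝕜 (Dual 𝕜 E))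
    (K : LinearMap.BilinForm 𝕜 (Dual 𝕜 F)) :
    pushforward (θ.prodMap LinearMap.id) (prodBivector Λ K) =
      prodBivector (pushforward θ Λ) K := by
  have h1 : θ.prodMap LinearMap.id ∘ₗ LinearMap.inl 𝕜 E F = LinearMap.inl 𝕜 E' F ∘ₗ θ := by
    ext x <;> simp
  have h2 : θ.prodMap LinearMap.id ∘ₗ LinearMap.inr 𝕜 E F = LinearMap.inr 𝕜 E' F := by
    ext x <;> simp
  ext α β
  simp only [prodBivector, pushforward_apply, LinearMap.add_apply, LinearMap.comp_assoc, h1, h2]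

theorem pushforward_dualBivector [FiniteDimensional 𝕜 E] [FiniteDimensional 𝕜 E']
    {ω : LinearMap.BilinForm 𝕜 E} {ω' : LinearMap.BilinForm 𝕜 E'} (hω : ω.Nondegenerate)
    (hω' : ω'.Nondegenerate) (θ : E ≃ₗ[𝕜] E') (h : ∀ x y, ω' (θ x) (θ y) = ω x y) :
    pushforward θ.toLinearMap (dualBivector ω hω) = dualBivector ω' hω' := by
  ext α β
  have key : ∀ x, ω' (θ x) ∘ₗ θ.toLinearMap = ω x := fun x => LinearMap.ext fun y => h x y
  obtain ⟨x, rfl⟩ := (ω'.toDual hω').surjective α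
  obtain ⟨y, rfl⟩ := (ω'.toDual hω').surjective β
  obtain ⟨x, rfl⟩ := θ.surjective x
  obtain ⟨y, rfl⟩ := θ.surjective y
  rw [pushforward_apply]
  refine (IsMaximal.dualBivector_apply hω (key x).symm (key y).symm).trans ?_
  exact (h x y).symm.trans (IsMaximal.dualBivector_apply hω' rfl rfl).symm

theorem isomorphic_prodBivector_of_isometry [FiniteDimensional 𝕜 E] [FiniteDimensional 𝕜 E']
    {σ : SymplecticPair 𝕜 E} {σ' : SymplecticPair 𝕜 E'} (θ : E ≃ₗ[𝕜] E')
    (hθ : ∀ x y, σ'.ω (θ x) (θ y) = σ.ω x y ∧ σ'.ω₁ (θ x) (θ y) = σ.ω₁ x y)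
    (K K₁ : LinearMap.BilinForm 𝕜 (Dual 𝕜 F)) :
    Isomorphic (prodBivector σ.dual K) (prodBivector σ.dual₁ K₁) (prodBivector σ'.dual K)
      (prodBivector σ'.dual₁ K₁) := by
  refine ⟨θ.prodCongr (LinearEquiv.refl 𝕜 F), ?_, ?_⟩
  · exact (pushforward_prodBivector _ _ _).trans (congrArg (prodBivector · K)
      (pushforward_dualBivector σ.nondeg σ'.nondeg θ fun x y => (hθ x y).1))
  · exact (pushforward_prodBivector _ _ _).trans (congrArg (prodBivector · K₁)
      (pushforward_dualBivector σ.nondeg₁ σ'.nondeg₁ θ fun x y => (hθ x y).2))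

end Pushforward

/-! ### Invariance of the web and of the reduced pair under isomorphism. -/

section Transport

variable {𝕜 W W' : Type*} [Field 𝕜] [AddCommGroup W] [Module 𝕜 W] [AddCommGroup W'] [Module 𝕜 W']
  {Λ Λ₁ : LinearMap.BilinForm 𝕜 (Dual 𝕜 W)} (φ : W ≃ₗ[𝕜] W')

theorem pushforward_symm_dualMap (A : LinearMap.BilinForm 𝕜 (Dual 𝕜 W)) (α β : Dual 𝕜 W) :
    pushforward φ.toLinearMap A (φ.symm.dualMap α) (φ.symm.dualMap β) = A α β := by
  have key : ∀ α : Dual 𝕜 W, φ.symm.dualMap α ∘ₗ φ.toLinearMap = α := fun α =>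
    LinearMap.ext fun x => congrArg α (φ.symm_apply_apply x)
  rw [pushforward_apply, key, key]

theorem ker_pushforward (A : LinearMap.BilinForm 𝕜 (Dual 𝕜 W)) :
    LinearMap.ker (pushforward φ.toLinearMap A) =
      (LinearMap.ker A).map φ.symm.dualMap.toLinearMap := by
  ext α
  constructor
  · intro hα
    obtain ⟨α, rfl⟩ := φ.symm.dualMap.surjective α
    refine ⟨α, LinearMap.ext fun β => ?_, rfl⟩
    rw [← pushforward_symm_dualMap φ, LinearMap.mem_ker.1 hα]
    rfl
  · rintro ⟨α, hα, rfl⟩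
    refine LinearMap.ext fun β => ?_
    obtain ⟨β, rfl⟩ := φ.symm.dualMap.surjective β
    exact (pushforward_symm_dualMap φ A α β).trans (by rw [LinearMap.mem_ker.1 hα]; rfl)

theorem ker_pushforward_add (t : 𝕜) :
    LinearMap.ker (pushforward φ.toLinearMap Λ + t • pushforward φ.toLinearMap Λ₁) =
      (LinearMap.ker (Λ + t • Λ₁)).map φ.symm.dualMap.toLinearMap :=
  ker_pushforward φ (Λ + t • Λ₁)

theorem regularSet_pushforward :
    regularSet (pushforward φ.toLinearMap Λ) (pushforward φ.toLinearMap Λ₁) = regularSet Λ Λ₁ := by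
  ext t
  change finrank 𝕜 _ = finrank 𝕜 _ ↔ finrank 𝕜 _ = finrank 𝕜 _
  rw [ker_pushforward_add, ker_pushforward, LinearEquiv.finrank_map_eq,
    LinearEquiv.finrank_map_eq]

theorem kernelSpan_pushforward :
    kernelSpan (pushforward φ.toLinearMap Λ) (pushforward φ.toLinearMap Λ₁) =
      (kernelSpan Λ Λ₁).map φ.symm.dualMap.toLinearMap := by
  simp only [kernelSpan, regularSet_pushforward, ker_pushforward_add, Submodule.map_iSup]

variable [FiniteDimensional 𝕜 W] [FiniteDimensional 𝕜 W']

theorem hasCharacteristicNumbers_web_pushforward [Infinite 𝕜] (h : IsMaximal Λ Λ₁)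
    (h' : IsMaximal (pushforward φ.toLinearMap Λ) (pushforward φ.toLinearMap Λ₁)) {r : ℕ}
    {n : Fin r → ℕ} (hn : HasCharacteristicNumbers (web Λ Λ₁) n) :
    HasCharacteristicNumbers
      (web (pushforward φ.toLinearMap Λ) (pushforward φ.toLinearMap Λ₁)) n := by
  rw [h.hasCharacteristicNumbers_web_iff] at hn
  obtain ⟨hpos, e, he⟩ := hn
  rw [h'.hasCharacteristicNumbers_web_iff]
  refine ⟨hpos, e.map (φ.symm.dualMap.ofSubmodules _ _ (kernelSpan_pushforward φ).symm), fun t => ?_⟩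
  refine (congrArg₂ (· ⊓ ·) (ker_pushforward_add φ t) (kernelSpan_pushforward φ)).trans ?_
  rw [← Submodule.map_inf _ φ.symm.dualMap.injective, he, Submodule.map_span, ← Set.range_comp]
  congr 2
  funext j
  simp only [Function.comp_apply, map_sum, map_smul, Basis.map_apply]
  rfl

theorem mem_core_pushforward_iff (h : IsMaximal Λ Λ₁)
    (h' : IsMaximal (pushforward φ.toLinearMap Λ) (pushforward φ.toLinearMap Λ₁)) (x : W) :
    φ x ∈ core (pushforward φ.toLinearMap Λ) (pushforward φ.toLinearMap Λ₁) ↔ x ∈ core Λ Λ₁ := by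
  rw [h.mem_core, h'.mem_core, kernelSpan_pushforward]
  constructor
  · intro hx α hα
    exact (congrArg α (φ.symm_apply_apply x)).symm.trans (hx _ ⟨α, hα, rfl⟩)
  · rintro hx _ ⟨α, hα, rfl⟩
    exact (congrArg α (φ.symm_apply_apply x)).trans (hx α hα)

theorem sharp_pushforward (A : LinearMap.BilinForm 𝕜 (Dual 𝕜 W)) (α : Dual 𝕜 W) :
    sharp (pushforward φ.toLinearMap A) (φ.symm.dualMap α) = φ (sharp A α) := by
  refine (evalEquiv 𝕜 W').injective (LinearMap.ext fun β => ?_)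
  change β _ = β _
  obtain ⟨β, rfl⟩ := φ.symm.dualMap.surjective β
  rw [apply_sharp, pushforward_symm_dualMap, ← apply_sharp]
  exact congrArg β (φ.symm_apply_apply _).symm

theorem exists_reduced_isometry [Infinite 𝕜] (h : IsMaximal Λ Λ₁)
    (h' : IsMaximal (pushforward φ.toLinearMap Λ) (pushforward φ.toLinearMap Λ₁))
    {σ : SymplecticPair 𝕜 (ReducedSpace Λ Λ₁)} {σ' : SymplecticPair 𝕜
      (ReducedSpace (pushforward φ.toLinearMap Λ) (pushforward φ.toLinearMap Λ₁))}
    (hσ : IsReducedPair Λ Λ₁ σ)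
    (hσ' : IsReducedPair (pushforward φ.toLinearMap Λ) (pushforward φ.toLinearMap Λ₁) σ') :
    ∃ θ : ReducedSpace Λ Λ₁ ≃ₗ[𝕜]
        ReducedSpace (pushforward φ.toLinearMap Λ) (pushforward φ.toLinearMap Λ₁),
      ∀ x y, σ'.ω (θ x) (θ y) = σ.ω x y ∧ σ'.ω₁ (θ x) (θ y) = σ.ω₁ x y := by
  have hcore : (core Λ Λ₁).map φ.toLinearMap =
      core (pushforward φ.toLinearMap Λ) (pushforward φ.toLinearMap Λ₁) := by
    ext y
    obtain ⟨x, rfl⟩ := φ.surjective y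
    rw [mem_core_pushforward_iff φ h h']
    exact φ.injective.mem_set_image
  let c := φ.ofSubmodules _ _ hcore
  have hc : ∀ x, (c x : W') = φ x := fun x => rfl
  have hker : ((coreKernel Λ Λ₁).submoduleOf (core Λ Λ₁)).map c.toLinearMap =
      (coreKernel (pushforward φ.toLinearMap Λ) (pushforward φ.toLinearMap Λ₁)).submoduleOf
        (core (pushforward φ.toLinearMap Λ) (pushforward φ.toLinearMap Λ₁)) := by
    ext y
    obtain ⟨x, rfl⟩ := c.surjective y
    refine (c.injective.mem_set_image).trans ?_
    rw [SetLike.mem_coe, Submodule.submoduleOf, Submodule.submoduleOf, Submodule.mem_comap,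
      Submodule.mem_comap, Submodule.subtype_apply, Submodule.subtype_apply, hc, h.coreKernel_eq,
      h'.coreKernel_eq, kernelSpan_pushforward]
    constructor
    · rintro ⟨α, hα, hx⟩
      exact ⟨_, ⟨α, hα, rfl⟩, (sharp_pushforward φ Λ α).trans (congrArg φ hx)⟩
    · rintro ⟨_, ⟨α, hα, rfl⟩, hx⟩
      exact ⟨α, hα, φ.injective ((sharp_pushforward φ Λ α).symm.trans hx)⟩
  refine ⟨Submodule.Quotient.equiv _ _ c hker, fun x y => ?_⟩
  obtain ⟨x, rfl⟩ := Submodule.Quotient.mk_surjective _ x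
  obtain ⟨y, rfl⟩ := Submodule.Quotient.mk_surjective _ y
  obtain ⟨α, hα⟩ := h.core_le_image x.2
  obtain ⟨β, hβ⟩ := h.core_le_image₁ x.2
  have e : ∀ α : Dual 𝕜 W, φ.symm.dualMap α (φ (y : W)) = α y := fun α =>
    congrArg α (φ.symm_apply_apply _)
  change σ'.ω (Submodule.Quotient.mk (c x)) (Submodule.Quotient.mk (c y)) = _ ∧
    σ'.ω₁ (Submodule.Quotient.mk (c x)) (Submodule.Quotient.mk (c y)) = _
  rw [hσ.ω_apply h hα, hσ.ω₁_apply h hβ,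
    hσ'.ω_apply h' (α := φ.symm.dualMap α) ((sharp_pushforward φ Λ α).trans (congrArg φ hα)),
    hσ'.ω₁_apply h' (α := φ.symm.dualMap β) ((sharp_pushforward φ Λ₁ β).trans (congrArg φ hβ)),
    hc, e, e]
  exact ⟨rfl, rfl⟩

end Transport

/-! ### Completeness of the invariants and the final assembly. -/

section Classification

variable {𝕜 W W' : Type*} [Field 𝕜] [CharZero 𝕜] [AddCommGroup W] [Module 𝕜 W]
  [FiniteDimensional 𝕜 W] [AddCommGroup W'] [Module 𝕜 W'] [FiniteDimensional 𝕜 W']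
  {Λ Λ₁ : LinearMap.BilinForm 𝕜 (Dual 𝕜 W)} {Λ' Λ₁' : LinearMap.BilinForm 𝕜 (Dual 𝕜 W')}

/-- Classification of maximal pairs. -/
theorem IsMaximal.isomorphic_iff (h : IsMaximal Λ Λ₁) (h' : IsMaximal Λ' Λ₁')
    {σ : SymplecticPair 𝕜 (ReducedSpace Λ Λ₁)} {σ' : SymplecticPair 𝕜 (ReducedSpace Λ' Λ₁')}
    (hσ : IsReducedPair Λ Λ₁ σ) (hσ' : IsReducedPair Λ' Λ₁' σ') :
    Isomorphic Λ Λ₁ Λ' Λ₁' ↔ (∃ s, σ.HasElementaryDivisors s ∧ σ'.HasElementaryDivisors s) ∧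
      ∃ n : Fin (pairCorank Λ Λ₁) → ℕ, HasCharacteristicNumbers (web Λ Λ₁) n ∧
        HasCharacteristicNumbers (web Λ' Λ₁') n := by
  constructor
  · rintro ⟨φ, rfl, rfl⟩
    obtain ⟨s, hs⟩ := σ.exists_hasElementaryDivisors
    obtain ⟨θ, hθ⟩ := exists_reduced_isometry φ h h' hσ hσ'
    obtain ⟨n, hn⟩ := h.isVeroneseWeb
    exact ⟨⟨s, hs, hs.of_isometry θ hθ⟩, n, hn, hasCharacteristicNumbers_web_pushforward φ h h' hn⟩
  · rintro ⟨⟨s, hs, hs'⟩, n, hn, hn'⟩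
    obtain ⟨θ, hθ⟩ := SymplecticPair.exists_isometry hs hs'
    -- Any distinct non-zero weights would do, provided the same ones are used for both pairs; 1, 2,
    -- …, n are such in characteristic zero.
    have hb : ∀ l, ∀ i : Fin (n l), ((i : ℕ) + 1 : 𝕜) ≠ 0 := fun l i => Nat.cast_add_one_ne_zero _
    have hinj : ∀ l, Function.Injective fun i : Fin (n l) => ((i : ℕ) + 1 : 𝕜) := fun l i i' hii =>
      Fin.ext (Nat.cast_injective (add_right_cancel hii))
    exact ((h.isomorphic_prodBivector hσ hn _ hb hinj).trans
      (isomorphic_prodBivector_of_isometry θ hθ _ _)).trans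
      (h'.isomorphic_prodBivector hσ' hn' _ hb hinj).symm

end Classification

end BivectorPair

theorem proposition1p4 {𝕜 : Type*} [RCLike 𝕜] {W : Type*} [AddCommGroup W] [Module 𝕜 W]
    [FiniteDimensional 𝕜 W] (Λ Λ₁ : LinearMap.BilinForm 𝕜 (Dual 𝕜 W)) (hmax : IsMaximal Λ Λ₁) :
    -- (a)
    core Λ Λ₁ ≤ image Λ₁ ∧
    (core Λ Λ₁).dualAnnihilator.map (sharp Λ) = (core Λ Λ₁).dualAnnihilator.map (sharp Λ₁) ∧
    -- (b) the kernels of the restricted 2-forms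
    (∃ (h : core Λ Λ₁ ≤ image Λ) (h₁ : core Λ Λ₁ ≤ image Λ₁),
      (LinearMap.ker (restrictedForm Λ h)).map (core Λ Λ₁).subtype = coreKernel Λ Λ₁ ∧
      (LinearMap.ker (restrictedForm Λ₁ h₁)).map (core Λ Λ₁).subtype = coreKernel Λ Λ₁) ∧
    -- (c)
    IsVeroneseWeb (pairCorank Λ Λ₁) (web Λ Λ₁) ∧
    -- (b) the projections are symplectic
    ∃ σ : SymplecticPair 𝕜 (ReducedSpace Λ Λ₁), IsReducedPair Λ Λ₁ σ ∧
      -- (d) decomposition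
      (∀ n : Fin (pairCorank Λ Λ₁) → ℕ, HasCharacteristicNumbers (web Λ Λ₁) n →
        ∀ (b : ∀ l, Fin (n l) → 𝕜) (hb : ∀ l i, b l i ≠ 0), (∀ l, Function.Injective (b l)) →
          Isomorphic Λ Λ₁
            (prodBivector σ.dual (piBivector fun l => kronecker (b l) (hb l)))
            (prodBivector σ.dual₁ (piBivector fun l => kronecker₁ (b l) (hb l)))) ∧
      -- (d) the invariants are complete
      (∀ {W' : Type*} [AddCommGroup W'] [Module 𝕜 W'] [FiniteDimensional 𝕜 W']
        (Λ' Λ₁' : LinearMap.BilinForm 𝕜 (Dual 𝕜 W')), IsMaximal Λ' Λ₁' →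
        ∀ σ' : SymplecticPair 𝕜 (ReducedSpace Λ' Λ₁'), IsReducedPair Λ' Λ₁' σ' →
          (Isomorphic Λ Λ₁ Λ' Λ₁' ↔
            (∃ s, σ.HasElementaryDivisors s ∧ σ'.HasElementaryDivisors s) ∧
            ∃ n : Fin (pairCorank Λ Λ₁) → ℕ, HasCharacteristicNumbers (web Λ Λ₁) n ∧
              HasCharacteristicNumbers (web Λ' Λ₁') n)) ∧
      -- (e)
      ∀ a : 𝕜, pairCorank Λ Λ₁ < corank (Λ + a • Λ₁) ↔ σ.charpoly.IsRoot (-a) := by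
  have : Infinite 𝕜 := Infinite.of_injective (Nat.cast : ℕ → 𝕜) Nat.cast_injective
  obtain ⟨hker, hker₁, σ, hσ⟩ := hmax.exists_isReducedPair
  refine ⟨hmax.core_le_image₁, ?_, ⟨hmax.core_le_image, hmax.core_le_image₁, hker, hker₁⟩,
    hmax.isVeroneseWeb, σ, hσ, fun n hn b hb hinj => hmax.isomorphic_prodBivector hσ hn b hb hinj,
    fun Λ' Λ₁' hmax' σ' hσ' => hmax.isomorphic_iff hmax' hσ hσ', hσ.isRoot_charpoly_iff hmax⟩
  rw [hmax.dualAnnihilator_core, ← hmax.coreKernel_eq, ← hmax.coreKernel_eq₁]
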